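/- \textbf{Escape rate for holes shrinking to a point.} Let $m$ be Lebesgue measure on $[0,1]$, and let $\mathrm{BV}$ be the space of $m$-classes of real functions of bounded variation on $[0,1]$, where $\|f\|$ is the (essential) variation over $\mathbb R$ of the extension of $f$ by zero. Let $T:[0,1]\to[0,1]$ be piecewise monotone with at most countably many branches: there are at most countably many pairwise disjoint open intervals in $[0,1]$, with union of full measure, on each of which $T$ is strictly monotone and $C^1$ with $T'\ne0$. Let $g=1/|T'|$ on these intervals and $g=0$ elsewhere, and assume that $g$ has bounded variation and $\sup g<1$. Assume that $T$ is mixing: it has exactly one $m$-absolutely continuous invariant probability measure $\mu_0$, and $(T,\mu_0)$ is measure-theoretically mixing. Let $\varphi_0\ge0$ be a density of $\mu_0$. Let $z\in[0,1]$ be such that $\varphi_0$ is continuous at $z$ (relative to $[0,1]$) and such that, for every $k\ge1$, either $T^k$ is continuous at $z$ (relative to $[0,1]$) or $z$ is not a cluster value of $T^k(x)$ as $x\to z$. For $0<\varepsilon\le\varepsilon_1$ let $I_\varepsilon=[a_\varepsilon,b_\varepsilon]\subseteq[0,1]$ be an interval of length $\varepsilon$ containing $z$. If $\varphi_0(z)=0$,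 assume in addition that there is a constant $C$ such that, for all small $\varepsilon>0$, $\mu_0(I_\varepsilon)>0$ and $\|\varphi_0 1_{I_\varepsilon}\|\le \frac C\varepsilon\,\mu_0(I_\varepsilon)$. Let $P_\varepsilon f=P(f1_{[0,1]\setminus I_\varepsilon})$ on $\mathrm{BV}$, where $P$ is the Perron--Frobenius operator of $T$, i.e. $\int_A Pf\,dm=\int_{T^{-1}A}f\,dm$ for all measurable $A$. A real number $\lambda\neq0$ is called the leading eigenvalue of $P_\varepsilon$ if $P_\varepsilon$ is a bounded operator on $\mathrm{BV}$ and $\lambda^{-1}P_\varepsilon=\varphi\otimes\nu+Q$ with $\varphi\in\mathrm{BV}$, $\nu\in\mathrm{BV}'$ and a bounded operator $Q$ such that $P_\varepsilon\varphi=\lambda\varphi$, $\nu P_\varepsilon=\lambda\nu$, $Q\varphi=0$, $\nu Q=0$, $\nu(\varphi)=1$ and $\sum_n\|Q^n\|<\infty$. Then for all sufficiently small $\varepsilon>0$ there is exactly one leading eigenvalue $\lambda_\varepsilon$ of $P_\varepsilon$, and the following hold. 1. If $z$ is not periodic, then $$\lim_{\varepsilon\to0}\frac{1-\lambda_\varepsilon}{\mu_0(I_\varepsilon)}=1\qquad\text{and}\qquad\lim_{\varepsilon\to0}\frac{1-\lambda_\varepsilon}{\varepsilon}=\varphi_0(z).$$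 2. Let $z$ be periodic with minimal period $p$, and let $T^p$ be differentiable at $z$ (relative to $[0,1]$) with derivative $D=(T^p)'(z)$. If $D<0$, assume in addition that $z-a_\varepsilon\le|D|(b_\varepsilon-z)+o(\varepsilon)$ and $b_\varepsilon-z\le|D|(z-a_\varepsilon)+o(\varepsilon)$ as $\varepsilon\to0$ (for instance, $I_\varepsilon$ centred at $z$). Then $$\lim_{\varepsilon\to0}\frac{1-\lambda_\varepsilon}{\varepsilon}=\varphi_0(z)\left(1-\frac1{|D|}\right),$$ and, if $\varphi_0(z)>0$, also $$\lim_{\varepsilon\to0}\frac{1-\lambda_\varepsilon}{\mu_0(I_\varepsilon)}=1-\frac1{|D|}.$$ -/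

import Mathlib

open MeasureTheory Set Filter Topology
open scoped ENNReal

noncomputable section

namespace HoleEscape

/-- Lebesgue measure on `[0,1]`. -/
def leb : Measure ℝ := volume.restrict (Icc (0 : ℝ) 1)

/-! ### The space of functions of bounded variation on the unit interval -/

/-- Essential variation of (the restriction to `[0,1]` of) `u`: the smallest total variation over
the whole real line of a function that equals `u` almost everywhere on `[0,1]` and vanishes off
`[0,1]`. -/
def essVar (u : ℝ → ℝ) : ℝ≥0∞ :=
  ⨅ (v : ℝ → ℝ) (_ : v =ᵐ[leb] u ∧ ∀ x, x ∉ Icc (0 : ℝ) 1 → v x = 0), eVariationOn v univ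

theorem essVar_le {u v : ℝ → ℝ} (h : v =ᵐ[leb] u) (h0 : ∀ x, x ∉ Icc (0 : ℝ) 1 → v x = 0) :
    essVar u ≤ eVariationOn v univ :=
  iInf₂_le v ⟨h, h0⟩

theorem exists_of_essVar_lt {u : ℝ → ℝ} {r : ℝ≥0∞} (h : essVar u < r) :
    ∃ v : ℝ → ℝ, v =ᵐ[leb] u ∧ (∀ x, x ∉ Icc (0 : ℝ) 1 → v x = 0) ∧ eVariationOn v univ < r := by
  simp only [essVar, iInf_lt_iff] at h
  obtain ⟨v, ⟨h1, h2⟩, h3⟩ := h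
  exact ⟨v, h1, h2, h3⟩

theorem essVar_congr {u w : ℝ → ℝ} (h : u =ᵐ[leb] w) : essVar u = essVar w := by
  have key : ∀ {u w : ℝ → ℝ}, u =ᵐ[leb] w → essVar u ≤ essVar w := by
    intro u w h
    refine le_iInf₂ fun v hv => essVar_le (hv.1.trans h.symm) hv.2
  exact le_antisymm (key h) (key h.symm)

theorem eVariationOn_add_le (u v : ℝ → ℝ) :
    eVariationOn (u + v) univ ≤ eVariationOn u univ + eVariationOn v univ := by
  refine iSup_le fun p => ?_
  calc _ ≤ ∑ i ∈ Finset.range p.1, (edist (u (p.2.1 (i + 1))) (u (p.2.1 i))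
            + edist (v (p.2.1 (i + 1))) (v (p.2.1 i))) := by
        refine Finset.sum_le_sum fun i _ => ?_
        exact edist_add_add_le _ _ _ _
    _ ≤ _ := by
        rw [Finset.sum_add_distrib]
        exact add_le_add (eVariationOn.sum_le p.2.2.1 p.2.2.2)
          (eVariationOn.sum_le p.2.2.1 p.2.2.2)

theorem eVariationOn_smul_le (k : ℝ) (u : ℝ → ℝ) :
    eVariationOn (k • u) univ ≤ ENNReal.ofReal |k| * eVariationOn u univ := by
  refine iSup_le fun p => ?_
  calc _ = ∑ i ∈ Finset.range p.1,
            ENNReal.ofReal |k| * edist (u (p.2.1 (i + 1))) (u (p.2.1 i)) := by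
        refine Finset.sum_congr rfl fun i _ => ?_
        simp only [Pi.smul_apply, smul_eq_mul]
        rw [edist_dist, edist_dist, ← ENNReal.ofReal_mul (abs_nonneg k), Real.dist_eq,
          Real.dist_eq, ← mul_sub, abs_mul]
    _ ≤ _ := by
        rw [← Finset.mul_sum]
        gcongr
        exact eVariationOn.sum_le p.2.2.1 p.2.2.2

theorem essVar_add_le (u v : ℝ → ℝ) : essVar (u + v) ≤ essVar u + essVar v := by
  refine ENNReal.le_of_forall_pos_le_add fun δ hδ hfin => ?_
  obtain ⟨hu, hv⟩ := ENNReal.add_lt_top.1 hfin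
  have hδ2 : ((δ : ℝ≥0∞) / 2) ≠ 0 := by
    simp [ENNReal.div_eq_zero_iff, hδ.ne']
  obtain ⟨u', hu1, hu2, hu3⟩ := exists_of_essVar_lt (ENNReal.lt_add_right hu.ne hδ2)
  obtain ⟨v', hv1, hv2, hv3⟩ := exists_of_essVar_lt (ENNReal.lt_add_right hv.ne hδ2)
  calc essVar (u + v) ≤ eVariationOn (u' + v') univ :=
        essVar_le (hu1.add hv1) fun x hx => by simp [hu2 x hx, hv2 x hx]
    _ ≤ eVariationOn u' univ + eVariationOn v' univ := eVariationOn_add_le _ _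
    _ ≤ (essVar u + δ / 2) + (essVar v + δ / 2) := add_le_add hu3.le hv3.le
    _ = essVar u + essVar v + δ := by
        rw [add_add_add_comm, ENNReal.add_halves]

theorem essVar_smul_le (k : ℝ) (u : ℝ → ℝ) :
    essVar (k • u) ≤ ENNReal.ofReal |k| * essVar u := by
  rcases eq_or_ne k 0 with rfl | hk
  · rw [zero_smul]
    refine (essVar_le (v := 0) (by rfl) (by simp)).trans ?_
    rw [eVariationOn.constant_on (by rintro _ ⟨x, -, rfl⟩ _ ⟨y, -, rfl⟩; rfl)]
    exact bot_le
  have h0 : ENNReal.ofReal |k| ≠ 0 := by simpa using hk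
  rw [mul_comm, ← ENNReal.div_le_iff h0 ENNReal.ofReal_ne_top]
  refine le_iInf₂ fun v hv => ?_
  rw [ENNReal.div_le_iff h0 ENNReal.ofReal_ne_top, mul_comm]
  refine (essVar_le (v := k • v) (hv.1.const_smul k) fun x hx => ?_).trans
    (eVariationOn_smul_le k v)
  simp [hv.2 x hx]

theorem essVar_zero : essVar 0 = 0 := by
  refine le_antisymm ((essVar_le (v := 0) (by rfl) (by simp)).trans ?_) bot_le
  exact (eVariationOn.constant_on (by
    rintro _ ⟨x, -, rfl⟩ _ ⟨y, -, rfl⟩; rfl)).le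

theorem ae_eq_zero_of_essVar_eq_zero {u : ℝ → ℝ} (h : essVar u = 0) : u =ᵐ[leb] 0 := by
  have hn : ∀ n : ℕ, ∀ᵐ x ∂leb, |u x| ≤ 1 / ((n : ℝ) + 1) := by
    intro n
    have hpos : (0 : ℝ) < 1 / ((n : ℝ) + 1) := Nat.one_div_pos_of_nat
    have hlt : essVar u < ENNReal.ofReal (1 / ((n : ℝ) + 1)) := by
      rw [h]; exact ENNReal.ofReal_pos.2 hpos
    obtain ⟨v, hv1, hv2, hv3⟩ := exists_of_essVar_lt hlt
    filter_upwards [hv1] with x hx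
    have h2 : v 2 = 0 := hv2 2 (by norm_num)
    have := (eVariationOn.edist_le v (mem_univ x) (mem_univ (2 : ℝ))).trans hv3.le
    rw [h2, edist_dist, ENNReal.ofReal_le_ofReal_iff hpos.le, Real.dist_eq, sub_zero, hx] at this
    exact this
  filter_upwards [ae_all_iff.2 hn] with x hx
  have : |u x| ≤ 0 := ge_of_tendsto' tendsto_one_div_add_atTop_nhds_zero_nat hx
  simpa using this

/-- Lebesgue classes of real functions of bounded variation on `[0,1]`, as a linear space. -/
def bvSubmodule : Submodule ℝ (ℝ →ₘ[leb] ℝ) where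
  carrier := {f | essVar f < ∞}
  zero_mem' := by
    have : essVar ((0 : ℝ →ₘ[leb] ℝ) : ℝ → ℝ) = 0 := by
      rw [essVar_congr AEEqFun.coeFn_zero, essVar_zero]
    simp [this]
  add_mem' := by
    intro f g hf hg
    simp only [mem_ofPred_eq] at *
    rw [essVar_congr (AEEqFun.coeFn_add f g)]
    exact (essVar_add_le _ _).trans_lt (ENNReal.add_lt_top.2 ⟨hf, hg⟩)
  smul_mem' := by
    intro k f hf
    simp only [mem_ofPred_eq] at *
    rw [essVar_congr (AEEqFun.coeFn_smul k f)]
    exact (essVar_smul_le _ _).trans_lt (ENNReal.mul_lt_top ENNReal.ofReal_lt_top hf)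

/-- The space `BV`: Lebesgue classes of real functions of bounded variation on `[0,1]`. -/
def BV : Type := bvSubmodule

instance : AddCommGroup BV := inferInstanceAs (AddCommGroup bvSubmodule)

instance : Module ℝ BV := inferInstanceAs (Module ℝ bvSubmodule)

/-- A representative of an element of `BV`. -/
def BV.fn (f : BV) : ℝ → ℝ := (Subtype.val (p := fun g => g ∈ bvSubmodule) f : ℝ →ₘ[leb] ℝ)

theorem BV.essVar_lt_top (f : BV) : essVar f.fn < ∞ :=
  Subtype.property (p := fun g => g ∈ bvSubmodule) f

theorem BV.fn_add (f g : BV) : (f + g).fn =ᵐ[leb] f.fn + g.fn := AEEqFun.coeFn_add _ _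

theorem BV.fn_smul (k : ℝ) (f : BV) : (k • f).fn =ᵐ[leb] k • f.fn := AEEqFun.coeFn_smul _ _

/-- The norm of `BV` is the (essential) variation of the extension by zero to the real line. -/
instance : Norm BV := ⟨fun f => (essVar f.fn).toReal⟩

theorem BV.norm_def (f : BV) : ‖f‖ = (essVar f.fn).toReal := rfl

theorem BV.normCore : NormedSpace.Core ℝ BV where
  norm_nonneg f := ENNReal.toReal_nonneg
  norm_smul k f := by
    have key : ∀ (k : ℝ) (f : BV), ‖k • f‖ ≤ ‖k‖ * ‖f‖ := by
      intro k f
      rw [BV.norm_def, BV.norm_def, essVar_congr (BV.fn_smul k f), Real.norm_eq_abs,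
        ← ENNReal.toReal_ofReal (abs_nonneg k), ← ENNReal.toReal_mul]
      exact ENNReal.toReal_mono
        (ENNReal.mul_lt_top ENNReal.ofReal_lt_top f.essVar_lt_top).ne (essVar_smul_le _ _)
    rcases eq_or_ne k 0 with rfl | hk
    · refine le_antisymm (key 0 f) ?_
      rw [norm_zero, zero_mul]
      exact ENNReal.toReal_nonneg
    · refine le_antisymm (key k f) ?_
      have h := key k⁻¹ (k • f)
      rw [smul_smul, inv_mul_cancel₀ hk, one_smul, norm_inv] at h
      have hk' : 0 < ‖k‖ := norm_pos_iff.2 hk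
      calc ‖k‖ * ‖f‖ ≤ ‖k‖ * (‖k‖⁻¹ * ‖k • f‖) := by gcongr
        _ = ‖k • f‖ := by field_simp
  norm_triangle f g := by
    rw [BV.norm_def, BV.norm_def, BV.norm_def, essVar_congr (BV.fn_add f g),
      ← ENNReal.toReal_add f.essVar_lt_top.ne g.essVar_lt_top.ne]
    exact ENNReal.toReal_mono
      (ENNReal.add_lt_top.2 ⟨f.essVar_lt_top, g.essVar_lt_top⟩).ne (essVar_add_le _ _)
  norm_eq_zero_iff f := by
    constructor
    · intro h
      rw [BV.norm_def, ENNReal.toReal_eq_zero_iff] at h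
      have h0 : essVar f.fn = 0 := h.resolve_right f.essVar_lt_top.ne
      refine Subtype.ext (AEEqFun.ext ?_)
      exact (ae_eq_zero_of_essVar_eq_zero h0).trans AEEqFun.coeFn_zero.symm
    · rintro rfl
      have : (0 : BV).fn =ᵐ[leb] 0 := AEEqFun.coeFn_zero
      rw [BV.norm_def, essVar_congr this, essVar_zero, ENNReal.toReal_zero]

instance : NormedAddCommGroup BV := NormedAddCommGroup.ofCore BV.normCore

instance : NormedSpace ℝ BV := NormedSpace.ofCore BV.normCore

/-! ### Piecewise expanding interval maps -/

/-- The weight `g`: it is `1 / |T'|` inside the branch domains `(c i, d i)`, and `0` elsewhere. -/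
def weight (T : ℝ → ℝ) (c d : ℕ → ℝ) : ℝ → ℝ :=
  (⋃ i, Ioo (c i) (d i)).indicator fun x => 1 / |deriv T x|

/-- `T` maps `[0,1]` to itself and is piecewise monotone with countably many `C¹` branches; the
interiors of the monotonicity intervals are the open intervals `(c i, d i)` (empty if `d i ≤ c i`,
so that finitely many branches are included), which fill `[0,1]` up to a null set. The weight `g`
has bounded variation on the real line, and its supremum is smaller than one. Only the restriction
of `T` to `[0,1]` matters. -/
structure IsPiecewiseExpanding (T : ℝ → ℝ) (c d : ℕ → ℝ) : Prop where
  mapsTo : MapsTo T (Icc 0 1) (Icc 0 1)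
  branch_subset : ∀ i, Ioo (c i) (d i) ⊆ Icc 0 1
  branch_disjoint : Pairwise fun i j => Disjoint (Ioo (c i) (d i)) (Ioo (c j) (d j))
  branch_full : leb (⋃ i, Ioo (c i) (d i))ᶜ = 0
  branch_monotone : ∀ i, StrictMonoOn T (Ioo (c i) (d i)) ∨ StrictAntiOn T (Ioo (c i) (d i))
  branch_contDiff : ∀ i, ContDiffOn ℝ 1 T (Ioo (c i) (d i))
  branch_deriv_ne_zero : ∀ i, ∀ x ∈ Ioo (c i) (d i), deriv T x ≠ 0
  weight_bv : BoundedVariationOn (weight T c d) univ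
  weight_lt_one : ∃ θ < 1, ∀ x, weight T c d x ≤ θ

/-- `μ` is an absolutely continuous `T`-invariant probability measure on `[0,1]`. -/
structure IsAcip (T : ℝ → ℝ) (μ : Measure ℝ) : Prop where
  prob : μ univ = 1
  ac : μ ≪ leb
  invariant : ∀ B, MeasurableSet B → μ (T ⁻¹' B) = μ B

/-- `T` is mixing: it has exactly one absolutely continuous invariant probability measure,
namely `μ`, and `T` is mixing with respect to `μ`. -/
structure IsMixing (T : ℝ → ℝ) (μ : Measure ℝ) : Prop where
  acip : IsAcip T μ
  unique : ∀ ν, IsAcip T ν → ν = μ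
  mixing : ∀ A B, MeasurableSet A → MeasurableSet B →
    Tendsto (fun n : ℕ => μ (A ∩ T^[n] ⁻¹' B)) atTop (𝓝 (μ A * μ B))

/-- The measure on `[0,1]` with density `φ` with respect to Lebesgue measure. -/
def densityMeasure (φ : ℝ → ℝ) : Measure ℝ := leb.withDensity fun x => ENNReal.ofReal (φ x)

/-! ### The open system with hole `H` -/

/-- `P` is the operator `f ↦ P₀ (f · 1_{[0,1] \ H})` on `BV`, where `P₀` is the Perron-Frobenius
operator of `T`: the function `P₀ f` is characterised by `∫_A P₀ f dm = ∫_{T⁻¹ A} f dm` for all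
measurable sets `A`. -/
def IsTransferOperator (T : ℝ → ℝ) (H : Set ℝ) (P : BV →L[ℝ] BV) : Prop :=
  ∀ (f : BV) (A : Set ℝ), MeasurableSet A →
    ∫ x in A, (P f).fn x ∂leb = ∫ x in T ⁻¹' A \ H, f.fn x ∂leb

/-- `l` is the leading eigenvalue of the transfer operator `P` on `BV` of the system with hole `H`:
`l⁻¹ P = φ ⊗ ν + Q` where `P φ = l φ`, `ν P = l ν`, `Q φ = 0`, `ν Q = 0`, `ν φ = 1`, and the norms
of the powers of `Q` are summable. -/
def IsLeadingEigenvalue (T : ℝ → ℝ) (H : Set ℝ) (l : ℝ) : Prop :=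
  ∃ (P Q : BV →L[ℝ] BV) (φ : BV) (ν : BV →L[ℝ] ℝ),
    IsTransferOperator T H P ∧
    l ≠ 0 ∧
    l⁻¹ • P = ν.smulRight φ + Q ∧
    P φ = l • φ ∧ ν.comp P = l • ν ∧ Q φ = 0 ∧ ν.comp Q = 0 ∧ ν φ = 1 ∧
    Summable fun n : ℕ => ‖Q ^ n‖

end HoleEscape

end

open HoleEscape

namespace HoleEscape

/-! ### Variation -/

/-! The operator L of the open system is a perturbation of the closed Perron–Frobenius operator P
that is small only from `BV` to L¹: ‖(P − L)f‖₁ ≤ m(H)‖f‖. Two facts make this enough. The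
Lasota–Yorke inequality `exists_lasotaYorke` holds with constants independent of the interval
removed, so the powers of all open operators are uniformly bounded. And `BV` embeds compactly into
L¹, which together with mixing and uniqueness of the invariant density yields uniform L¹ decay of Pⁿ
on functions of integral zero (`exists_exact`). For small holes some fixed power of L therefore
contracts the kernel of the integral in `BV`, while the integral is nearly invariant
(`IsNearlyMarkov`). From this alone a contraction argument gives the eigenvector, and the
eigenfunctional ν is the limit of λ⁻ⁿ∫Lⁿ, with error at most a constant times m(H) ρⁿ ‖f‖
(`exists_decomposition`). The factor m(H) in that error is decisive.

For the escape rate let φ be the invariant density, so that (1 − λ) ν(φ) = ν(φ − Lφ). Stopping the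
limit for ν at time n turns the right side into λ⁻ⁿ times the μ₀-mass of those points of the hole
that do not return at times 1, …, n (`int_pow_sub`). The error is O(ε ρⁿ ‖φ − Lφ‖), and ‖φ − Lφ‖ =
‖P(φ 1_H)‖ = O(μ₀(H)/ε), so after division by μ₀(H) it is O(ρⁿ). Letting ε → 0 for fixed n, and then
n → ∞, identifies the limit of (1 − λ)/μ₀(H) with the limiting proportion of points that do not
return.

If z is not periodic, nothing returns and the proportion is 1. If z has period p, returns happen
only at multiples of p, and T^p is close to x ↦ z + D(x − z); to first order the returning points
fill the preimage of the hole under this map, of length ε/|D|. The side condition for D < 0 keeps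
that preimage inside the hole and makes later returns negligible. Where φ₀(z) > 0, invariance forces
|D| ≥ 1 (`one_le_abs_deriv`). Where φ₀(z) = 0 and z is periodic, the bound 1 − λ = O(μ₀(H)) = o(ε)
suffices. -/

theorem enorm_le_of_abs_le {x a : ℝ} (h : |x| ≤ a) : ‖x‖ₑ ≤ ENNReal.ofReal a := by
  rw [← ofReal_norm]
  exact ENNReal.ofReal_le_ofReal h

theorem eVariationOn_add_le' (F G : ℝ → ℝ) (s : Set ℝ) :
    eVariationOn (fun x => F x + G x) s ≤ eVariationOn F s + eVariationOn G s := by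
  refine iSup_le fun p => ?_
  calc _ ≤ ∑ i ∈ Finset.range p.1, (edist (F (p.2.1 (i + 1))) (F (p.2.1 i))
            + edist (G (p.2.1 (i + 1))) (G (p.2.1 i))) :=
        Finset.sum_le_sum fun i _ => edist_add_add_le _ _ _ _
    _ ≤ _ := by
        rw [Finset.sum_add_distrib]
        exact add_le_add (eVariationOn.sum_le p.2.2.1 p.2.2.2)
          (eVariationOn.sum_le p.2.2.1 p.2.2.2)

theorem eVariationOn_const_sub_le (k : ℝ) (F : ℝ → ℝ) (s : Set ℝ) :
    eVariationOn (fun x => k - F x) s ≤ eVariationOn F s := by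
  refine iSup_le fun p => ?_
  simp only [edist_sub_left]
  exact eVariationOn.sum_le p.2.2.1 p.2.2.2

theorem eVariationOn_mul_le {F G : ℝ → ℝ} {s : Set ℝ} {A B : ℝ≥0∞}
    (hF : ∀ x ∈ s, ‖F x‖ₑ ≤ A) (hG : ∀ x ∈ s, ‖G x‖ₑ ≤ B) :
    eVariationOn (fun x => F x * G x) s ≤ eVariationOn F s * B + A * eVariationOn G s := by
  refine iSup_le fun p => ?_
  calc _ ≤ ∑ i ∈ Finset.range p.1, (edist (F (p.2.1 (i + 1))) (F (p.2.1 i)) * B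
            + A * edist (G (p.2.1 (i + 1))) (G (p.2.1 i))) := by
        refine Finset.sum_le_sum fun i _ => ?_
        simp only [edist_eq_enorm_sub]
        set x := (p.2.1 (i + 1) : ℝ)
        set y := (p.2.1 i : ℝ)
        calc ‖F x * G x - F y * G y‖ₑ = ‖(F x - F y) * G x + F y * (G x - G y)‖ₑ := by
              congr 1; ring
          _ ≤ ‖(F x - F y) * G x‖ₑ + ‖F y * (G x - G y)‖ₑ := enorm_add_le _ _
          _ ≤ _ := by
              rw [enorm_mul, enorm_mul]
              gcongr
              · exact hG _ (p.2.2.2 _)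
              · exact hF _ (p.2.2.2 _)
    _ = (∑ i ∈ Finset.range p.1, edist (F (p.2.1 (i + 1))) (F (p.2.1 i))) * B
          + A * ∑ i ∈ Finset.range p.1, edist (G (p.2.1 (i + 1))) (G (p.2.1 i)) := by
        rw [Finset.sum_add_distrib, Finset.sum_mul, Finset.mul_sum]
    _ ≤ _ := by
        gcongr
        · exact eVariationOn.sum_le p.2.2.1 p.2.2.2
        · exact eVariationOn.sum_le p.2.2.1 p.2.2.2

theorem eVariationOn_sum_le {ι : Type*} (t : Finset ι) (F : ι → ℝ → ℝ) (s : Set ℝ) :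
    eVariationOn (fun x => ∑ i ∈ t, F i x) s ≤ ∑ i ∈ t, eVariationOn (F i) s := by
  classical
  induction t using Finset.induction_on with
  | empty =>
    simp only [Finset.sum_empty]
    exact (eVariationOn.constant_on (by rintro _ ⟨x, -, rfl⟩ _ ⟨y, -, rfl⟩; rfl)).le
  | insert a t ha ih =>
    simp only [Finset.sum_insert ha]
    exact (eVariationOn_add_le' _ _ s).trans (by gcongr)

/-- Lower semicontinuity of the variation, used both for infinite sums over branches and for L¹
limits. -/
theorem eVariationOn_le_of_tendsto {ι : Type*} {l : Filter ι} [l.NeBot] {F : ι → ℝ → ℝ}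
    {G : ℝ → ℝ} {s : Set ℝ} {C : ℝ≥0∞} (h : ∀ x ∈ s, Tendsto (fun i => F i x) l (𝓝 (G x)))
    (hC : ∀ᶠ i in l, eVariationOn (F i) s ≤ C) : eVariationOn G s ≤ C := by
  by_contra! hlt
  obtain ⟨i, h1, h2⟩ := ((eVariationOn.lowerSemicontinuous_aux h hlt).and hC).exists
  exact absurd h1 (not_lt.2 h2)

theorem eVariationOn_tsum_le {F : ℕ → ℝ → ℝ} {s : Set ℝ}
    (h : ∀ x ∈ s, Summable fun i => F i x) :
    eVariationOn (fun x => ∑' i, F i x) s ≤ ∑' i, eVariationOn (F i) s := by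
  refine eVariationOn_le_of_tendsto (l := atTop) (F := fun (t : Finset ℕ) x => ∑ i ∈ t, F i x)
    (fun x hx => (h x hx).hasSum) (Eventually.of_forall fun t => ?_)
  exact (eVariationOn_sum_le t F s).trans (ENNReal.sum_le_tsum _)

theorem Monotone.eVariationOn_le_of_abs {f : ℝ → ℝ} (hf : Monotone f) {u v : ℝ}
    (hu : ∀ x, u ≤ f x) (hv : ∀ x, f x ≤ v) (s : Set ℝ) :
    eVariationOn f s ≤ ENNReal.ofReal (v - u) := by
  refine (eVariationOn.mono f (subset_univ s)).trans ?_
  rw [eVariationOn.eq_biSup_inter_Icc]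
  refine iSup_le fun p => iSup_le fun hp => ?_
  obtain ⟨h1, h2, h3⟩ := hp
  rw [univ_inter]
  calc eVariationOn f (Icc p.1 p.2) = eVariationOn f (univ ∩ Icc p.1 p.2) := by rw [univ_inter]
    _ ≤ ENNReal.ofReal (f p.2 - f p.1) :=
        (MonotoneOn.eVariationOn_eq (hf.monotoneOn _) (mem_univ _) (mem_univ _)).le
    _ ≤ _ := ENNReal.ofReal_le_ofReal (by linarith [hu p.1, hv p.2])

/-- A function on a subset of the line extends to the line without increasing its variation. -/
theorem exists_extension_eVariationOn_le {f : ℝ → ℝ} {s : Set ℝ} (hs : s.Nonempty)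
    (hf : eVariationOn f s ≠ ∞) :
    ∃ F : ℝ → ℝ, EqOn F f s ∧ eVariationOn F univ ≤ eVariationOn f s := by
  obtain ⟨a, ha⟩ := hs
  set W := (eVariationOn f s).toReal with hW
  have hloc : LocallyBoundedVariationOn f s :=
    BoundedVariationOn.locallyBoundedVariationOn (f := f) (s := s) hf
  set p : ℝ → ℝ := fun x => (eVariationOn f (s ∩ Iic x)).toReal with hp
  have hfin : ∀ x, eVariationOn f (s ∩ Iic x) ≠ ∞ := fun x =>
    ne_top_of_le_ne_top hf (eVariationOn.mono f inter_subset_left)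
  have hpm : Monotone p := fun x y hxy =>
    ENNReal.toReal_mono (hfin y) (eVariationOn.mono f
      (inter_subset_inter_right _ (Iic_subset_Iic.2 hxy)))
  have hpW : ∀ x, p x ≤ W := fun x =>
    ENNReal.toReal_mono hf (eVariationOn.mono f inter_subset_left)
  have hdist : ∀ x ∈ s, ∀ y ∈ s, x ≤ y → |f x - f y| ≤ p y - p x := by
    intro x hx y hy hxy
    have h1 : eVariationOn f (s ∩ Iic x) + eVariationOn f {x, y} ≤ eVariationOn f (s ∩ Iic y) := by
      refine (eVariationOn.add_le_union f ?_).trans (eVariationOn.mono f ?_)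
      · rintro u ⟨-, hu⟩ v hv
        rcases hv with rfl | rfl
        · exact hu
        · exact le_trans hu hxy
      · rintro u (⟨h1, h2⟩ | h)
        · exact ⟨h1, le_trans h2 hxy⟩
        · rcases h with rfl | rfl
          · exact ⟨hx, hxy⟩
          · exact ⟨hy, mem_Iic.2 le_rfl⟩
    rw [eVariationOn.pair, edist_dist] at h1
    have h2 := ENNReal.toReal_mono (hfin y) h1
    rw [ENNReal.toReal_add (hfin x) ENNReal.ofReal_ne_top, ENNReal.toReal_ofReal dist_nonneg,
      Real.dist_eq] at h2
    simp only [hp]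
    linarith
  have hinj : ∀ x ∈ s, ∀ y ∈ s, |f x - f y| ≤ |p x - p y| := by
    intro x hx y hy
    rcases le_total x y with h | h
    · exact (hdist x hx y hy h).trans ((le_abs_self _).trans (abs_sub_comm _ _).le)
    · rw [abs_sub_comm]
      exact (hdist y hy x hx h).trans (le_abs_self _)
  classical
  let q : ℝ → ℝ := fun t => if h : ∃ x ∈ s, p x = t then f h.choose else 0
  have hq : ∀ x ∈ s, q (p x) = f x := by
    intro x hx
    have h : ∃ y ∈ s, p y = p x := ⟨x, hx, rfl⟩
    have h2 : q (p x) = f h.choose := dif_pos h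
    rw [h2]
    have := hinj _ h.choose_spec.1 x hx
    rw [h.choose_spec.2, sub_self, abs_zero] at this
    linarith [abs_nonpos_iff.1 this]
  have hlip : LipschitzOnWith 1 q (p '' s) := by
    refine LipschitzOnWith.of_dist_le_mul ?_
    rintro _ ⟨x, hx, rfl⟩ _ ⟨y, hy, rfl⟩
    rw [hq x hx, hq y hy, NNReal.coe_one, one_mul, Real.dist_eq, Real.dist_eq]
    exact hinj x hx y hy
  obtain ⟨Q, hQ, hQe⟩ := hlip.extend_real
  refine ⟨fun x => Q (p x), fun x hx => ?_, ?_⟩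
  · change Q (p x) = f x
    rw [← hQe (mem_image_of_mem p hx), hq x hx]
  · have h1 := LipschitzOnWith.comp_eVariationOn_le (f := Q) (C := 1) (t := univ)
      (hQ.lipschitzOnWith) (g := p) (s := univ) (fun _ _ => mem_univ _)
    refine (h1.trans ?_)
    rw [ENNReal.coe_one, one_mul]
    refine (Monotone.eVariationOn_le_of_abs hpm (fun x => ENNReal.toReal_nonneg) hpW univ).trans ?_
    rw [sub_zero, hW, ENNReal.ofReal_toReal hf]

theorem measurable_of_eVariationOn_ne_top {f : ℝ → ℝ} (hf : eVariationOn f univ ≠ ∞) :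
    Measurable f := by
  obtain ⟨p, q, hp, hq, h⟩ :=
    (BoundedVariationOn.locallyBoundedVariationOn (f := f) (s := univ) hf).exists_monotoneOn_sub_monotoneOn
  rw [h]
  exact (monotoneOn_univ.1 hp).measurable.sub (monotoneOn_univ.1 hq).measurable

theorem eVariationOn_indicator_one_le {J : Set ℝ} (hJ : J.OrdConnected) :
    eVariationOn (J.indicator fun _ => (1 : ℝ)) univ ≤ 2 := by
  classical
  by_cases hne : J.Nonempty
  -- The indicator is a sum of two monotone steps of variation at most 1: `f` jumps to 1 on reaching
  -- `J`, and `-1 - g` drops to -1 on leaving it.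
  · let f : ℝ → ℝ := fun x => if ∃ y ∈ J, y ≤ x then 1 else 0
    let g : ℝ → ℝ := fun x => if ∃ y ∈ J, x ≤ y then -1 else 0
    have hf : Monotone f := by
      intro x y hxy
      simp only [f]
      split_ifs with h1 h2
      · exact le_refl _
      · obtain ⟨u, hu, hu2⟩ := h1
        exact absurd ⟨u, hu, hu2.trans hxy⟩ h2
      · norm_num
      · exact le_refl _
    have hg : Monotone g := by
      intro x y hxy
      simp only [g]
      split_ifs with h1 h2 h2
      · exact le_refl _
      · norm_num
      · obtain ⟨u, hu, hu2⟩ := h2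
        exact absurd ⟨u, hu, hxy.trans hu2⟩ h1
      · exact le_refl _
    have hsum : (J.indicator fun _ => (1 : ℝ)) = fun x => f x + (-1 - g x) := by
      funext x
      by_cases hx : x ∈ J
      · rw [indicator_of_mem hx]
        simp only [f, g]
        rw [if_pos ⟨x, hx, le_refl _⟩, if_pos ⟨x, hx, le_refl _⟩]; norm_num
      · rw [indicator_of_notMem hx]
        simp only [f, g]
        obtain ⟨w, hw⟩ := hne
        rcases le_total w x with h | h
        · rw [if_pos ⟨w, hw, h⟩, if_neg]
          · norm_num
          · rintro ⟨y, hy, hxy⟩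
            exact hx (hJ.out hw hy ⟨h, hxy⟩)
        · rw [if_neg, if_pos ⟨w, hw, h⟩]
          · norm_num
          · rintro ⟨y, hy, hxy⟩
            exact hx (hJ.out hy hw ⟨hxy, h⟩)
    have e1 : eVariationOn f univ ≤ 1 := by
      refine (Monotone.eVariationOn_le_of_abs hf (u := 0) (v := 1) ?_ ?_ univ).trans (by simp)
      · intro x; simp only [f]; split_ifs <;> norm_num
      · intro x; simp only [f]; split_ifs <;> norm_num
    have e2 : eVariationOn (fun x => -1 - g x) univ ≤ 1 := by
      refine (eVariationOn_const_sub_le (-1) g univ).trans ((Monotone.eVariationOn_le_of_abs hg (u := -1) (v := 0) ?_ ?_ univ).trans (by simp))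
      · intro x; simp only [g]; split_ifs <;> norm_num
      · intro x; simp only [g]; split_ifs <;> norm_num
    rw [hsum]
    refine (eVariationOn_add_le' _ _ univ).trans ((add_le_add e1 e2).trans ?_)
    norm_num
  · rw [not_nonempty_iff_eq_empty.1 hne, indicator_empty]
    rw [eVariationOn.constant_on (by rintro _ ⟨x, -, rfl⟩ _ ⟨y, -, rfl⟩; rfl)]
    exact bot_le

/-- Cutting a function off outside an interval. -/
theorem eVariationOn_indicator_le {J : Set ℝ} (hJ : J.OrdConnected) {F : ℝ → ℝ} {A : ℝ≥0∞}
    (hA : ∀ x ∈ J, ‖F x‖ₑ ≤ A) :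
    eVariationOn (J.indicator F) univ ≤ eVariationOn F J + 2 * A := by
  rcases J.eq_empty_or_nonempty with rfl | hne
  · rw [indicator_empty, eVariationOn.constant_on (by rintro _ ⟨x, -, rfl⟩ _ ⟨y, -, rfl⟩; rfl)]
    exact bot_le
  by_cases hfin : eVariationOn F J = ∞
  · rw [hfin, top_add]; exact le_top
  by_cases hAfin : A = ∞
  · rw [hAfin]; simp
  obtain ⟨F₁, h1, h2⟩ := exists_extension_eVariationOn_le hne hfin
  set r := A.toReal
  -- Truncation at the level `A` changes nothing on `J` and does not increase the variation; it
  -- makes the bound on `J` global, as the product rule requires.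
  let F₂ : ℝ → ℝ := fun x => max (-r) (min r (F₁ x))
  have hr : 0 ≤ r := ENNReal.toReal_nonneg
  have hb : ∀ x, ‖F₂ x‖ₑ ≤ A := by
    intro x
    rw [← ENNReal.ofReal_toReal hAfin]
    refine enorm_le_of_abs_le (abs_le.2 ⟨le_max_left _ _, max_le (by linarith) (min_le_left _ _)⟩)
  have hV : eVariationOn F₂ univ ≤ eVariationOn F J := by
    have hl : LipschitzWith 1 fun t : ℝ => max (-r) (min r t) :=
      (LipschitzWith.id.const_min r).const_max (-r)
    have := LipschitzOnWith.comp_eVariationOn_le (C := 1) (t := univ)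
      (hl.lipschitzOnWith) (g := F₁) (s := univ) (fun _ _ => mem_univ _)
    rw [ENNReal.coe_one, one_mul] at this
    exact this.trans h2
  have he : J.indicator F = fun x => (J.indicator fun _ => (1 : ℝ)) x * F₂ x := by
    funext x
    by_cases hx : x ∈ J
    · rw [indicator_of_mem hx, indicator_of_mem hx, one_mul]
      have h3 : |F x| ≤ r := by
        have := ENNReal.toReal_mono hAfin (hA x hx)
        rwa [toReal_enorm, Real.norm_eq_abs] at this
      have h4 := abs_le.1 h3
      simp only [F₂, h1 hx]
      rw [min_eq_right h4.2, max_eq_right h4.1]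
    · rw [indicator_of_notMem hx, indicator_of_notMem hx, zero_mul]
  rw [he]
  refine (eVariationOn_mul_le (A := 1) (B := A) (fun x _ => ?_) fun x _ => hb x).trans ?_
  · by_cases hx : x ∈ J
    · simp [indicator_of_mem hx]
    · simp [indicator_of_notMem hx]
  · rw [one_mul, add_comm]
    gcongr
    exact eVariationOn_indicator_one_le hJ

/-- Cutting a function off inside an interval. -/
theorem eVariationOn_indicator_compl_le {J : Set ℝ} (hJ : J.OrdConnected) {F : ℝ → ℝ} {A : ℝ≥0∞}
    {s : Set ℝ} (hA : ∀ x ∈ s, ‖F x‖ₑ ≤ A) :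
    eVariationOn (Jᶜ.indicator F) s ≤ eVariationOn F s + 2 * A := by
  have he : Jᶜ.indicator F = fun x => (Jᶜ.indicator fun _ => (1 : ℝ)) x * F x := by
    funext x
    by_cases hx : x ∈ Jᶜ
    · rw [indicator_of_mem hx, indicator_of_mem hx, one_mul]
    · rw [indicator_of_notMem hx, indicator_of_notMem hx, zero_mul]
  rw [he]
  refine (eVariationOn_mul_le (A := 1) (B := A) (fun x _ => ?_) hA).trans ?_
  · by_cases hx : x ∈ Jᶜ
    · rw [indicator_of_mem hx]; simp
    · rw [indicator_of_notMem hx]; simp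
  · rw [one_mul, add_comm]
    gcongr
    refine (eVariationOn.mono _ (subset_univ s)).trans ?_
    rw [indicator_compl]
    exact (eVariationOn_const_sub_le 1 _ univ).trans (eVariationOn_indicator_one_le hJ)

/-- The variations over finitely many non-overlapping sets add up to at most the variation over
their union. -/
theorem sum_eVariationOn_le_biUnion {ι : Type*} (t : Finset ι) (J : ι → Set ℝ) (e : ι → ℝ)
    (he : ∀ i ∈ t, ∀ x ∈ J i, e i ≤ x)
    (hJ : ∀ i ∈ t, ∀ j ∈ t, i ≠ j → e i ≤ e j → ∀ x ∈ J i, x ≤ e j) (F : ℝ → ℝ) :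
    ∑ i ∈ t, eVariationOn F (J i) ≤ eVariationOn F (⋃ i ∈ t, J i) := by
  classical
  induction t using Finset.induction_on_max_value e with
  | empty => simp
  | insert a s ha hmax ih =>
    rw [Finset.sum_insert ha, Finset.set_biUnion_insert, union_comm, add_comm]
    refine (add_le_add (ih (fun i hi => he i (Finset.mem_insert_of_mem hi))
      (fun i hi j hj => hJ i (Finset.mem_insert_of_mem hi) j (Finset.mem_insert_of_mem hj)))
      le_rfl).trans (eVariationOn.add_le_union F ?_)
    intro x hx y hy
    simp only [mem_iUnion] at hx
    obtain ⟨i, hi, hx⟩ := hx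
    have hia : i ≠ a := fun h => ha (h ▸ hi)
    exact (hJ i (Finset.mem_insert_of_mem hi) a (Finset.mem_insert_self _ _) hia (hmax i hi) x
      hx).trans (he a (Finset.mem_insert_self _ _) y hy)

theorem tsum_eVariationOn_le {J : ℕ → Set ℝ} {e : ℕ → ℝ}
    (he : ∀ i, ∀ x ∈ J i, e i ≤ x)
    (hJ : ∀ i j, i ≠ j → e i ≤ e j → ∀ x ∈ J i, x ≤ e j) (F : ℝ → ℝ) :
    ∑' i, eVariationOn F (J i) ≤ eVariationOn F univ := by
  refine ENNReal.summable.tsum_le_of_sum_le fun t => ?_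
  exact (sum_eVariationOn_le_biUnion t J e (fun i _ => he i) (fun i _ j _ => hJ i j) F).trans
    (eVariationOn.mono F (subset_univ _))

/-! ### The space `BV` -/

instance : IsProbabilityMeasure leb := ⟨by simp [leb]⟩

/-- Nearly optimal representatives converge on a set `E` that contains almost every point of [0,1]
and everything outside. Lower semicontinuity bounds the variation over `E`, and extension from `E`
fills in the exceptional points at no cost. -/
theorem essVar_le_of_tendsto {u : ℕ → ℝ → ℝ} {w : ℝ → ℝ} {C : ℝ≥0∞}
    (h : ∀ᵐ x ∂leb, Tendsto (fun n => u n x) atTop (𝓝 (w x))) (hC : ∀ n, essVar (u n) ≤ C) :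
    essVar w ≤ C := by
  refine ENNReal.le_of_forall_pos_le_add fun δ hδ hfin => ?_
  have hδ' : (δ : ℝ≥0∞) ≠ 0 := by simpa using hδ.ne'
  have hlt : ∀ n, essVar (u n) < C + δ := fun n =>
    (hC n).trans_lt (ENNReal.lt_add_right hfin.ne hδ')
  choose v hv1 hv2 hv3 using fun n => exists_of_essVar_lt (hlt n)
  let w' : ℝ → ℝ := (Icc (0 : ℝ) 1).indicator w
  let E : Set ℝ := {x | Tendsto (fun n => v n x) atTop (𝓝 (w' x))}
  have hE : eVariationOn w' E ≤ C + δ :=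
    eVariationOn_le_of_tendsto (l := atTop) (F := v) (fun x hx => hx)
      (Eventually.of_forall fun n => (eVariationOn.mono _ (subset_univ _)).trans (hv3 n).le)
  have hout : ∀ x, x ∉ Icc (0 : ℝ) 1 → x ∈ E := by
    intro x hx
    simp only [E, mem_ofPred_eq, w', indicator_of_notMem hx, hv2 _ x hx]
    exact tendsto_const_nhds
  obtain ⟨F, hF, hFV⟩ := exists_extension_eVariationOn_le (s := E) (f := w')
    ⟨2, hout 2 (by norm_num)⟩
    (ne_top_of_le_ne_top (ENNReal.add_ne_top.2 ⟨hfin.ne, ENNReal.coe_ne_top⟩) hE)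
  refine (essVar_le (v := F) ?_ fun x hx => ?_).trans (hFV.trans hE)
  · have hmem : ∀ᵐ x ∂leb, x ∈ Icc (0 : ℝ) 1 := ae_restrict_mem measurableSet_Icc
    filter_upwards [h, ae_all_iff.2 hv1, hmem] with x h1 h2 h3
    have hxE : x ∈ E := by
      simp only [E, mem_ofPred_eq, w', indicator_of_mem h3, h2]
      exact h1
    rw [hF hxE]
    simp only [w', indicator_of_mem h3]
  · rw [hF (hout x hx)]
    simp only [w', indicator_of_notMem hx]

namespace BV

/-- The element of `BV` represented by a function. -/
noncomputable def mk (u : ℝ → ℝ) (hm : AEStronglyMeasurable u leb) (h : essVar u < ∞) : BV :=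
  (⟨AEEqFun.mk u hm, by
    change essVar (AEEqFun.mk u hm : ℝ → ℝ) < ∞
    rwa [essVar_congr (AEEqFun.coeFn_mk u hm)]⟩ : bvSubmodule)

theorem fn_mk (u : ℝ → ℝ) (hm : AEStronglyMeasurable u leb) (h : essVar u < ∞) :
    (mk u hm h).fn =ᵐ[leb] u := AEEqFun.coeFn_mk u hm

theorem ext_fn {f g : BV} (h : f.fn =ᵐ[leb] g.fn) : f = g :=
  Subtype.ext (AEEqFun.ext h)

theorem fn_aestronglyMeasurable (f : BV) : AEStronglyMeasurable f.fn leb :=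
  AEEqFun.aestronglyMeasurable _

theorem fn_sub (f g : BV) : (f - g).fn =ᵐ[leb] f.fn - g.fn := AEEqFun.coeFn_sub _ _

theorem ofReal_norm (f : BV) : ENNReal.ofReal ‖f‖ = essVar f.fn :=
  ENNReal.ofReal_toReal f.essVar_lt_top.ne

theorem norm_le_of_essVar_le {f : BV} {C : ℝ} (hC : 0 ≤ C) (h : essVar f.fn ≤ ENNReal.ofReal C) :
    ‖f‖ ≤ C := by
  rw [norm_def]
  exact ENNReal.toReal_le_of_le_ofReal hC h

theorem exists_version (f : BV) {r : ℝ} (hr : ‖f‖ < r) :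
    ∃ v : ℝ → ℝ, Measurable v ∧ v =ᵐ[leb] f.fn ∧ (∀ x, x ∉ Icc (0 : ℝ) 1 → v x = 0) ∧
      eVariationOn v univ ≤ ENNReal.ofReal r := by
  have h : essVar f.fn < ENNReal.ofReal r := by
    rw [← ofReal_norm]
    exact (ENNReal.ofReal_lt_ofReal_iff ((norm_nonneg f).trans_lt hr)).2 hr
  obtain ⟨v, h1, h2, h3⟩ := exists_of_essVar_lt h
  exact ⟨v, measurable_of_eVariationOn_ne_top (h3.trans ENNReal.ofReal_lt_top).ne, h1, h2, h3.le⟩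

end BV

theorem enorm_le_eVariationOn {v : ℝ → ℝ} (h : ∀ x, x ∉ Icc (0 : ℝ) 1 → v x = 0) (x : ℝ) :
    ‖v x‖ₑ ≤ eVariationOn v univ := by
  have := eVariationOn.edist_le v (mem_univ x) (mem_univ (2 : ℝ))
  rwa [h 2 (by norm_num), edist_zero_right] at this

theorem abs_le_of_enorm_le {x r : ℝ} (hr : 0 ≤ r) (h : ‖x‖ₑ ≤ ENNReal.ofReal r) : |x| ≤ r := by
  rwa [← ofReal_norm, ENNReal.ofReal_le_ofReal_iff hr] at h

namespace BV

/-- A representative that vanishes off [0,1] is nowhere larger than its variation. This is why the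
variation alone serves as a norm and controls the supremum. -/
theorem abs_fn_le (f : BV) : ∀ᵐ x ∂leb, |f.fn x| ≤ ‖f‖ := by
  have hn : ∀ n : ℕ, ∀ᵐ x ∂leb, |f.fn x| ≤ ‖f‖ + 1 / ((n : ℝ) + 1) := by
    intro n
    have hpos : (0 : ℝ) < 1 / ((n : ℝ) + 1) := Nat.one_div_pos_of_nat
    obtain ⟨v, -, h1, h2, h3⟩ := f.exists_version (r := ‖f‖ + 1 / ((n : ℝ) + 1)) (by linarith)
    filter_upwards [h1] with x hx
    rw [← hx]
    exact abs_le_of_enorm_le (by positivity) ((enorm_le_eVariationOn h2 x).trans h3)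
  filter_upwards [ae_all_iff.2 hn] with x hx
  have := (tendsto_const_nhds (x := ‖f‖)).add (tendsto_one_div_add_atTop_nhds_zero_nat (𝕜 := ℝ))
  rw [add_zero] at this
  exact ge_of_tendsto' this hx

theorem integrable (f : BV) : Integrable f.fn leb :=
  (integrable_const ‖f‖).mono' f.fn_aestronglyMeasurable
    (by simpa only [Real.norm_eq_abs] using f.abs_fn_le)

theorem integral_abs_le (f : BV) : ∫ x, |f.fn x| ∂leb ≤ ‖f‖ := by
  calc ∫ x, |f.fn x| ∂leb ≤ ∫ _, ‖f‖ ∂leb :=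
        integral_mono_ae f.integrable.abs (integrable_const _) f.abs_fn_le
    _ = ‖f‖ := by simp

/-- The embedding of `BV` into `L¹`. -/
noncomputable def toL1 : BV →L[ℝ] Lp ℝ 1 leb :=
  LinearMap.mkContinuous
    { toFun := fun f => f.integrable.toL1 f.fn
      map_add' := fun f g => by
        rw [← Integrable.toL1_add]
        exact (Integrable.toL1_eq_toL1_iff _ _ _ _).2 (f.fn_add g)
      map_smul' := fun k f => by
        rw [RingHom.id_apply, ← Integrable.toL1_smul]
        exact (Integrable.toL1_eq_toL1_iff _ _ _ _).2 (f.fn_smul k) }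
    1 fun f => by
      rw [one_mul]
      change ‖f.integrable.toL1 f.fn‖ ≤ _
      rw [L1.norm_of_fun_eq_integral_norm]
      exact f.integral_abs_le

theorem coeFn_toL1 (f : BV) : (toL1 f : ℝ → ℝ) =ᵐ[leb] f.fn := f.integrable.coeFn_toL1

theorem norm_toL1 (f : BV) : ‖toL1 f‖ = ∫ x, |f.fn x| ∂leb :=
  L1.norm_of_fun_eq_integral_norm f.integrable

theorem norm_toL1_le (f : BV) : ‖toL1 f‖ ≤ ‖f‖ := by
  rw [norm_toL1]; exact f.integral_abs_le

/-- The integral over a set, as a functional on `BV`. -/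
noncomputable def setInt (A : Set ℝ) : BV →L[ℝ] ℝ :=
  LinearMap.mkContinuous
    { toFun := fun f => ∫ x in A, f.fn x ∂leb
      map_add' := fun f g => by
        rw [← integral_add f.integrable.integrableOn g.integrable.integrableOn]
        exact integral_congr_ae (ae_restrict_of_ae (f.fn_add g))
      map_smul' := fun k f => by
        rw [RingHom.id_apply, smul_eq_mul, ← integral_const_mul]
        exact integral_congr_ae (ae_restrict_of_ae (f.fn_smul k)) }
    1 fun f => by
      rw [one_mul]
      refine (norm_integral_le_integral_norm _).trans ?_
      refine (setIntegral_le_integral f.integrable.norm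
        (Eventually.of_forall fun _ => norm_nonneg _)).trans ?_
      exact f.integral_abs_le

theorem setInt_apply (A : Set ℝ) (f : BV) : setInt A f = ∫ x in A, f.fn x ∂leb := rfl

/-- The integral, as a functional on `BV`. -/
noncomputable def int : BV →L[ℝ] ℝ := setInt univ

theorem int_apply (f : BV) : int f = ∫ x, f.fn x ∂leb := by
  rw [int, setInt_apply, setIntegral_univ]

theorem abs_setInt_le (A : Set ℝ) (f : BV) : |setInt A f| ≤ ‖toL1 f‖ := by
  rw [norm_toL1, setInt_apply]
  exact (norm_integral_le_integral_norm _).trans (setIntegral_le_integral f.integrable.norm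
        (Eventually.of_forall fun _ => norm_nonneg _))

/-- Balls of `BV` are closed in L¹: a subsequence converges almost everywhere, and the variation is
lower semicontinuous along it. -/
theorem exists_of_tendsto_toL1 {u : ℕ → BV} {g : Lp ℝ 1 leb} {C : ℝ} (hC : ∀ n, ‖u n‖ ≤ C)
    (h : Tendsto (fun n => toL1 (u n)) atTop (𝓝 g)) : ∃ f : BV, toL1 f = g ∧ ‖f‖ ≤ C := by
  obtain ⟨ns, -, hns⟩ := (tendstoInMeasure_of_tendsto_Lp h).exists_seq_tendsto_ae
  have hC0 : 0 ≤ C := (norm_nonneg _).trans (hC 0)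
  have hg : essVar g ≤ ENNReal.ofReal C := by
    refine essVar_le_of_tendsto (u := fun i => (toL1 (u (ns i)) : ℝ → ℝ)) hns fun n => ?_
    rw [essVar_congr (coeFn_toL1 _), ← ofReal_norm]
    exact ENNReal.ofReal_le_ofReal (hC _)
  have hm := Lp.aestronglyMeasurable g
  refine ⟨mk g hm (hg.trans_lt ENNReal.ofReal_lt_top), ?_, ?_⟩
  · exact Lp.ext ((coeFn_toL1 _).trans (fn_mk _ _ _))
  · refine norm_le_of_essVar_le hC0 ?_
    rw [essVar_congr (fn_mk _ _ _)]
    exact hg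

theorem toL1_injective : Function.Injective toL1 := fun f g h =>
  ext_fn ((coeFn_toL1 f).symm.trans ((by rw [h] : (toL1 f : ℝ → ℝ) =ᵐ[leb] toL1 g).trans
    (coeFn_toL1 g)))

/-- A Cauchy sequence converges in L¹, and closedness of balls in L¹, applied to the differences `u
n - u (N + k)`, upgrades this to convergence in norm. The fixed point argument for the eigenvector
needs completeness. -/
instance : CompleteSpace BV := by
  refine Metric.complete_of_cauchySeq_tendsto fun u hu => ?_
  obtain ⟨g, hg⟩ := cauchySeq_tendsto_of_complete (toL1.uniformContinuous.comp_cauchySeq hu)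
  obtain ⟨K, hK⟩ := hu.norm_bddAbove
  obtain ⟨f, hf, -⟩ := exists_of_tendsto_toL1 (C := K) (fun n => hK (mem_range_self n)) hg
  refine ⟨f, ?_⟩
  rw [Metric.tendsto_atTop]
  intro δ hδ
  obtain ⟨N, hN⟩ := Metric.cauchySeq_iff.1 hu (δ / 2) (by linarith)
  refine ⟨N, fun n hn => ?_⟩
  have h1 : Tendsto (fun k => toL1 (u n - u (N + k))) atTop (𝓝 (toL1 (u n - f))) := by
    simp only [map_sub]
    refine tendsto_const_nhds.sub ?_
    rw [hf]
    exact hg.comp (tendsto_add_atTop_nat N |>.congr fun k => add_comm _ _)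
  obtain ⟨f', hf', hn'⟩ := exists_of_tendsto_toL1 (C := δ / 2) (fun k => by
    rw [← dist_eq_norm]; exact (hN n hn (N + k) (Nat.le_add_right _ _)).le) h1
  rw [dist_eq_norm, ← toL1_injective hf']
  linarith

end BV

/-- On a set of positive measure a function is bounded by its variation plus its mean value. -/
theorem abs_sub_average_le {v : ℝ → ℝ} {J : Set ℝ}
    (hv : IntegrableOn v J) (h0 : volume J ≠ 0) (h1 : volume J ≠ ∞)
    (hfin : eVariationOn v J ≠ ∞) {x : ℝ} (hx : x ∈ J) :
    |v x - (volume.real J)⁻¹ * ∫ y in J, v y| ≤ (eVariationOn v J).toReal := by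
  have hpos : 0 < volume.real J := ENNReal.toReal_pos h0 h1
  have e : v x - (volume.real J)⁻¹ * ∫ y in J, v y
      = (volume.real J)⁻¹ * ∫ y in J, (v x - v y) := by
    rw [integral_sub (integrable_const_iff.2 (Or.inr ⟨by simpa using h1.lt_top⟩)) hv,
      setIntegral_const, smul_eq_mul]
    field_simp
  rw [e, abs_mul, abs_of_pos (inv_pos.2 hpos), inv_mul_le_iff₀ hpos]
  have := norm_setIntegral_le_of_norm_le_const (μ := volume) (s := J) (f := fun y => v x - v y)
    (C := (eVariationOn v J).toReal) h1.lt_top (fun y hy => ?_)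
  · rw [mul_comm]; exact this
  · rw [Real.norm_eq_abs, ← Real.dist_eq]
    exact BoundedVariationOn.dist_le (f := v) (s := J) hfin hx hy

/-- The cells of the partition of the line into intervals of length `1 / N`. -/
def cell (N : ℕ) (k : ℕ) : Set ℝ := Ico ((k : ℝ) / N) (((k : ℝ) + 1) / N)

theorem measurableSet_cell (N k : ℕ) : MeasurableSet (cell N k) := measurableSet_Ico

theorem volume_cell (N k : ℕ) : volume (cell N k) = ENNReal.ofReal (1 / N) := by
  rw [cell, Real.volume_Ico]
  congr 1; ring

theorem cell_sep {N : ℕ} {i j : ℕ} (hij : i ≠ j)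
    (h : (i : ℝ) / N ≤ (j : ℝ) / N) (hN : 0 < N) : ∀ x ∈ cell N i, x ≤ (j : ℝ) / N := by
  intro x hx
  have hN' : (0 : ℝ) < N := by exact_mod_cast hN
  have h2 : (i : ℝ) ≤ j := by rwa [div_le_div_iff_of_pos_right hN'] at h
  have h3 : i < j := lt_of_le_of_ne (by exact_mod_cast h2) hij
  refine hx.2.le.trans ?_
  rw [div_le_div_iff_of_pos_right hN']
  exact_mod_cast h3

theorem sum_eVariationOn_cell_le {N : ℕ} (hN : 0 < N) (t : Finset ℕ) (v : ℝ → ℝ) :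
    ∑ k ∈ t, eVariationOn v (cell N k) ≤ eVariationOn v univ :=
  (sum_eVariationOn_le_biUnion t (cell N) (fun k => (k : ℝ) / N) (fun _ _ _ hx => hx.1)
    (fun _ _ _ _ hij h => cell_sep hij h hN) v).trans (eVariationOn.mono _ (subset_univ _))

theorem cell_disjoint {N : ℕ} (hN : 0 < N) : Pairwise (Function.onFun Disjoint (cell N)) := by
  intro i j hij
  have hN' : (0 : ℝ) < N := by exact_mod_cast hN
  refine Set.disjoint_left.2 fun x hi hj => ?_
  rcases lt_or_gt_of_ne hij with h | h
  · have : ((i : ℝ) + 1) / N ≤ j / N := by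
      rw [div_le_div_iff_of_pos_right hN']; exact_mod_cast h
    linarith [hi.2, hj.1]
  · have : ((j : ℝ) + 1) / N ≤ i / N := by
      rw [div_le_div_iff_of_pos_right hN']; exact_mod_cast h
    linarith [hj.2, hi.1]

theorem exists_mem_cell {N : ℕ} (hN : 0 < N) {x : ℝ} (h0 : 0 ≤ x) :
    x ∈ cell N ⌊x * N⌋₊ := by
  have hN' : (0 : ℝ) < N := by exact_mod_cast hN
  constructor
  · rw [div_le_iff₀ hN']; exact Nat.floor_le (by positivity)
  · rw [lt_div_iff₀ hN']; exact Nat.lt_floor_add_one _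

/-! ### Compactness of the embedding of `BV` into L¹ -/

namespace BV

theorem coeFn_finset_sum {ι : Type*} (t : Finset ι) (F : ι → Lp ℝ 1 leb) :
    ((∑ i ∈ t, F i : Lp ℝ 1 leb) : ℝ → ℝ) =ᵐ[leb] ∑ i ∈ t, (F i : ℝ → ℝ) := by
  classical
  induction t using Finset.induction_on with
  | empty => simpa using Lp.coeFn_zero ℝ 1 leb
  | insert a s ha ih =>
    rw [Finset.sum_insert ha, Finset.sum_insert ha]
    exact (Lp.coeFn_add _ _).trans (EventuallyEq.rfl.add ih)

/-- Conditional expectation on the partition into cells of length `1 / N`. -/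
noncomputable def cellAverage (N : ℕ) : BV →L[ℝ] Lp ℝ 1 leb :=
  ∑ k ∈ Finset.range N, ((N : ℝ) • setInt (cell N k)).smulRight
    (indicatorConstLp 1 (measurableSet_cell N k) (measure_ne_top leb _) (1 : ℝ))

theorem isCompactOperator_cellAverage (N : ℕ) : IsCompactOperator (cellAverage N) := by
  have : ∀ k, ((N : ℝ) • setInt (cell N k)).smulRight
      (indicatorConstLp 1 (measurableSet_cell N k) (measure_ne_top leb _) (1 : ℝ)) ∈
      {F : BV →L[ℝ] Lp ℝ 1 leb | IsCompactOperator F} := by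
    intro k
    have h := (isCompactOperator_of_locallyCompactSpace_dom
      ((N : ℝ) • setInt (cell N k))).clm_comp (ContinuousLinearMap.toSpanSingleton ℝ
      (indicatorConstLp 1 (measurableSet_cell N k) (measure_ne_top leb _) (1 : ℝ)))
    exact h
  unfold cellAverage
  generalize Finset.range N = t
  induction t using Finset.induction_on with
  | empty => simpa using isCompactOperator_zero
  | insert a s ha ih =>
    rw [Finset.sum_insert ha]
    exact (this a).add ih

theorem cell_subset {N k : ℕ} (hN : 0 < N) (hk : k < N) : cell N k ⊆ Icc 0 1 := by
  have hN' : (0 : ℝ) < N := by exact_mod_cast hN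
  rintro x ⟨h1, h2⟩
  refine ⟨le_trans (by positivity) h1, h2.le.trans ?_⟩
  rw [div_le_one hN']
  exact_mod_cast hk

/-- On a cell a function differs from its mean by at most its variation there. The cells have length
1/N, and the variations over them add up to at most the total one. -/
theorem norm_toL1_sub_cellAverage_le {N : ℕ} (hN : 0 < N) (f : BV) :
    ‖toL1 f - cellAverage N f‖ ≤ 1 / N * ‖f‖ := by
  have hN' : (0 : ℝ) < N := by exact_mod_cast hN
  suffices H : ∀ r, ‖f‖ < r → ‖toL1 f - cellAverage N f‖ ≤ 1 / N * r by
    refine le_of_forall_gt_imp_ge_of_dense fun a ha => ?_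
    have := H (a * N) (by rwa [one_div, inv_mul_lt_iff₀ hN', mul_comm] at ha)
    rwa [mul_comm a, ← mul_assoc, one_div, inv_mul_cancel₀ hN'.ne', one_mul] at this
  intro r hr
  obtain ⟨v, hvm, hv1, hv2, hv3⟩ := f.exists_version hr
  have hfin : ∀ s, eVariationOn v s ≠ ∞ := fun s =>
    ne_top_of_le_ne_top ENNReal.ofReal_ne_top ((eVariationOn.mono v (subset_univ s)).trans hv3)
  have hr0 : 0 ≤ r := (norm_nonneg f).trans hr.le
  have hvint : Integrable v leb := f.integrable.congr hv1.symm
  have hvon : ∀ k < N, IntegrableOn v (cell N k) := fun k hk =>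
    IntegrableOn.mono_set hvint (cell_subset hN hk)
  have hcell : ∀ k < N, leb.restrict (cell N k) = volume.restrict (cell N k) := fun k hk => by
    rw [leb, Measure.restrict_restrict (measurableSet_cell N k),
      inter_eq_left.2 (cell_subset hN hk)]
  have hlt1 : ∀ᵐ x ∂leb, x < 1 := by
    have : ∀ᵐ x ∂(volume : Measure ℝ), x ≠ 1 := by simp [ae_iff]
    have h2 : ∀ᵐ x ∂leb, x ∈ Icc (0 : ℝ) 1 := ae_restrict_mem measurableSet_Icc
    filter_upwards [ae_restrict_of_ae this, h2] with x hx hx2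
    exact lt_of_le_of_ne hx2.2 hx
  have hmem : ∀ᵐ x ∂leb, x ∈ Icc (0 : ℝ) 1 := ae_restrict_mem measurableSet_Icc
  have hind : ∀ᵐ x ∂leb, ∀ k, (indicatorConstLp (E := ℝ) 1 (measurableSet_cell N k)
      (measure_ne_top leb _) (1 : ℝ) : ℝ → ℝ) x = (cell N k).indicator (fun _ => 1) x :=
    ae_all_iff.2 fun k => indicatorConstLp_coeFn
  have hsum : (cellAverage N f : ℝ → ℝ) =ᵐ[leb] fun x => ∑ k ∈ Finset.range N,
      (N * setInt (cell N k) f) * (cell N k).indicator (fun _ => 1) x := by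
    have e : cellAverage N f = ∑ k ∈ Finset.range N, (N * setInt (cell N k) f) •
        (indicatorConstLp 1 (measurableSet_cell N k) (measure_ne_top leb _) (1 : ℝ)) := by
      simp [cellAverage]
    rw [e]
    refine (coeFn_finset_sum _ _).trans ?_
    have h3 : ∀ᵐ x ∂leb, ∀ k, (((N * setInt (cell N k) f) • (indicatorConstLp (E := ℝ) 1
        (measurableSet_cell N k) (measure_ne_top leb _) (1 : ℝ)) : Lp ℝ 1 leb) : ℝ → ℝ) x =
        (N * setInt (cell N k) f) * (indicatorConstLp (E := ℝ) 1 (measurableSet_cell N k)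
      (measure_ne_top leb _) (1 : ℝ) : ℝ → ℝ) x := ae_all_iff.2 fun k => Lp.coeFn_smul _ _
    filter_upwards [h3, hind] with x h4 h5
    rw [Finset.sum_apply]
    exact Finset.sum_congr rfl fun k _ => by rw [h4, h5]
  have hpt : ∀ᵐ x ∂leb, ‖(toL1 f - cellAverage N f : Lp ℝ 1 leb) x‖ ≤
      ∑ k ∈ Finset.range N, (eVariationOn v (cell N k)).toReal *
        (cell N k).indicator (fun _ => 1) x := by
    filter_upwards [Lp.coeFn_sub (toL1 f) (cellAverage N f), coeFn_toL1 f, hsum, hlt1, hmem, hv1]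
      with x h1 h2 h3 h4 h5 h6
    rw [h1, Pi.sub_apply, h2, h3, ← h6]
    set k := ⌊x * N⌋₊ with hk
    have hxk : x ∈ cell N k := exists_mem_cell hN h5.1
    have hkN : k < N := by
      rw [hk, Nat.floor_lt (by have := h5.1; positivity)]
      nlinarith
    have hother : ∀ j, j ≠ k → (cell N j).indicator (fun _ => (1 : ℝ)) x = 0 := fun j hj =>
      indicator_of_notMem (fun hxj => Set.disjoint_left.1 (cell_disjoint hN hj) hxj hxk) _
    rw [Finset.sum_eq_single k (fun j _ hj => by rw [hother j hj, mul_zero])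
      (fun h => absurd (Finset.mem_range.2 hkN) h),
      Finset.sum_eq_single k (fun j _ hj => by rw [hother j hj, mul_zero])
      (fun h => absurd (Finset.mem_range.2 hkN) h), indicator_of_mem hxk, mul_one, mul_one]
    have hvol : volume.real (cell N k) = 1 / N := by
      rw [measureReal_def, volume_cell, ENNReal.toReal_ofReal (by positivity)]
    have := abs_sub_average_le (hvon k hkN)
      (by rw [volume_cell]; simpa using hN.ne') (by rw [volume_cell]; exact ENNReal.ofReal_ne_top)
      (hfin _) hxk
    rw [hvol, one_div, inv_inv] at this
    have e2 : setInt (cell N k) f = ∫ y in cell N k, v y := by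
      rw [setInt_apply, ← hcell k hkN]
      exact integral_congr_ae (ae_restrict_of_ae hv1.symm)
    rw [e2]
    exact this
  rw [L1.norm_eq_integral_norm]
  refine (integral_mono_ae (L1.integrable_coeFn _).norm ?_ hpt).trans ?_
  · exact integrable_finsetSum _ fun k _ =>
      ((integrable_const _).indicator (measurableSet_cell N k)).const_mul _
  rw [integral_finsetSum _ fun k _ =>
      ((integrable_const _).indicator (measurableSet_cell N k)).const_mul _]
  have hI : ∀ k ∈ Finset.range N, ∫ x, (eVariationOn v (cell N k)).toReal *
        (cell N k).indicator (fun _ => 1) x ∂leb = 1 / N * (eVariationOn v (cell N k)).toReal := by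
    intro k hk
    rw [integral_const_mul, integral_indicator_const _ (measurableSet_cell N k), smul_eq_mul,
      mul_one, mul_comm]
    congr 1
    rw [measureReal_def, leb, Measure.restrict_apply (measurableSet_cell N k),
      inter_eq_left.2 (cell_subset hN (Finset.mem_range.1 hk)), volume_cell,
      ENNReal.toReal_ofReal (by positivity)]
  rw [Finset.sum_congr rfl hI, ← Finset.mul_sum]
  refine mul_le_mul_of_nonneg_left ?_ (by positivity)
  rw [← ENNReal.toReal_sum fun k _ => hfin _]
  exact ENNReal.toReal_le_of_le_ofReal hr0 ((sum_eVariationOn_cell_le hN _ v).trans hv3)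

/-- The embedding is the norm limit of the finite rank operators `cellAverage N`. -/
theorem isCompactOperator_toL1 : IsCompactOperator toL1 := by
  refine isCompactOperator_of_tendsto (l := atTop) (F := cellAverage) ?_
    (Eventually.of_forall isCompactOperator_cellAverage)
  rw [tendsto_iff_norm_sub_tendsto_zero]
  refine squeeze_zero' (Eventually.of_forall fun _ => norm_nonneg _) ?_
    tendsto_one_div_atTop_nhds_zero_nat
  filter_upwards [eventually_gt_atTop 0] with N hN
  refine ContinuousLinearMap.opNorm_le_bound _ (by positivity) fun f => ?_
  rw [sub_apply, norm_sub_rev]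
  exact norm_toL1_sub_cellAverage_le hN f

end BV

/-! ### Inverse branches -/

theorem exists_monotone_inverse {T : ℝ → ℝ} {c d : ℝ} (hcd : c < d)
    (hm : StrictMonoOn T (Ioo c d)) (hT : ContinuousOn T (Ioo c d)) :
    ∃ s : ℝ → ℝ, Monotone s ∧ (∀ y, s y ∈ Icc c d) ∧ (∀ x ∈ Ioo c d, s (T x) = x) ∧
      ∀ y, s y ∈ Ioo c d → T (s y) = y := by
  -- The inverse is the supremum of the points whose value is at most `y`. Adjoining `c` keeps the
  -- set nonempty when `y` lies below the image.
  let S : ℝ → Set ℝ := fun y => insert c {x | x ∈ Ioo c d ∧ T x ≤ y}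
  have hne : ∀ y, (S y).Nonempty := fun y => ⟨c, mem_insert _ _⟩
  have hub : ∀ y, ∀ x ∈ S y, x ≤ d := by
    rintro y x (rfl | hx)
    · exact hcd.le
    · exact hx.1.2.le
  have hbdd : ∀ y, BddAbove (S y) := fun y => ⟨d, hub y⟩
  refine ⟨fun y => sSup (S y), fun y₁ y₂ h => ?_, fun y => ⟨?_, ?_⟩, fun x hx => ?_, fun y hy => ?_⟩
  · refine csSup_le_csSup (hbdd _) (hne _) (insert_subset_insert fun x hx => ⟨hx.1, hx.2.trans h⟩)
  · exact le_csSup (hbdd y) (mem_insert _ _)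
  · exact csSup_le (hne y) (hub y)
  · refine le_antisymm (csSup_le (hne _) ?_) (le_csSup (hbdd _) (mem_insert_of_mem _ ⟨hx, le_rfl⟩))
    rintro u (rfl | hu)
    · exact hx.1.le
    · exact (hm.le_iff_le hu.1 hx).1 hu.2
  · set x₀ := sSup (S y) with hx₀
    have hc : ContinuousAt T x₀ := hT.continuousAt (Ioo_mem_nhds hy.1 hy.2)
    have hmem : ∀ᶠ x in 𝓝 x₀, x ∈ Ioo c d := Ioo_mem_nhds hy.1 hy.2
    rcases lt_trichotomy (T x₀) y with h | h | h
    · have h1 : ∀ᶠ x in 𝓝[>] x₀, T x < y ∧ x ∈ Ioo c d :=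
        ((hc.eventually (gt_mem_nhds h)).and hmem).filter_mono nhdsWithin_le_nhds
      obtain ⟨x, ⟨hx1, hx2⟩, hx3⟩ := (h1.and self_mem_nhdsWithin).exists
      exact absurd (le_csSup (hbdd y) (mem_insert_of_mem c ⟨hx2, hx1.le⟩)) (not_le.2 hx3)
    · exact h
    · have h1 : ∀ᶠ x in 𝓝[<] x₀, y < T x ∧ x ∈ Ioo c d :=
        ((hc.eventually (lt_mem_nhds h)).and hmem).filter_mono nhdsWithin_le_nhds
      obtain ⟨x, ⟨hx1, hx2⟩, hx3⟩ := (h1.and self_mem_nhdsWithin).exists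
      obtain ⟨x', hx', hlt⟩ := exists_lt_of_lt_csSup (hne y) hx3
      rcases hx' with rfl | hx'
      · exact absurd hx2.1 (not_lt.2 hlt.le)
      · exact absurd ((hm hx2 hx'.1 hlt).trans_le hx'.2) (not_lt.2 hx1.le)

theorem exists_inverse_branch {T : ℝ → ℝ} {c d : ℝ} (hcd : c < d)
    (hm : StrictMonoOn T (Ioo c d) ∨ StrictAntiOn T (Ioo c d)) (hT : ContinuousOn T (Ioo c d)) :
    ∃ s : ℝ → ℝ, (Monotone s ∨ Antitone s) ∧ (∀ y, s y ∈ Icc c d) ∧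
      (∀ x ∈ Ioo c d, s (T x) = x) ∧ ∀ y, s y ∈ Ioo c d → T (s y) = y := by
  rcases hm with hm | hm
  · obtain ⟨s, h1, h2⟩ := exists_monotone_inverse hcd hm hT
    exact ⟨s, Or.inl h1, h2⟩
  · obtain ⟨s, h1, h2, h3, h4⟩ := exists_monotone_inverse (T := fun x => -T x) hcd
      (fun x hx y hy h => neg_lt_neg (hm hx hy h)) hT.neg
    refine ⟨fun y => s (-y), Or.inr fun a b h => h1 (neg_le_neg h), fun y => h2 _, h3,
      fun y hy => ?_⟩
    have := h4 (-y) hy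
    linarith

/-- The union of the branch domains. -/
def branches (c d : ℕ → ℝ) : Set ℝ := ⋃ i, Ioo (c i) (d i)

theorem weight_eq_zero {T : ℝ → ℝ} {c d : ℕ → ℝ} {x : ℝ} (hx : x ∉ branches c d) :
    weight T c d x = 0 :=
  indicator_of_notMem hx _

/-- The closure of a branch domain. -/
def closedBranch (c d : ℕ → ℝ) (i : ℕ) : Set ℝ := {x | c i < d i ∧ x ∈ Icc (c i) (d i)}

/-- `s i` is a globally defined monotone inverse of the `i`-th branch of `T`; it takes values at the
boundary of the branch domain off the image of the branch. -/
structure IsInverseBranches (T : ℝ → ℝ) (c d : ℕ → ℝ) (s : ℕ → ℝ → ℝ) : Prop where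
  monotone : ∀ i, Monotone (s i) ∨ Antitone (s i)
  mem_closedBranch : ∀ i, c i < d i → ∀ y, s i y ∈ closedBranch c d i
  degenerate : ∀ i, ¬ c i < d i → ∀ y, s i y = 2
  left_inv : ∀ i, ∀ x ∈ Ioo (c i) (d i), s i (T x) = x
  right_inv : ∀ i y, s i y ∈ Ioo (c i) (d i) → T (s i y) = y

namespace IsPiecewiseExpanding

variable {T : ℝ → ℝ} {c d : ℕ → ℝ} (hT : IsPiecewiseExpanding T c d)
include hT

theorem exists_isInverseBranches : ∃ s, IsInverseBranches T c d s := by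
  have key : ∀ i, ∃ s : ℝ → ℝ, (Monotone s ∨ Antitone s) ∧
      (c i < d i → ∀ y, s y ∈ closedBranch c d i) ∧ (¬ c i < d i → ∀ y, s y = 2) ∧
      (∀ x ∈ Ioo (c i) (d i), s (T x) = x) ∧ ∀ y, s y ∈ Ioo (c i) (d i) → T (s y) = y := by
    intro i
    by_cases h : c i < d i
    · obtain ⟨s, h1, h2, h3, h4⟩ := exists_inverse_branch h (hT.branch_monotone i)
        (hT.branch_contDiff i).continuousOn
      exact ⟨s, h1, fun _ y => ⟨h, h2 y⟩, fun h' => absurd h h', h3, h4⟩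
    · have he : Ioo (c i) (d i) = ∅ := Ioo_eq_empty h
      exact ⟨fun _ => 2, Or.inl fun _ _ _ => le_rfl, fun h' => absurd h' h, fun _ _ => rfl,
        by simp [he], by simp [he]⟩
  choose s h1 h2 h3 h4 h5 using key
  exact ⟨s, h1, h2, h3, h4, h5⟩

theorem branches_subset : branches c d ⊆ Icc 0 1 := iUnion_subset hT.branch_subset

theorem eq_of_mem_of_mem {i j : ℕ} {x : ℝ} (hi : x ∈ Ioo (c i) (d i)) (hj : x ∈ Ioo (c j) (d j)) :
    i = j := by
  by_contra h
  exact Set.disjoint_left.1 (hT.branch_disjoint h) hi hj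

/-- If an endpoint of one branch lay inside another, the two open intervals would overlap. In
particular the weight vanishes at all endpoints of branches. -/
theorem mem_of_mem_closedBranch {i : ℕ} {x : ℝ} (hx : x ∈ closedBranch c d i)
    (hU : x ∈ branches c d) : x ∈ Ioo (c i) (d i) := by
  obtain ⟨j, hj⟩ := mem_iUnion.1 hU
  by_cases hij : i = j
  · rwa [hij]
  exfalso
  have hlt : max (c i) (c j) < min (d i) (d j) := by
    have h1 : c j < d i := hj.1.trans_le hx.2.2
    have h2 : c i < d j := hx.2.1.trans_lt hj.2
    exact max_lt (lt_min hx.1 h2) (lt_min h1 (hj.1.trans hj.2))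
  obtain ⟨w, hw1, hw2⟩ := exists_between hlt
  exact hij (hT.eq_of_mem_of_mem ⟨(le_max_left _ _).trans_lt hw1, hw2.trans_le (min_le_left _ _)⟩
    ⟨(le_max_right _ _).trans_lt hw1, hw2.trans_le (min_le_right _ _)⟩)

theorem left_notMem_branches {i : ℕ} (h : c i < d i) : c i ∉ branches c d := fun hU =>
  lt_irrefl _ (hT.mem_of_mem_closedBranch ⟨h, le_rfl, h.le⟩ hU).1

theorem right_notMem_branches {i : ℕ} (h : c i < d i) : d i ∉ branches c d := fun hU =>
  lt_irrefl _ (hT.mem_of_mem_closedBranch ⟨h, h.le, le_rfl⟩ hU).2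

theorem tsum_eVariationOn_closedBranch_le (F : ℝ → ℝ) :
    ∑' i, eVariationOn F (closedBranch c d i) ≤ eVariationOn F univ := by
  classical
  -- The marker 2 places the empty branches to the right of [0,1], where they do not disturb the
  -- order of the others.
  refine tsum_eVariationOn_le (e := fun i => if c i < d i then c i else 2) ?_ ?_ F
  · intro i x hx
    rw [if_pos hx.1]
    exact hx.2.1
  · intro i j hij h x hx
    rw [if_pos hx.1] at h
    have hsub : Icc (c i) (d i) ⊆ Icc 0 1 := by
      rw [← closure_Ioo hx.1.ne]
      exact closure_minimal (hT.branch_subset i) isClosed_Icc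
    split_ifs at h ⊢ with hj
    · refine hx.2.2.trans ?_
      by_contra hlt
      rw [not_le] at hlt
      obtain ⟨w, hw1, hw2⟩ := exists_between (lt_min hlt hj)
      exact hij (hT.eq_of_mem_of_mem ⟨h.trans_lt hw1, hw2.trans_le (min_le_left _ _)⟩
        ⟨hw1, hw2.trans_le (min_le_right _ _)⟩)
    · linarith [(hsub hx.2).2]

end IsPiecewiseExpanding

/-- Summation over the inverse branches. -/
noncomputable def transfer (s : ℕ → ℝ → ℝ) (F : ℝ → ℝ) (y : ℝ) : ℝ := ∑' i, F (s i y)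

/-! ### Variation and integrals of sums over the inverse branches -/

namespace IsPiecewiseExpanding

variable {T : ℝ → ℝ} {c d : ℕ → ℝ} (hT : IsPiecewiseExpanding T c d)
  {s : ℕ → ℝ → ℝ} (hs : IsInverseBranches T c d s)
include hT hs

theorem mem_of_inverse_mem {i : ℕ} {y : ℝ} (h : s i y ∈ branches c d) :
    s i y ∈ Ioo (c i) (d i) := by
  by_cases hcd : c i < d i
  · exact hT.mem_of_mem_closedBranch (hs.mem_closedBranch i hcd y) h
  · have := hT.branches_subset h
    rw [hs.degenerate i hcd] at this
    norm_num at this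

theorem mem_of_apply_ne_zero {F : ℝ → ℝ} (hF : ∀ x, x ∉ branches c d → F x = 0) {i : ℕ} {y : ℝ}
    (h : F (s i y) ≠ 0) : s i y ∈ Ioo (c i) (d i) :=
  hT.mem_of_inverse_mem hs (by_contra fun hn => h (hF _ hn))

theorem apply_of_apply_ne_zero {F : ℝ → ℝ} (hF : ∀ x, x ∉ branches c d → F x = 0) {i : ℕ} {y : ℝ}
    (h : F (s i y) ≠ 0) : T (s i y) = y :=
  hs.right_inv i y (hT.mem_of_apply_ne_zero hs hF h)

theorem enorm_apply_le {F : ℝ → ℝ} (hF : ∀ x, x ∉ branches c d → F x = 0) (i : ℕ) (y : ℝ) :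
    ‖F (s i y)‖ₑ ≤ eVariationOn F (closedBranch c d i) := by
  by_cases h0 : F (s i y) = 0
  · simp [h0]
  have h1 := hT.mem_of_apply_ne_zero hs hF h0
  have hcd := h1.1.trans h1.2
  have h2 := eVariationOn.edist_le F (s := closedBranch c d i) (x := s i y) (y := c i)
    (hs.mem_closedBranch i hcd y) ⟨hcd, le_rfl, hcd.le⟩
  rwa [hF _ (hT.left_notMem_branches hcd), edist_zero_right] at h2

omit hs in
theorem summable_toReal {F : ℝ → ℝ} (hfin : eVariationOn F univ ≠ ∞) :
    Summable fun i => (eVariationOn F (closedBranch c d i)).toReal :=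
  ENNReal.summable_toReal (ne_top_of_le_ne_top hfin (hT.tsum_eVariationOn_closedBranch_le F))

theorem abs_apply_le {F : ℝ → ℝ} (hF : ∀ x, x ∉ branches c d → F x = 0)
    (hfin : eVariationOn F univ ≠ ∞) (i : ℕ) (y : ℝ) :
    |F (s i y)| ≤ (eVariationOn F (closedBranch c d i)).toReal := by
  have := ENNReal.toReal_mono (ne_top_of_le_ne_top hfin (eVariationOn.mono F (subset_univ _)))
    (hT.enorm_apply_le hs hF i y)
  rwa [toReal_enorm, Real.norm_eq_abs] at this

theorem summable_apply {F : ℝ → ℝ} (hF : ∀ x, x ∉ branches c d → F x = 0)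
    (hfin : eVariationOn F univ ≠ ∞) (y : ℝ) : Summable fun i => F (s i y) :=
  (hT.summable_toReal hfin).of_norm_bounded (hT.abs_apply_le hs hF hfin · y)

/-- Composition with a monotone inverse branch does not increase variation, and closed branches do
not overlap. There are no boundary terms: `F` vanishes at the ends of each branch, so the cut at the
ends of its image is already contained in `F ∘ s i`. -/
theorem eVariationOn_transfer_le {F : ℝ → ℝ} (hF : ∀ x, x ∉ branches c d → F x = 0) :
    eVariationOn (transfer s F) univ ≤ eVariationOn F univ := by
  by_cases hfin : eVariationOn F univ = ∞
  · rw [hfin]; exact le_top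
  refine (eVariationOn_tsum_le fun y _ => hT.summable_apply hs hF hfin y).trans
    (le_trans (ENNReal.tsum_le_tsum fun i => ?_) (hT.tsum_eVariationOn_closedBranch_le F))
  by_cases hcd : c i < d i
  · rcases hs.monotone i with h | h
    · exact eVariationOn.comp_le_of_monotoneOn F (s i) (h.monotoneOn _)
        fun y _ => hs.mem_closedBranch i hcd y
    · exact eVariationOn.comp_le_of_antitoneOn F (s i) (h.antitoneOn _)
        fun y _ => hs.mem_closedBranch i hcd y
  · rw [eVariationOn.constant_on]
    · exact bot_le
    · rintro _ ⟨x, -, rfl⟩ _ ⟨y, -, rfl⟩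
      simp only [hs.degenerate i hcd]

/-- On the terms that contribute, `T ∘ s i` is the identity. This is what lets the weights of
successive steps be collected in the single factor `iterWeight`. -/
theorem mul_transfer {F : ℝ → ℝ} (hF : ∀ x, x ∉ branches c d → F x = 0) (u : ℝ → ℝ) (y : ℝ) :
    u y * transfer s F y = transfer s (fun x => u (T x) * F x) y := by
  unfold transfer
  rw [← tsum_mul_left]
  congr 1
  funext i
  by_cases h : F (s i y) = 0
  · simp [h]
  · simp only [hT.apply_of_apply_ne_zero hs hF h]

theorem transfer_eq_zero {F : ℝ → ℝ} (hF : ∀ x, x ∉ branches c d → F x = 0) {y : ℝ}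
    (hy : y ∉ Icc (0 : ℝ) 1) : transfer s F y = 0 := by
  unfold transfer
  convert tsum_zero with i
  by_contra h
  have h1 := hT.mem_of_apply_ne_zero hs hF h
  have h2 := hT.mapsTo (hT.branch_subset i h1)
  rw [hs.right_inv i y h1] at h2
  exact hy h2

omit hs in
theorem differentiableAt {i : ℕ} {x : ℝ} (hx : x ∈ Ioo (c i) (d i)) : DifferentiableAt ℝ T x :=
  ((hT.branch_contDiff i).differentiableOn one_ne_zero).differentiableAt (Ioo_mem_nhds hx.1 hx.2)

omit hs in
theorem injOn_branch (i : ℕ) : InjOn T (Ioo (c i) (d i)) := by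
  rcases hT.branch_monotone i with h | h
  · exact h.injOn
  · exact h.injOn

omit hs in
theorem measurableSet_branch_inter_preimage (i : ℕ) {A : Set ℝ} (hA : MeasurableSet A) :
    MeasurableSet (Ioo (c i) (d i) ∩ T ⁻¹' A) := by
  have h1 : Measurable ((Ioo (c i) (d i)).domRestrict T) :=
    (continuousOn_iff_continuous_domRestrict.1 (hT.branch_contDiff i).continuousOn).measurable
  have h2 := measurableSet_Ioo.subtype_image (h1 hA)
  rwa [domRestrict_eq, preimage_comp, Subtype.image_preimage_coe] at h2

theorem integral_inverse_branch {v : ℝ → ℝ} (i : ℕ) {A : Set ℝ} (hA : MeasurableSet A) :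
    ∫ y in A, weight T c d (s i y) * v (s i y) ∂leb
      = ∫ x in Ioo (c i) (d i) ∩ T ⁻¹' A, v x ∂leb := by
  set B := Ioo (c i) (d i) ∩ T ⁻¹' A with hB
  have hBm : MeasurableSet B := hT.measurableSet_branch_inter_preimage i hA
  have hBI : B ⊆ Icc 0 1 := inter_subset_left.trans (hT.branch_subset i)
  have hF : ∀ x, x ∉ branches c d → weight T c d x * v x = 0 := fun x hx => by
    rw [weight_eq_zero hx, zero_mul]
  have hsub : T '' B ⊆ A ∩ Icc 0 1 := by
    rintro _ ⟨x, hx, rfl⟩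
    exact ⟨hx.2, hT.mapsTo (hBI hx)⟩
  rw [leb, Measure.restrict_restrict hA, Measure.restrict_restrict hBm, inter_eq_left.2 hBI,
    setIntegral_eq_of_subset_of_forall_sdiff_eq_zero (hA.inter measurableSet_Icc) hsub,
    integral_image_eq_integral_abs_deriv_smul hBm (f' := deriv T)
      (fun x hx => (hT.differentiableAt hx.1).hasDerivAt.hasDerivWithinAt)
      ((hT.injOn_branch i).mono inter_subset_left)]
  · refine setIntegral_congr_fun hBm fun x hx => ?_
    have hU : x ∈ ⋃ i, Ioo (c i) (d i) := mem_iUnion.2 ⟨i, hx.1⟩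
    have h0 : |deriv T x| ≠ 0 := abs_ne_zero.2 (hT.branch_deriv_ne_zero i x hx.1)
    simp only [hs.left_inv i x hx.1, weight, indicator_of_mem hU, smul_eq_mul]
    field_simp
  · rintro y ⟨hy1, hy2⟩
    by_contra h
    have h1 := hT.mem_of_apply_ne_zero hs (F := fun x => weight T c d x * v x) hF h
    have h2 := hs.right_inv i y h1
    exact hy2 ⟨s i y, ⟨h1, by rw [mem_preimage, h2]; exact hy1.1⟩, h2⟩

/-- The change of variables on single branches is summed. The variations over the closed branches
dominate the terms, and the branch domains fill the preimage up to a null set. -/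
theorem integral_transfer {v : ℝ → ℝ} (hvint : Integrable v leb)
    (hfin : eVariationOn (fun x => weight T c d x * v x) univ ≠ ∞) {A : Set ℝ}
    (hA : MeasurableSet A) :
    ∫ y in A, transfer s (fun x => weight T c d x * v x) y ∂leb
      = ∫ x in T ⁻¹' A, v x ∂leb := by
  have hF : ∀ x, x ∉ branches c d → weight T c d x * v x = 0 := fun x hx => by
    rw [weight_eq_zero hx, zero_mul]
  have hFm : Measurable fun x => weight T c d x * v x := measurable_of_eVariationOn_ne_top hfin
  have hsm : ∀ i, Measurable (s i) := fun i => by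
    rcases hs.monotone i with h | h
    · exact h.measurable
    · exact h.measurable
  have hbd : ∀ i y, ‖weight T c d (s i y) * v (s i y)‖ ≤
      (eVariationOn (fun x => weight T c d x * v x) (closedBranch c d i)).toReal :=
    fun i y => hT.abs_apply_le hs hF hfin i y
  have hint : ∀ i, Integrable (fun y => weight T c d (s i y) * v (s i y)) (leb.restrict A) :=
    fun i => (integrable_const _).mono' (hFm.comp (hsm i)).aestronglyMeasurable
      (Eventually.of_forall (hbd i))
  have hsum := hasSum_integral_of_summable_integral_norm hint (by
    refine (hT.summable_toReal hfin).of_nonneg_of_le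
      (fun i => integral_nonneg fun _ => norm_nonneg _) fun i => ?_
    refine (integral_mono (hint i).norm (integrable_const _) (hbd i)).trans ?_
    rw [integral_const, smul_eq_mul]
    refine mul_le_of_le_one_left ENNReal.toReal_nonneg ?_
    rw [measureReal_restrict_apply_univ]
    exact measureReal_le_one)
  have e1 := hsum.tsum_eq
  unfold transfer
  rw [← e1]
  simp_rw [hT.integral_inverse_branch hs _ hA]
  rw [← integral_iUnion (fun i => hT.measurableSet_branch_inter_preimage i hA)
    (fun i j hij => (hT.branch_disjoint hij).mono inter_subset_left inter_subset_left)
    hvint.integrableOn, ← iUnion_inter]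
  refine setIntegral_congr_set ?_
  have hU : (⋃ i, Ioo (c i) (d i)) =ᵐ[leb] univ := by
    rw [ae_eq_univ]; exact hT.branch_full
  have := hU.inter (ae_eq_refl (T ⁻¹' A) : T ⁻¹' A =ᵐ[leb] T ⁻¹' A)
  rwa [univ_inter] at this

end IsPiecewiseExpanding

/-! ### Local variation of the iterated weights -/

theorem eVariationOn_indicator_Ioo_le {c d : ℝ} {F : ℝ → ℝ} (hcd : c < d) (hc : F c = 0)
    (hd : F d = 0) : eVariationOn ((Ioo c d).indicator F) univ ≤ eVariationOn F (Icc c d) := by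
  -- Moving each point to the nearest point of [c, d] realises the cut as a monotone change of
  -- variable, because `F` vanishes at both ends.
  have he : (Ioo c d).indicator F = F ∘ fun x => max c (min d x) := by
    funext x
    by_cases hx : x ∈ Ioo c d
    · rw [indicator_of_mem hx, Function.comp, min_eq_right hx.2.le, max_eq_right hx.1.le]
    · rw [indicator_of_notMem hx, Function.comp]
      rcases le_or_gt x c with h | h
      · rw [max_eq_left ((min_le_right _ _).trans h), hc]
      · have : d ≤ x := not_lt.1 fun h' => hx ⟨h, h'⟩
        rw [min_eq_left this, max_eq_right hcd.le, hd]
  rw [he]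
  refine eVariationOn.comp_le_of_monotoneOn F _ (fun x _ y _ h => ?_) fun x _ => ⟨le_max_left _ _,
    max_le hcd.le (min_le_left _ _)⟩
  exact max_le_max_left _ (min_le_min_left _ h)

theorem eVariationOn_comp_le_image {σ : ℝ → ℝ} (hσ : Monotone σ ∨ Antitone σ) (u : ℝ → ℝ)
    (J : Set ℝ) : eVariationOn (fun x => u (σ x)) J ≤ eVariationOn u (σ '' J) := by
  rcases hσ with h | h
  · exact eVariationOn.comp_le_of_monotoneOn u σ (h.monotoneOn _) (mapsTo_image σ J)
  · exact eVariationOn.comp_le_of_antitoneOn u σ (h.antitoneOn _) (mapsTo_image σ J)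

/-- `l` is the filter of left or of right neighbourhoods of a point. -/
def IsSide (l : Filter ℝ) (x : ℝ) : Prop := l = 𝓝[>] x ∨ l = 𝓝[<] x

theorem IsSide.neBot {l : Filter ℝ} {x : ℝ} (h : IsSide l x) : l.NeBot := by
  rcases h with rfl | rfl <;> infer_instance

theorem IsSide.exists_ordConnected {l : Filter ℝ} {x : ℝ} (h : IsSide l x) {t : Set ℝ}
    (ht : t ∈ l) : ∃ J ∈ l, J ⊆ t ∧ J.OrdConnected := by
  rcases h with rfl | rfl
  · obtain ⟨u, hu, h2⟩ := mem_nhdsGT_iff_exists_Ioo_subset.1 ht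
    exact ⟨_, Ioo_mem_nhdsGT hu, h2, ordConnected_Ioo⟩
  · obtain ⟨u, hu, h2⟩ := mem_nhdsLT_iff_exists_Ioo_subset.1 ht
    exact ⟨_, Ioo_mem_nhdsLT hu, h2, ordConnected_Ioo⟩

theorem IsSide.eventually_eVariationOn_le {l : Filter ℝ} {x : ℝ} (h : IsSide l x) {F : ℝ → ℝ}
    (hF : eVariationOn F univ ≠ ∞) {δ : ℝ≥0∞} (hδ : 0 < δ) :
    ∀ᶠ J in l.smallSets, eVariationOn F J ≤ δ := by
  have hb : BoundedVariationOn F univ := hF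
  rw [eventually_smallSets' fun s t hst ht => (eVariationOn.mono F hst).trans ht]
  rcases h with rfl | rfl
  · have h1 := hb.tendsto_eVariationOn_Ioc_zero x
    rw [nhdsWithin_univ] at h1
    obtain ⟨y, hy, hxy⟩ := (((h1.mono_left nhdsWithin_le_nhds).eventually (gt_mem_nhds hδ)).and
      (self_mem_nhdsWithin (a := x) (s := Ioi x))).exists
    rw [univ_inter] at hy
    exact ⟨Ioc x y, Ioc_mem_nhdsGT hxy, hy.le⟩
  · have h1 := hb.tendsto_eVariationOn_Ico_zero x
    rw [nhdsWithin_univ] at h1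
    obtain ⟨y, hy, hxy⟩ := (((h1.mono_left nhdsWithin_le_nhds).eventually (gt_mem_nhds hδ)).and
      (self_mem_nhdsWithin (a := x) (s := Iio x))).exists
    rw [univ_inter] at hy
    exact ⟨Ico y x, Ico_mem_nhdsLT hxy, hy.le⟩

/-- Monotone functions have one-sided limits, and strictness makes the approach to them one-sided as
well. One-sided neighbourhoods are thus carried to one-sided neighbourhoods, which permits induction
along an orbit. -/
theorem IsSide.exists_tendsto_of_strictMonoOn {l : Filter ℝ} {x : ℝ} (h : IsSide l x) {T : ℝ → ℝ}
    {B : Set ℝ} (hB : B ∈ l) (hm : StrictMonoOn T B) (hl : BddBelow (T '' B))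
    (hu : BddAbove (T '' B)) : ∃ (y : ℝ) (l' : Filter ℝ), IsSide l' y ∧ Tendsto T l l' := by
  obtain ⟨σ, hσ, hσT⟩ := hm.monotoneOn.exists_monotone_extension hl hu
  have hev : ∀ᶠ t in l, T t = σ t := by
    filter_upwards [hB] with t ht using hσT ht
  rcases h with rfl | rfl
  · refine ⟨sInf (σ '' Ioi x), _, Or.inl rfl, tendsto_nhdsWithin_iff.2
      ⟨(hσ.tendsto_nhdsGT x).congr' (hev.mono fun t ht => ht.symm), ?_⟩⟩
    filter_upwards [hB, self_mem_nhdsWithin] with t ht hxt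
    obtain ⟨t', ht'1, ht'2⟩ := Filter.nonempty_of_mem
      (inter_mem hB (Ioo_mem_nhdsGT (mem_Ioi.1 hxt)))
    have h1 : sInf (σ '' Ioi x) ≤ σ t' := by
      refine csInf_le ⟨σ x, ?_⟩ (mem_image_of_mem σ ht'2.1)
      rintro _ ⟨w, hw, rfl⟩
      exact hσ (le_of_lt hw)
    rw [← hσT ht'1] at h1
    exact h1.trans_lt (hm ht'1 ht ht'2.2)
  · refine ⟨sSup (σ '' Iio x), _, Or.inr rfl, tendsto_nhdsWithin_iff.2
      ⟨(hσ.tendsto_nhdsLT x).congr' (hev.mono fun t ht => ht.symm), ?_⟩⟩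
    filter_upwards [hB, self_mem_nhdsWithin] with t ht hxt
    obtain ⟨t', ht'1, ht'2⟩ := Filter.nonempty_of_mem
      (inter_mem hB (Ioo_mem_nhdsLT (mem_Iio.1 hxt)))
    have h1 : σ t' ≤ sSup (σ '' Iio x) := by
      refine le_csSup ⟨σ x, ?_⟩ (mem_image_of_mem σ ht'2.2)
      rintro _ ⟨w, hw, rfl⟩
      exact hσ (le_of_lt hw)
    rw [← hσT ht'1] at h1
    exact (hm ht ht'1 ht'2.1).trans_le h1

/-- The weight of the system with hole `H`. -/
noncomputable def holeWeight (T : ℝ → ℝ) (c d : ℕ → ℝ) (H : Set ℝ) : ℝ → ℝ :=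
  Hᶜ.indicator (weight T c d)

/-- The weights of the iterates of the system with hole `H`. -/
noncomputable def iterWeight (T : ℝ → ℝ) (c d : ℕ → ℝ) (H : Set ℝ) : ℕ → ℝ → ℝ
  | 0 => fun _ => 1
  | n + 1 => fun x => holeWeight T c d H x * iterWeight T c d H n (T x)

theorem weight_nonneg (T : ℝ → ℝ) (c d : ℕ → ℝ) (x : ℝ) : 0 ≤ weight T c d x :=
  indicator_nonneg (fun _ _ => by positivity) x

theorem enorm_holeWeight_le_of {T : ℝ → ℝ} {c d : ℕ → ℝ} {Θ : ℝ≥0∞} {x : ℝ}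
    (h : ‖weight T c d x‖ₑ ≤ Θ) (H : Set ℝ) : ‖holeWeight T c d H x‖ₑ ≤ Θ := by
  unfold holeWeight
  by_cases hx : x ∈ Hᶜ
  · rwa [indicator_of_mem hx]
  · rw [indicator_of_notMem hx]; simp

theorem enorm_iterWeight_le {T : ℝ → ℝ} {c d : ℕ → ℝ} {Θ : ℝ≥0∞}
    (h : ∀ x, ‖weight T c d x‖ₑ ≤ Θ) (H : Set ℝ) (n : ℕ) (x : ℝ) :
    ‖iterWeight T c d H n x‖ₑ ≤ Θ ^ n := by
  induction n generalizing x with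
  | zero => simp [iterWeight]
  | succ n ih =>
    rw [iterWeight, enorm_mul, pow_succ']
    exact mul_le_mul' (enorm_holeWeight_le_of (h x) H) (ih _)

namespace IsPiecewiseExpanding

variable {T : ℝ → ℝ} {c d : ℕ → ℝ} (hT : IsPiecewiseExpanding T c d)
include hT

/-- A bound for the weight. -/
theorem exists_rate : ∃ θ : ℝ, 0 < θ ∧ θ < 1 ∧ ∀ x, ‖weight T c d x‖ₑ ≤ ENNReal.ofReal θ := by
  obtain ⟨θ, h1, h2⟩ := hT.weight_lt_one
  refine ⟨max θ (1 / 2), by positivity, max_lt h1 (by norm_num), fun x => enorm_le_of_abs_le ?_⟩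
  rw [abs_of_nonneg (weight_nonneg T c d x)]
  exact (h2 x).trans (le_max_left _ _)

theorem image_branch_subset (i : ℕ) : T '' Ioo (c i) (d i) ⊆ Icc 0 1 :=
  image_subset_iff.2 fun _ hx => hT.mapsTo (hT.branch_subset i hx)

theorem exists_extension_branch (i : ℕ) :
    ∃ σ : ℝ → ℝ, (Monotone σ ∨ Antitone σ) ∧ EqOn σ T (Ioo (c i) (d i)) := by
  have hl : BddBelow (T '' Ioo (c i) (d i)) := bddBelow_Icc.mono (hT.image_branch_subset i)
  have hu : BddAbove (T '' Ioo (c i) (d i)) := bddAbove_Icc.mono (hT.image_branch_subset i)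
  rcases hT.branch_monotone i with h | h
  · obtain ⟨σ, h1, h2⟩ := h.monotoneOn.exists_monotone_extension hl hu
    exact ⟨σ, Or.inl h1, h2.symm⟩
  · obtain ⟨σ, h1, h2⟩ := h.antitoneOn.exists_antitone_extension hl hu
    exact ⟨σ, Or.inr h1, h2.symm⟩

theorem exists_tendsto_side {l : Filter ℝ} {x : ℝ} (h : IsSide l x) {i : ℕ}
    (hi : Ioo (c i) (d i) ∈ l) : ∃ (y : ℝ) (l' : Filter ℝ), IsSide l' y ∧ Tendsto T l l' := by
  have hl : BddBelow (T '' Ioo (c i) (d i)) := bddBelow_Icc.mono (hT.image_branch_subset i)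
  have hu : BddAbove (T '' Ioo (c i) (d i)) := bddAbove_Icc.mono (hT.image_branch_subset i)
  rcases hT.branch_monotone i with hm | hm
  · exact h.exists_tendsto_of_strictMonoOn hi hm hl hu
  · have hneg : ∀ B, (fun x => -T x) '' B = Neg.neg '' (T '' B) := fun B => by
      rw [image_image]
    obtain ⟨y, l', hl', ht⟩ := h.exists_tendsto_of_strictMonoOn (T := fun x => -T x) hi
      (fun a ha b hb hab => neg_lt_neg (hm ha hb hab))
      (by rw [hneg, image_neg_eq_neg]; exact hu.neg) (by rw [hneg, image_neg_eq_neg]; exact hl.neg)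
    have e : T = Neg.neg ∘ fun x => -T x := by funext x; simp
    rw [e]
    rcases hl' with rfl | rfl
    · exact ⟨-y, _, Or.inr rfl, tendsto_neg_nhdsGT.comp ht⟩
    · exact ⟨-y, _, Or.inl rfl, tendsto_neg_nhdsLT.comp ht⟩

/-- With infinitely many branches `u ∘ T` itself may have infinite variation. On one branch,
however, both the supremum and the variation of `w` are at most its variation over the closed
branch, and these numbers add up. -/
theorem eVariationOn_mul_comp_le {w u : ℝ → ℝ} (hw : ∀ x, x ∉ branches c d → w x = 0)
    {A : ℝ≥0∞} (hu : ∀ x, ‖u x‖ₑ ≤ A) :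
    eVariationOn (fun x => w x * u (T x)) univ
      ≤ eVariationOn w univ * (A + eVariationOn u univ) := by
  have hzero : ∀ x i j, x ∈ Ioo (c i) (d i) → j ≠ i →
      (Ioo (c j) (d j)).indicator w x * u (T x) = 0 := fun x i j hi hj => by
    rw [indicator_of_notMem (fun hxj => hj (hT.eq_of_mem_of_mem hxj hi)), zero_mul]
  have hall : ∀ x, x ∉ branches c d → ∀ j,
      (Ioo (c j) (d j)).indicator w x * u (T x) = 0 := fun x hx j => by
    rw [indicator_of_notMem (fun hxj => hx (mem_iUnion.2 ⟨j, hxj⟩)), zero_mul]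
  have he : (fun x => w x * u (T x))
      = fun x => ∑' i, (Ioo (c i) (d i)).indicator w x * u (T x) := by
    funext x
    by_cases hx : x ∈ branches c d
    · obtain ⟨i, hi⟩ := mem_iUnion.1 hx
      rw [tsum_eq_single i (fun j hj => hzero x i j hi hj), indicator_of_mem hi]
    · simp only [hall x hx, tsum_zero, hw x hx, zero_mul]
  have hterm : ∀ i, eVariationOn (fun x => (Ioo (c i) (d i)).indicator w x * u (T x)) univ
      ≤ eVariationOn w (closedBranch c d i) * (A + eVariationOn u univ) := by
    intro i
    by_cases hcd : c i < d i
    · obtain ⟨σ, hσ, hσT⟩ := hT.exists_extension_branch i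
      have e : (fun x => (Ioo (c i) (d i)).indicator w x * u (T x))
          = fun x => (Ioo (c i) (d i)).indicator w x * u (σ x) := by
        funext x
        by_cases hx : x ∈ Ioo (c i) (d i)
        · rw [hσT hx]
        · rw [indicator_of_notMem hx, zero_mul, zero_mul]
      have hcl : closedBranch c d i = Icc (c i) (d i) := by
        ext x; exact ⟨fun h => h.2, fun h => ⟨hcd, h⟩⟩
      have hb : ∀ x, ‖(Ioo (c i) (d i)).indicator w x‖ₑ ≤ eVariationOn w (closedBranch c d i) := by
        intro x
        by_cases hx : x ∈ Ioo (c i) (d i)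
        · rw [indicator_of_mem hx, hcl]
          have := eVariationOn.edist_le w (Ioo_subset_Icc_self hx) (left_mem_Icc.2 hcd.le)
          rwa [hw _ (hT.left_notMem_branches hcd), edist_zero_right] at this
        · rw [indicator_of_notMem hx]; simp
      rw [e, mul_add]
      refine (eVariationOn_mul_le (fun x _ => hb x) fun x _ => hu (σ x)).trans ?_
      gcongr
      · rw [hcl]
        exact eVariationOn_indicator_Ioo_le hcd (hw _ (hT.left_notMem_branches hcd))
          (hw _ (hT.right_notMem_branches hcd))
      · exact (eVariationOn_comp_le_image hσ u univ).trans (eVariationOn.mono u (subset_univ _))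
    · rw [Ioo_eq_empty hcd, indicator_empty]
      simp only [zero_mul]
      rw [eVariationOn.constant_on (by rintro _ ⟨x, -, rfl⟩ _ ⟨y, -, rfl⟩; rfl)]
      exact bot_le
  rw [he]
  refine (eVariationOn_tsum_le fun x _ => ?_).trans ((ENNReal.tsum_le_tsum hterm).trans ?_)
  · by_cases hx : x ∈ branches c d
    · obtain ⟨i, hi⟩ := mem_iUnion.1 hx
      exact summable_of_ne_finset_zero (s := {i}) fun j hj =>
        hzero x i j hi (by simpa using hj)
    · simp only [hall x hx]; exact summable_zero
  · rw [ENNReal.tsum_mul_right]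
    gcongr
    exact hT.tsum_eVariationOn_closedBranch_le w

omit hT in
theorem holeWeight_eq_zero {H : Set ℝ} {x : ℝ} (hx : x ∉ branches c d) :
    holeWeight T c d H x = 0 := by
  unfold holeWeight
  by_cases h : x ∈ Hᶜ
  · rw [indicator_of_mem h, weight_eq_zero hx]
  · rw [indicator_of_notMem h]

/-- A crude bound, with no decay in `n`; what matters is that it is finite and the same for all
holes. -/
theorem exists_eVariationOn_iterWeight_le (n : ℕ) :
    ∃ M : ℝ≥0∞, M ≠ ∞ ∧ ∀ H : Set ℝ, H.OrdConnected → eVariationOn (iterWeight T c d H n) univ ≤ M := by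
  obtain ⟨θ, -, -, hθ⟩ := hT.exists_rate
  induction n with
  | zero =>
    refine ⟨0, ENNReal.zero_ne_top, fun H _ => ?_⟩
    exact (eVariationOn.constant_on (by rintro _ ⟨x, -, rfl⟩ _ ⟨y, -, rfl⟩; rfl)).le
  | succ n ih =>
    obtain ⟨M, hM, hMH⟩ := ih
    refine ⟨(eVariationOn (weight T c d) univ + 2 * ENNReal.ofReal θ)
      * (ENNReal.ofReal θ ^ n + M), ?_, fun H hH => ?_⟩
    · refine ENNReal.mul_ne_top (ENNReal.add_ne_top.2 ⟨hT.weight_bv, ?_⟩)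
        (ENNReal.add_ne_top.2 ⟨by finiteness, hM⟩)
      finiteness
    · refine (hT.eVariationOn_mul_comp_le (w := holeWeight T c d H)
        (fun x hx => holeWeight_eq_zero hx) (enorm_iterWeight_le hθ H n)).trans ?_
      gcongr
      · exact eVariationOn_indicator_compl_le hH fun x _ => hθ x
      · exact hMH H hH

/-- An interval inside the union of the branches lies in one of them, since endpoints of branches
are outside the union. The alternative is that points of weight zero accumulate along the side. -/
theorem mem_side_or_forall_exists {l : Filter ℝ} {x : ℝ} (h : IsSide l x) :
    (∃ i, Ioo (c i) (d i) ∈ l) ∨ ∀ J ∈ l, ∃ y ∈ J, y ∉ branches c d := by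
  by_contra! hcon
  obtain ⟨h1, J, hJ, hJU⟩ := hcon
  obtain ⟨K, hK, hKJ, hKo⟩ := h.exists_ordConnected hJ
  have := h.neBot
  obtain ⟨y, hy⟩ := Filter.nonempty_of_mem hK
  obtain ⟨i, hi⟩ := mem_iUnion.1 (hJU y (hKJ hy))
  have hcd := hi.1.trans hi.2
  refine h1 i (mem_of_superset hK fun w hw => ⟨?_, ?_⟩)
  · by_contra hlt
    exact hT.left_notMem_branches hcd (hJU _ (hKJ (hKo.out hw hy ⟨not_lt.1 hlt, hi.1.le⟩)))
  · by_contra hlt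
    exact hT.right_notMem_branches hcd (hJU _ (hKJ (hKo.out hy hw ⟨hi.2.le, not_lt.1 hlt⟩)))

/-- On small one-sided neighbourhoods the iterated weights have small variation, uniformly in the
hole. -/
theorem eventually_eVariationOn_iterWeight_le {θ : ℝ} (hθ0 : 0 < θ)
    (hθ : ∀ x, ‖weight T c d x‖ₑ ≤ ENNReal.ofReal θ) (n : ℕ) {l : Filter ℝ} {x : ℝ}
    (hl : IsSide l x) : ∀ᶠ J in l.smallSets, ∀ H : Set ℝ, H.OrdConnected →
      eVariationOn (iterWeight T c d H n) J ≤ 3 * n * ENNReal.ofReal θ ^ n := by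
  set Θ := ENNReal.ofReal θ with hΘ
  have hΘ0 : Θ ≠ 0 := by simpa [hΘ] using hθ0
  have hΘt : Θ ≠ ∞ := ENNReal.ofReal_ne_top
  induction n generalizing l x with
  | zero =>
    refine Eventually.of_forall fun J H _ => ?_
    refine (eVariationOn.constant_on ?_).le.trans bot_le
    rintro _ ⟨x, -, rfl⟩ _ ⟨y, -, rfl⟩; rfl
  | succ n ih =>
    -- Inside one branch the side is carried to a side, where the inductive bound applies. The
    -- product rule adds Θ for the local variation of the weight and 2Θ for cutting out the hole,
    -- hence 3 per step.
    rcases hT.mem_side_or_forall_exists hl with ⟨i, hi⟩ | hout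
    · obtain ⟨y, l', hl', ht⟩ := hT.exists_tendsto_side hl hi
      obtain ⟨σ, hσ, hσT⟩ := hT.exists_extension_branch i
      filter_upwards [ht.image_smallSets.eventually (ih hl'), eventually_smallSets_subset.2 hi,
        hl.eventually_eVariationOn_le hT.weight_bv (pos_iff_ne_zero.2 hΘ0)] with J h1 h2 h3 H hH
      have e : EqOn (iterWeight T c d H (n + 1))
          (fun x => holeWeight T c d H x * iterWeight T c d H n (σ x)) J := fun w hw => by
        simp only [iterWeight, hσT (h2 hw)]
      have e2 : σ '' J = T '' J := image_congr fun w hw => hσT (h2 hw)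
      rw [eVariationOn.congr e]
      refine (eVariationOn_mul_le (fun w _ => enorm_holeWeight_le_of (hθ w) H)
        fun w _ => enorm_iterWeight_le hθ H n (σ w)).trans ?_
      have h4 : eVariationOn (holeWeight T c d H) J ≤ Θ + 2 * Θ :=
        (eVariationOn_indicator_compl_le hH fun x _ => hθ x).trans (by gcongr)
      have h5 : eVariationOn (fun x => iterWeight T c d H n (σ x)) J ≤ 3 * n * Θ ^ n := by
        refine (eVariationOn_comp_le_image hσ _ J).trans ?_
        rw [e2]
        exact h1 H hH
      calc _ ≤ (Θ + 2 * Θ) * Θ ^ n + Θ * (3 * n * Θ ^ n) := by gcongr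
        _ = _ := by push_cast; ring
    · obtain ⟨M, hM, hMH⟩ := hT.exists_eVariationOn_iterWeight_le n
      -- The weight has zeros in `J₀`, so small variation there makes it small. With variation at
      -- most `X / Y`, cutting to `J₀` and removing the hole give at most 5 `X / Y`; `Y` is chosen
      -- so that the crude bound for the remaining factor turns this into `X`.
      set X : ℝ≥0∞ := 3 * ((n + 1 : ℕ) : ℝ≥0∞) * Θ ^ (n + 1) with hX
      set Y : ℝ≥0∞ := 5 * (Θ ^ n + M) with hY
      have hX0 : X ≠ 0 := by
        rw [hX]
        exact mul_ne_zero (mul_ne_zero (by norm_num) (by simp)) (pow_ne_zero _ hΘ0)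
      have hY0 : Y ≠ 0 := by
        rw [hY]
        exact mul_ne_zero (by norm_num) (by simp [pow_ne_zero _ hΘ0])
      have hYt : Y ≠ ∞ := by
        rw [hY]
        exact ENNReal.mul_ne_top (by norm_num) (ENNReal.add_ne_top.2 ⟨ENNReal.pow_ne_top hΘt, hM⟩)
      have hδ : 0 < X / Y := ENNReal.div_pos hX0 hYt
      obtain ⟨K, hK, hKV⟩ := (eventually_smallSets'
        fun s t hst ht => (eVariationOn.mono _ hst).trans ht).1
        (hl.eventually_eVariationOn_le hT.weight_bv hδ)
      obtain ⟨J₀, hJ₀, hJK, hJo⟩ := hl.exists_ordConnected hK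
      replace hKV := (eVariationOn.mono _ hJK).trans hKV
      obtain ⟨y, hy, hyU⟩ := hout J₀ hJ₀
      have hsup : ∀ x ∈ J₀, ‖weight T c d x‖ₑ ≤ X / Y := fun x hx => by
        have := (eVariationOn.edist_le (weight T c d) hx hy).trans hKV
        rwa [weight_eq_zero hyU, edist_zero_right] at this
      filter_upwards [eventually_smallSets_subset.2 hJ₀] with J hJ H hH
      have e : EqOn (iterWeight T c d H (n + 1))
          (fun x => Hᶜ.indicator (J₀.indicator (weight T c d)) x * iterWeight T c d H n (T x)) J :=
        fun w hw => by
          have : Hᶜ.indicator (J₀.indicator (weight T c d)) w = holeWeight T c d H w := by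
            unfold holeWeight
            by_cases hwH : w ∈ Hᶜ
            · rw [indicator_of_mem hwH, indicator_of_mem hwH, indicator_of_mem (hJ hw)]
            · rw [indicator_of_notMem hwH, indicator_of_notMem hwH]
          simp only [iterWeight, this]
      rw [eVariationOn.congr e]
      refine (eVariationOn.mono _ (subset_univ J)).trans
        ((hT.eVariationOn_mul_comp_le (fun x hx => ?_) (enorm_iterWeight_le hθ H n)).trans ?_)
      · by_cases hxH : x ∈ Hᶜ
        · rw [indicator_of_mem hxH]
          by_cases hxJ : x ∈ J₀
          · rw [indicator_of_mem hxJ, weight_eq_zero hx]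
          · rw [indicator_of_notMem hxJ]
        · rw [indicator_of_notMem hxH]
      · have h1 : eVariationOn (J₀.indicator (weight T c d)) univ ≤ X / Y + 2 * (X / Y) :=
          (eVariationOn_indicator_le hJo hsup).trans (by gcongr)
        have h2 : eVariationOn (Hᶜ.indicator (J₀.indicator (weight T c d))) univ
            ≤ (X / Y + 2 * (X / Y)) + 2 * (X / Y) := by
          refine (eVariationOn_indicator_compl_le hH (A := X / Y) fun x _ => ?_).trans (by gcongr)
          by_cases hxJ : x ∈ J₀
          · rw [indicator_of_mem hxJ]; exact hsup x hxJ
          · rw [indicator_of_notMem hxJ]; simp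
        calc _ ≤ ((X / Y + 2 * (X / Y)) + 2 * (X / Y)) * (Θ ^ n + M) := by
              gcongr
              exact hMH H hH
          _ = X / Y * Y := by rw [hY]; ring
          _ = X := ENNReal.div_mul_cancel hY0 hYt
          _ ≤ _ := le_rfl

/-- On cells of a sufficiently fine partition the iterated weights have small variation, uniformly
in the hole. -/
theorem exists_eVariationOn_iterWeight_cell_le {θ : ℝ} (hθ0 : 0 < θ)
    (hθ : ∀ x, ‖weight T c d x‖ₑ ≤ ENNReal.ofReal θ) (n : ℕ) :
    ∃ N : ℕ, 0 < N ∧ ∀ k ≤ N, ∀ H : Set ℝ, H.OrdConnected →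
      eVariationOn (iterWeight T c d H n) (cell N k) ≤ (6 * n + 6) * ENNReal.ofReal θ ^ n := by
  set Θ := ENNReal.ofReal θ with hΘ
  have hloc : ∀ y : ℝ, ∃ W : Set ℝ, IsOpen W ∧ y ∈ W ∧ ∀ H : Set ℝ, H.OrdConnected →
      eVariationOn (iterWeight T c d H n) W ≤ (6 * n + 6) * Θ ^ n := by
    intro y
    have hmono : ∀ ⦃s t : Set ℝ⦄, s ⊆ t → (∀ H : Set ℝ, H.OrdConnected →
      eVariationOn (iterWeight T c d H n) t ≤ 3 * n * Θ ^ n) → (∀ H : Set ℝ, H.OrdConnected →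
      eVariationOn (iterWeight T c d H n) s ≤ 3 * n * Θ ^ n) := fun s t hst ht H hH =>
        (eVariationOn.mono _ hst).trans (ht H hH)
    obtain ⟨R, hR, hRV⟩ := (eventually_smallSets' hmono).1
      (hT.eventually_eVariationOn_iterWeight_le hθ0 hθ n (Or.inl rfl : IsSide (𝓝[>] y) y))
    obtain ⟨L, hL, hLV⟩ := (eventually_smallSets' hmono).1
      (hT.eventually_eVariationOn_iterWeight_le hθ0 hθ n (Or.inr rfl : IsSide (𝓝[<] y) y))
    obtain ⟨b, hb, hbR⟩ := mem_nhdsGT_iff_exists_Ioo_subset.1 hR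
    obtain ⟨a, ha, haL⟩ := mem_nhdsLT_iff_exists_Ioo_subset.1 hL
    refine ⟨Ioo a b, isOpen_Ioo, ⟨ha, hb⟩, fun H hH => ?_⟩
    have hbd := enorm_iterWeight_le hθ H n
    set G := iterWeight T c d H n
    -- Cutting at `y` costs 2Θⁿ for each of the three pieces, in addition to 3nΘⁿ from each side;
    -- the total is (6n + 6)Θⁿ.
    have e : EqOn G (fun x => (Ioo a y).indicator G x + (({y} : Set ℝ).indicator G x
        + (Ioo y b).indicator G x)) (Ioo a b) := by
      intro x hx
      simp only
      rcases lt_trichotomy x y with h | h | h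
      · rw [indicator_of_mem (show x ∈ Ioo a y from ⟨hx.1, h⟩), indicator_of_notMem (by simpa using h.ne),
          indicator_of_notMem (fun h' => lt_asymm h h'.1), add_zero, add_zero]
      · rw [indicator_of_notMem (fun h' => h'.2.ne h), indicator_of_mem (by simpa using h),
          indicator_of_notMem (fun h' => h'.1.ne' h), zero_add, add_zero]
      · rw [indicator_of_mem (show x ∈ Ioo y b from ⟨h, hx.2⟩),
          indicator_of_notMem (fun h' => lt_asymm h h'.2), indicator_of_notMem (by simpa using h.ne'),
          zero_add, zero_add]
    have h1 := eVariationOn_indicator_le (ordConnected_Ioo (a := a) (b := y)) (F := G)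
      fun x _ => hbd x
    have h2 := eVariationOn_indicator_le (ordConnected_singleton (a := y)) (F := G)
      fun x _ => hbd x
    have h3 := eVariationOn_indicator_le (ordConnected_Ioo (a := y) (b := b)) (F := G)
      fun x _ => hbd x
    rw [eVariationOn.subsingleton _ subsingleton_singleton, zero_add] at h2
    have h4 := (eVariationOn.mono _ haL).trans (hLV H hH)
    have h5 := (eVariationOn.mono _ hbR).trans (hRV H hH)
    rw [eVariationOn.congr e]
    refine (eVariationOn.mono _ (subset_univ _)).trans ((eVariationOn_add_le' _ _ univ).trans
      ((add_le_add_right (eVariationOn_add_le' _ _ univ) _).trans ?_))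
    calc _ ≤ (3 * n * Θ ^ n + 2 * Θ ^ n) + (2 * Θ ^ n + (3 * n * Θ ^ n + 2 * Θ ^ n)) := by
          refine add_le_add (h1.trans ?_) (add_le_add h2 (h3.trans ?_))
          · gcongr
          · gcongr
      _ = _ := by ring
  choose W hWo hyW hWV using hloc
  obtain ⟨δ, hδ, hball⟩ := lebesgue_number_lemma_of_metric (isCompact_Icc (a := (0 : ℝ)) (b := 1))
    hWo fun x _ => mem_iUnion.2 ⟨x, hyW x⟩
  obtain ⟨N, hN⟩ := exists_nat_one_div_lt hδ
  refine ⟨N + 1, Nat.succ_pos N, fun k hk H hH => ?_⟩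
  have hN' : (0 : ℝ) < (N + 1 : ℕ) := by positivity
  obtain ⟨y, hy⟩ := hball ((k : ℝ) / (N + 1 : ℕ)) ⟨by positivity, by
    rw [div_le_one hN']; exact_mod_cast hk⟩
  refine (eVariationOn.mono _ (Subset.trans (fun x hx => ?_) hy)).trans (hWV y H hH)
  rw [Metric.mem_ball, Real.dist_eq, abs_of_nonneg (by linarith [hx.1])]
  have := hx.2
  rw [add_div] at this
  push_cast at *
  linarith

end IsPiecewiseExpanding

/-! ### Transfer operators on `BV` and the Lasota-Yorke inequality -/

/-- The transfer operator of the system with hole `H`, on functions. -/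
noncomputable def openTransfer (T : ℝ → ℝ) (c d : ℕ → ℝ) (s : ℕ → ℝ → ℝ) (H : Set ℝ)
    (v : ℝ → ℝ) : ℝ → ℝ :=
  transfer s fun x => weight T c d x * Hᶜ.indicator v x

/-- The value at a point differs from every other value on the cell by at most the variation there;
averaging over the cell gives the bound. The mean becomes the L¹ term of the Lasota–Yorke
inequality. -/
theorem enorm_le_on_cell {N : ℕ} (hN : 0 < N) (v : ℝ → ℝ) {k : ℕ} {x : ℝ} (hx : x ∈ cell N k) :
    ‖v x‖ₑ ≤ eVariationOn v (cell N k) + N * ∫⁻ y in cell N k, ‖v y‖ₑ := by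
  have hvol : (N : ℝ≥0∞) * volume (cell N k) = 1 := by
    have hN' : (0 : ℝ) < N := by exact_mod_cast hN
    rw [volume_cell, ← ENNReal.ofReal_natCast, ← ENNReal.ofReal_mul hN'.le,
      mul_one_div_cancel hN'.ne', ENNReal.ofReal_one]
  calc ‖v x‖ₑ = N * ∫⁻ _ in cell N k, ‖v x‖ₑ := by
        rw [setLIntegral_const, mul_comm ‖v x‖ₑ, ← mul_assoc, hvol, one_mul]
    _ ≤ N * ∫⁻ y in cell N k, (‖v y‖ₑ + eVariationOn v (cell N k)) := by
        gcongr 1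
        refine setLIntegral_mono' (measurableSet_cell N k) fun y hy => ?_
        have h1 := eVariationOn.edist_le v hx hy
        rw [edist_eq_enorm_sub] at h1
        calc ‖v x‖ₑ = ‖v y + (v x - v y)‖ₑ := by congr 1; ring
          _ ≤ ‖v y‖ₑ + ‖v x - v y‖ₑ := enorm_add_le _ _
          _ ≤ _ := by gcongr
    _ = _ := by
        rw [lintegral_add_right _ measurable_const, setLIntegral_const, mul_add, add_comm,
          mul_comm (eVariationOn v (cell N k)), ← mul_assoc, hvol, one_mul]

/-- The points which have not fallen into the hole `H` before time `n`. -/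
def survivors (T : ℝ → ℝ) (H : Set ℝ) (n : ℕ) : Set ℝ := {x | ∀ j < n, T^[j] x ∉ H}

theorem survivors_succ (T : ℝ → ℝ) (H : Set ℝ) (n : ℕ) :
    survivors T H (n + 1) = T ⁻¹' survivors T H n \ H := by
  ext x
  simp only [survivors, mem_ofPred_eq, Set.mem_sdiff, mem_preimage]
  constructor
  · intro h
    exact ⟨fun j hj => by rw [← Function.iterate_succ_apply]; exact h (j + 1) (by lia),
      h 0 (by lia)⟩
  · rintro ⟨h1, h2⟩ j hj
    cases j with
    | zero => exact h2
    | succ j => rw [Function.iterate_succ_apply]; exact h1 j (by lia)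

namespace BV

theorem ext_setIntegral {f g : BV}
    (h : ∀ A, MeasurableSet A → ∫ x in A, f.fn x ∂leb = ∫ x in A, g.fn x ∂leb) : f = g :=
  ext_fn (Integrable.ae_eq_of_forall_setIntegral_eq _ _ f.integrable g.integrable
    fun A hA _ => h A hA)

theorem measurable_fn (f : BV) : Measurable f.fn := (AEEqFun.stronglyMeasurable _).measurable

theorem eVariationOn_unit_le : eVariationOn ((Icc (0 : ℝ) 1).indicator fun _ => (1 : ℝ)) univ ≤ 2 :=
  eVariationOn_indicator_one_le ordConnected_Icc

theorem essVar_one_lt_top : essVar (fun _ => (1 : ℝ)) < ∞ := by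
  refine (essVar_le (v := (Icc (0 : ℝ) 1).indicator fun _ => (1 : ℝ)) ?_ fun x hx =>
    indicator_of_notMem hx _).trans_lt (eVariationOn_unit_le.trans_lt (by norm_num))
  have hmem : ∀ᵐ x ∂leb, x ∈ Icc (0 : ℝ) 1 := ae_restrict_mem measurableSet_Icc
  filter_upwards [hmem] with x hx
  rw [indicator_of_mem hx]

/-- The constant function `1`. -/
noncomputable def one : BV := mk (fun _ => 1) aestronglyMeasurable_const essVar_one_lt_top

theorem fn_one : one.fn =ᵐ[leb] fun _ => 1 := fn_mk _ _ _

end BV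

namespace IsPiecewiseExpanding

variable {T : ℝ → ℝ} {c d : ℕ → ℝ} (hT : IsPiecewiseExpanding T c d)
include hT

/-- The weight of the later steps is pulled inside the sum over branches, so that n steps act on one
weighted function; the sums themselves cost no variation. -/
theorem eVariationOn_iterate_openTransfer_le {s : ℕ → ℝ → ℝ} (hs : IsInverseBranches T c d s)
    (H : Set ℝ) (n : ℕ) (v : ℝ → ℝ) :
    eVariationOn ((openTransfer T c d s H)^[n] v) univ
      ≤ eVariationOn (fun x => iterWeight T c d H n x * v x) univ := by
  induction n generalizing v with
  | zero => simp [iterWeight]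
  | succ n ih =>
    have h0 : ∀ x, x ∉ branches c d → weight T c d x * Hᶜ.indicator v x = 0 := fun x hx => by
      rw [weight_eq_zero hx, zero_mul]
    rw [Function.iterate_succ_apply]
    refine (ih _).trans ?_
    have e1 : (fun x => iterWeight T c d H n x * openTransfer T c d s H v x)
        = transfer s (fun x => iterWeight T c d H n (T x)
          * (weight T c d x * Hᶜ.indicator v x)) := by
      funext y
      exact hT.mul_transfer hs h0 _ y
    have e2 : (fun x => iterWeight T c d H n (T x) * (weight T c d x * Hᶜ.indicator v x))
        = fun x => iterWeight T c d H (n + 1) x * v x := by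
      funext x
      simp only [iterWeight, holeWeight]
      by_cases hx : x ∈ Hᶜ
      · rw [indicator_of_mem hx, indicator_of_mem hx]; ring
      · rw [indicator_of_notMem hx, indicator_of_notMem hx]; ring
    rw [e1, ← e2]
    refine hT.eVariationOn_transfer_le hs fun x hx => ?_
    rw [h0 x hx, mul_zero]

/-- On each cell the iterated weight is small both in supremum and in variation. In 6n + 9, the part
6n + 6 is the variation of the weight, 1 that of `v`, and 2 the cut to the cell; the growth is
linear, so θⁿ wins. -/
theorem exists_eVariationOn_iterWeight_mul_le {θ : ℝ} (hθ0 : 0 < θ)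
    (hθ : ∀ x, ‖weight T c d x‖ₑ ≤ ENNReal.ofReal θ) (n : ℕ) :
    ∃ N : ℕ, ∀ H : Set ℝ, H.OrdConnected → ∀ v : ℝ → ℝ, (∀ x, x ∉ Icc (0 : ℝ) 1 → v x = 0) →
      eVariationOn (fun x => iterWeight T c d H n x * v x) univ
        ≤ (6 * n + 9) * ENNReal.ofReal θ ^ n
          * (eVariationOn v univ + N * ∫⁻ x, ‖v x‖ₑ) := by
  set Θ := ENNReal.ofReal θ with hΘ
  obtain ⟨N, hN, hcell⟩ := hT.exists_eVariationOn_iterWeight_cell_le hθ0 hθ n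
  refine ⟨N, fun H hH v hv => ?_⟩
  have hbd := enorm_iterWeight_le hθ H n
  set G := iterWeight T c d H n with hG
  have hN' : (0 : ℝ) < N := by exact_mod_cast hN
  -- The additional cell of index `N` takes care of the point 1.
  have e : (fun x => G x * v x) = fun x => ∑ k ∈ Finset.range (N + 1),
      (cell N k).indicator (fun x => G x * v x) x := by
    funext x
    by_cases hx : x ∈ Icc (0 : ℝ) 1
    · have hk := exists_mem_cell hN hx.1
      rw [Finset.sum_eq_single ⌊x * N⌋₊, indicator_of_mem hk]
      · intro j _ hj
        exact indicator_of_notMem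
          (fun hxj => Set.disjoint_left.1 (cell_disjoint hN hj) hxj hk) _
      · intro h
        exfalso
        apply h
        rw [Finset.mem_range, Nat.lt_succ_iff]
        refine Nat.floor_le_of_le ?_
        nlinarith [hx.2]
    · rw [hv x hx, mul_zero, Finset.sum_eq_zero]
      intro k _
      by_cases hxk : x ∈ cell N k
      · rw [indicator_of_mem hxk, hv x hx, mul_zero]
      · rw [indicator_of_notMem hxk]
  set S : ℕ → ℝ≥0∞ := fun k => eVariationOn v (cell N k) + N * ∫⁻ y in cell N k, ‖v y‖ₑ with hS
  have hterm : ∀ k ∈ Finset.range (N + 1),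
      eVariationOn ((cell N k).indicator fun x => G x * v x) univ
        ≤ (6 * n + 9) * Θ ^ n * S k := by
    intro k hk
    have hk' : k ≤ N := Nat.lt_succ_iff.1 (Finset.mem_range.1 hk)
    have h1 : ∀ x ∈ cell N k, ‖v x‖ₑ ≤ S k := fun x hx => enorm_le_on_cell hN v hx
    have h2 : ∀ x ∈ cell N k, ‖G x * v x‖ₑ ≤ Θ ^ n * S k := fun x hx => by
      rw [enorm_mul]
      exact mul_le_mul' (hbd x) (h1 x hx)
    refine (eVariationOn_indicator_le ordConnected_Ico h2).trans ?_
    calc _ ≤ (eVariationOn G (cell N k) * S k + Θ ^ n * eVariationOn v (cell N k))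
          + 2 * (Θ ^ n * S k) := by
          gcongr
          exact eVariationOn_mul_le (fun x _ => hbd x) h1
      _ ≤ ((6 * n + 6) * Θ ^ n * S k + Θ ^ n * S k) + 2 * (Θ ^ n * S k) := by
          gcongr
          · exact hcell k hk' H hH
          · exact le_self_add
      _ = _ := by ring
  rw [e]
  refine (eVariationOn_sum_le _ _ univ).trans ((Finset.sum_le_sum hterm).trans ?_)
  rw [← Finset.mul_sum]
  gcongr
  rw [hS, Finset.sum_add_distrib, ← Finset.mul_sum]
  gcongr
  · exact sum_eVariationOn_cell_le hN _ v
  · rw [← lintegral_biUnion_finset (fun i _ j _ hij => cell_disjoint hN hij)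
      fun k _ => measurableSet_cell N k]
    exact setLIntegral_le_lintegral _ _

theorem eVariationOn_weight_mul_le {H : Set ℝ} (hH : H.OrdConnected) {v : ℝ → ℝ}
    (hv : ∀ x, x ∉ Icc (0 : ℝ) 1 → v x = 0) :
    eVariationOn (fun x => weight T c d x * Hᶜ.indicator v x) univ
      ≤ (eVariationOn (weight T c d) univ + 3) * eVariationOn v univ := by
  obtain ⟨θ, -, hθ1, hθ⟩ := hT.exists_rate
  have h1 : ∀ x, ‖weight T c d x‖ₑ ≤ 1 := fun x =>
    (hθ x).trans ((ENNReal.ofReal_le_ofReal hθ1.le).trans (by simp))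
  have h2 : ∀ x, ‖Hᶜ.indicator v x‖ₑ ≤ eVariationOn v univ := fun x => by
    by_cases hx : x ∈ Hᶜ
    · rw [indicator_of_mem hx]; exact enorm_le_eVariationOn hv x
    · rw [indicator_of_notMem hx]; simp
  refine (eVariationOn_mul_le (fun x _ => h1 x) fun x _ => h2 x).trans ?_
  calc _ ≤ eVariationOn (weight T c d) univ * eVariationOn v univ
        + 1 * (eVariationOn v univ + 2 * eVariationOn v univ) := by
        gcongr
        exact eVariationOn_indicator_compl_le hH fun x _ => enorm_le_eVariationOn hv x
    _ = _ := by ring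

theorem openTransfer_eq_zero {s : ℕ → ℝ → ℝ} (hs : IsInverseBranches T c d s) (H : Set ℝ)
    (v : ℝ → ℝ) {x : ℝ} (hx : x ∉ Icc (0 : ℝ) 1) : openTransfer T c d s H v x = 0 :=
  hT.transfer_eq_zero hs (fun x hx => by rw [weight_eq_zero hx, zero_mul]) hx

theorem eVariationOn_openTransfer_le {s : ℕ → ℝ → ℝ} (hs : IsInverseBranches T c d s) {H : Set ℝ}
    (hH : H.OrdConnected) {v : ℝ → ℝ} (hv : ∀ x, x ∉ Icc (0 : ℝ) 1 → v x = 0) :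
    eVariationOn (openTransfer T c d s H v) univ
      ≤ (eVariationOn (weight T c d) univ + 3) * eVariationOn v univ :=
  (hT.eVariationOn_transfer_le hs fun x hx => by rw [weight_eq_zero hx, zero_mul]).trans
    (hT.eVariationOn_weight_mul_le hH hv)

theorem eVariationOn_openTransfer_ne_top {s : ℕ → ℝ → ℝ} (hs : IsInverseBranches T c d s)
    {H : Set ℝ} (hH : H.OrdConnected) {v : ℝ → ℝ} (hv : ∀ x, x ∉ Icc (0 : ℝ) 1 → v x = 0)
    (hfin : eVariationOn v univ ≠ ∞) : eVariationOn (openTransfer T c d s H v) univ ≠ ∞ :=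
  ne_top_of_le_ne_top (ENNReal.mul_ne_top (ENNReal.add_ne_top.2 ⟨hT.weight_bv, by norm_num⟩) hfin)
    (hT.eVariationOn_openTransfer_le hs hH hv)

theorem setIntegral_openTransfer {s : ℕ → ℝ → ℝ} (hs : IsInverseBranches T c d s) {H : Set ℝ}
    (hH : H.OrdConnected) {v : ℝ → ℝ} (hv : ∀ x, x ∉ Icc (0 : ℝ) 1 → v x = 0)
    (hfin : eVariationOn v univ ≠ ∞) (hint : Integrable v leb) {A : Set ℝ} (hA : MeasurableSet A) :
    ∫ x in A, openTransfer T c d s H v x ∂leb = ∫ x in T ⁻¹' A \ H, v x ∂leb := by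
  have hm := hH.measurableSet.compl
  have h1 := hT.integral_transfer hs (v := Hᶜ.indicator v) (hint.indicator hm)
    (ne_top_of_le_ne_top (ENNReal.mul_ne_top (ENNReal.add_ne_top.2 ⟨hT.weight_bv, by norm_num⟩) hfin)
    (hT.eVariationOn_weight_mul_le hH hv)) hA
  rw [setIntegral_indicator hm] at h1
  exact h1

/-- Equality of all set integrals determines an integrable function. This connects the operator on
classes with the pointwise formula to which the variation estimates apply. -/
theorem fn_ae_eq_openTransfer {s : ℕ → ℝ → ℝ} (hs : IsInverseBranches T c d s) {H : Set ℝ}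
    (hH : H.OrdConnected) {f h : BV} (hh : ∀ A, MeasurableSet A →
      ∫ x in A, h.fn x ∂leb = ∫ x in T ⁻¹' A \ H, f.fn x ∂leb)
    {v : ℝ → ℝ} (hvf : v =ᵐ[leb] f.fn) (hv : ∀ x, x ∉ Icc (0 : ℝ) 1 → v x = 0)
    (hfin : eVariationOn v univ ≠ ∞) : h.fn =ᵐ[leb] openTransfer T c d s H v := by
  have hfin' := hT.eVariationOn_openTransfer_ne_top hs hH hv hfin
  refine Integrable.ae_eq_of_forall_setIntegral_eq _ _ h.integrable ?_ fun A hA _ => ?_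
  · refine (integrable_const (eVariationOn (openTransfer T c d s H v) univ).toReal).mono'
      (measurable_of_eVariationOn_ne_top hfin').aestronglyMeasurable (Eventually.of_forall fun x => ?_)
    have := ENNReal.toReal_mono hfin' (enorm_le_eVariationOn
      (fun x hx => hT.openTransfer_eq_zero hs H v hx) x)
    rwa [toReal_enorm] at this
  · rw [hT.setIntegral_openTransfer hs hH hv hfin (f.integrable.congr hvf.symm) hA, hh A hA]
    exact integral_congr_ae (ae_restrict_of_ae hvf.symm)

theorem exists_isTransferOperator {H : Set ℝ} (hH : H.OrdConnected) :
    ∃ P : BV →L[ℝ] BV, IsTransferOperator T H P := by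
  obtain ⟨s, hs⟩ := hT.exists_isInverseBranches
  have hex : ∀ f : BV, ∃ h : BV, ∀ A, MeasurableSet A →
      ∫ x in A, h.fn x ∂leb = ∫ x in T ⁻¹' A \ H, f.fn x ∂leb := by
    intro f
    obtain ⟨v, hvm, hvf, hv, hV⟩ := f.exists_version (r := ‖f‖ + 1) (by linarith)
    have hfin := ne_top_of_le_ne_top ENNReal.ofReal_ne_top hV
    have hfin' := hT.eVariationOn_openTransfer_ne_top hs hH hv hfin
    refine ⟨BV.mk (openTransfer T c d s H v)
      (measurable_of_eVariationOn_ne_top hfin').aestronglyMeasurable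
      ((essVar_le (ae_eq_refl _) fun x hx => hT.openTransfer_eq_zero hs H v hx).trans_lt
        hfin'.lt_top), fun A hA => ?_⟩
    rw [integral_congr_ae (ae_restrict_of_ae (BV.fn_mk _ _ _)),
      hT.setIntegral_openTransfer hs hH hv hfin (f.integrable.congr hvf.symm) hA]
    exact integral_congr_ae (ae_restrict_of_ae hvf)
  choose P hP using hex
  set C : ℝ := (eVariationOn (weight T c d) univ + 3).toReal with hC
  have hCt : eVariationOn (weight T c d) univ + 3 ≠ ∞ :=
    ENNReal.add_ne_top.2 ⟨hT.weight_bv, by norm_num⟩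
  have hC0 : 0 ≤ C := ENNReal.toReal_nonneg
  refine ⟨LinearMap.mkContinuous
    { toFun := P
      map_add' := fun f g => BV.ext_setIntegral fun A hA => ?_
      map_smul' := fun k f => BV.ext_setIntegral fun A hA => ?_ } C fun f => ?_, fun f A hA => hP f A hA⟩
  · have h1 := (BV.setInt A).map_add (P f) (P g)
    have h2 := (BV.setInt (T ⁻¹' A \ H)).map_add f g
    simp only [BV.setInt_apply] at h1 h2
    rw [hP _ A hA, h1, hP _ A hA, hP _ A hA, h2]
  · have h1 := (BV.setInt A).map_smul k (P f)
    have h2 := (BV.setInt (T ⁻¹' A \ H)).map_smul k f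
    simp only [BV.setInt_apply] at h1 h2
    rw [hP _ A hA, RingHom.id_apply, h1, hP _ A hA, h2]
  · change ‖P f‖ ≤ C * ‖f‖
    -- The norm is an infimum over representatives, so the estimate is made for every `r` above it.
    refine le_of_forall_gt_imp_ge_of_dense fun a ha => ?_
    obtain ⟨r, hr1, hr2⟩ : ∃ r, ‖f‖ < r ∧ C * r ≤ a := by
      refine ⟨‖f‖ + (a - C * ‖f‖) / (C + 1), by
        have : 0 < (a - C * ‖f‖) / (C + 1) := div_pos (by linarith) (by linarith)
        linarith, ?_⟩
      have h3 : C * ((a - C * ‖f‖) / (C + 1)) ≤ a - C * ‖f‖ := by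
        rw [mul_div_assoc', div_le_iff₀ (by linarith)]
        nlinarith
      linarith
    refine le_trans ?_ hr2
    obtain ⟨v, -, hvf, hv, hV⟩ := f.exists_version hr1
    have hfin := ne_top_of_le_ne_top ENNReal.ofReal_ne_top hV
    refine BV.norm_le_of_essVar_le (mul_nonneg hC0 ((norm_nonneg f).trans hr1.le)) ?_
    rw [essVar_congr (hT.fn_ae_eq_openTransfer hs hH (hP f) hvf hv hfin), ENNReal.ofReal_mul hC0, hC,
      ENNReal.ofReal_toReal hCt]
    refine (essVar_le (ae_eq_refl _) fun x hx => hT.openTransfer_eq_zero hs H v hx).trans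
      ((hT.eVariationOn_openTransfer_le hs hH hv).trans ?_)
    gcongr

/-- The Lasota-Yorke inequality, uniformly in the hole. -/
theorem exists_lasotaYorke {θ : ℝ} (hθ0 : 0 < θ)
    (hθ : ∀ x, ‖weight T c d x‖ₑ ≤ ENNReal.ofReal θ) (n : ℕ) :
    ∃ K : ℝ, 0 ≤ K ∧ ∀ H : Set ℝ, H.OrdConnected → ∀ P : BV →L[ℝ] BV, IsTransferOperator T H P →
      ∀ f : BV, ‖(P ^ n) f‖ ≤ (6 * n + 9) * θ ^ n * ‖f‖ + K * ‖BV.toL1 f‖ := by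
  obtain ⟨N, hN⟩ := hT.exists_eVariationOn_iterWeight_mul_le hθ0 hθ n
  obtain ⟨s, hs⟩ := hT.exists_isInverseBranches
  set a : ℝ := (6 * n + 9) * θ ^ n with ha
  have ha0 : 0 < a := by positivity
  refine ⟨a * N, by positivity, fun H hH P hP f => ?_⟩
  have hiter : ∀ (n : ℕ) (g : BV) (v : ℝ → ℝ), v =ᵐ[leb] g.fn →
      (∀ x, x ∉ Icc (0 : ℝ) 1 → v x = 0) → eVariationOn v univ ≠ ∞ →
      ((P ^ n) g).fn =ᵐ[leb] (openTransfer T c d s H)^[n] v ∧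
      (∀ x, x ∉ Icc (0 : ℝ) 1 → (openTransfer T c d s H)^[n] v x = 0) := by
    intro n
    induction n with
    | zero => intro g v h1 h2 _; exact ⟨h1.symm, h2⟩
    | succ n ih =>
      intro g v h1 h2 h3
      rw [pow_succ, Function.iterate_succ_apply]
      exact ih (P g) _ (hT.fn_ae_eq_openTransfer hs hH (hP g) h1 h2 h3).symm
        (fun x hx => hT.openTransfer_eq_zero hs H v hx)
        (hT.eVariationOn_openTransfer_ne_top hs hH h2 h3)
  have key : ∀ r, ‖f‖ < r → ‖(P ^ n) f‖ ≤ a * (r + N * ‖BV.toL1 f‖) := by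
    intro r hr
    obtain ⟨v, hvm, hvf, hv, hV⟩ := f.exists_version hr
    have hfin := ne_top_of_le_ne_top ENNReal.ofReal_ne_top hV
    obtain ⟨h1, h2⟩ := hiter n f v hvf hv hfin
    have hr0 : 0 ≤ r := (norm_nonneg f).trans hr.le
    have hL : ∫⁻ x, ‖v x‖ₑ = ENNReal.ofReal ‖BV.toL1 f‖ := by
      have e1 : ∫⁻ x, ‖v x‖ₑ = ∫⁻ x, ‖v x‖ₑ ∂leb := by
        rw [leb, ← lintegral_indicator measurableSet_Icc]
        congr 1
        funext x
        by_cases hx : x ∈ Icc (0 : ℝ) 1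
        · rw [indicator_of_mem hx]
        · rw [indicator_of_notMem hx, hv x hx]; simp
      have e2 : ∫⁻ x, ‖v x‖ₑ ∂leb = ∫⁻ x, ‖f.fn x‖ₑ ∂leb :=
        lintegral_congr_ae (hvf.mono fun x hx => by simp only [hx])
      rw [e1, e2, BV.norm_toL1, ← ofReal_integral_norm_eq_lintegral_enorm f.integrable]
      rfl
    refine BV.norm_le_of_essVar_le (by positivity) ?_
    rw [essVar_congr h1]
    refine (essVar_le (ae_eq_refl _) h2).trans ((hT.eVariationOn_iterate_openTransfer_le hs H n v).trans
      ((hN H hH v hv).trans ?_))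
    have hA : ENNReal.ofReal a = (6 * n + 9) * ENNReal.ofReal θ ^ n := by
      rw [ha, ENNReal.ofReal_mul (by positivity), ENNReal.ofReal_pow hθ0.le,
        ENNReal.ofReal_add (by positivity) (by norm_num), ENNReal.ofReal_mul (by norm_num),
        ENNReal.ofReal_natCast]
      simp
    have hB : ENNReal.ofReal (r + N * ‖BV.toL1 f‖)
        = ENNReal.ofReal r + N * ENNReal.ofReal ‖BV.toL1 f‖ := by
      rw [ENNReal.ofReal_add hr0 (by positivity), ENNReal.ofReal_mul (by positivity),
        ENNReal.ofReal_natCast]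
    rw [ENNReal.ofReal_mul ha0.le, hA, hB, hL]
    gcongr
  have h4 : Tendsto (fun r => a * (r + N * ‖BV.toL1 f‖)) (𝓝[>] ‖f‖)
      (𝓝 (a * (‖f‖ + N * ‖BV.toL1 f‖))) := by
    refine Tendsto.mono_left ?_ nhdsWithin_le_nhds
    exact Continuous.tendsto (by fun_prop) _
  have h5 := ge_of_tendsto h4 (eventually_nhdsWithin_of_forall fun r hr => key r hr)
  linarith

end IsPiecewiseExpanding

/-! ### Duality, contraction in `L¹`, and power bounds -/

theorem IsTransferOperator.unique {T : ℝ → ℝ} {H : Set ℝ} {P P' : BV →L[ℝ] BV}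
    (h : IsTransferOperator T H P) (h' : IsTransferOperator T H P') : P = P' :=
  ContinuousLinearMap.ext fun f => BV.ext_setIntegral fun A hA => by rw [h f A hA, h' f A hA]

/-- A function `h` whose integrals over sets `A` are those of `f` over `T⁻¹ A ∩ S` has `L¹` norm at
most `∫_S |f|`. -/
theorem norm_toL1_le_setIntegral {T : ℝ → ℝ} {S : Set ℝ} {f h : BV}
    (hTm : ∀ A, MeasurableSet A → NullMeasurableSet (T ⁻¹' A) leb)
    (hh : ∀ A, MeasurableSet A → ∫ x in A, h.fn x ∂leb = ∫ x in T ⁻¹' A ∩ S, f.fn x ∂leb) :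
    ‖BV.toL1 h‖ ≤ ∫ x in S, |f.fn x| ∂leb := by
  -- Testing on the sets where `h` is nonnegative and where it is negative recovers its L¹ norm.
  set A : Set ℝ := {x | 0 ≤ h.fn x} with hA
  have hAm : MeasurableSet A := measurableSet_le measurable_const h.measurable_fn
  have hd1 : NullMeasurableSet (T ⁻¹' A) leb := hTm A hAm
  rw [BV.norm_toL1, ← integral_add_compl hAm h.integrable.abs]
  have e1 : ∫ x in A, |h.fn x| ∂leb = ∫ x in A, h.fn x ∂leb :=
    setIntegral_congr_fun hAm fun x hx => abs_of_nonneg hx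
  have e2 : ∫ x in Aᶜ, |h.fn x| ∂leb = - ∫ x in Aᶜ, h.fn x ∂leb := by
    rw [← integral_neg]
    exact setIntegral_congr_fun hAm.compl fun x hx => abs_of_neg (not_le.1 hx)
  rw [e1, e2, hh A hAm, hh _ hAm.compl]
  have b1 : ∫ x in T ⁻¹' A ∩ S, f.fn x ∂leb ≤ ∫ x in T ⁻¹' A ∩ S, |f.fn x| ∂leb :=
    integral_mono f.integrable.integrableOn f.integrable.abs.integrableOn fun x => le_abs_self _
  have b2 : -∫ x in T ⁻¹' Aᶜ ∩ S, f.fn x ∂leb ≤ ∫ x in T ⁻¹' Aᶜ ∩ S, |f.fn x| ∂leb := by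
    rw [← integral_neg]
    exact integral_mono f.integrable.neg.integrableOn f.integrable.abs.integrableOn
      fun x => neg_le_abs _
  refine (add_le_add b1 b2).trans ?_
  have e3 : T ⁻¹' A ∩ S = S ∩ T ⁻¹' A := inter_comm _ _
  have e4 : T ⁻¹' Aᶜ ∩ S = S \ T ⁻¹' A := by rw [preimage_compl, inter_comm]; rfl
  rw [e3, e4, integral_inter_add_sdiff₀ hd1 f.integrable.abs.integrableOn]

namespace IsPiecewiseExpanding

variable {T : ℝ → ℝ} {c d : ℕ → ℝ} (hT : IsPiecewiseExpanding T c d)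
include hT

theorem nullMeasurableSet_preimage_of_measurableSet {A : Set ℝ} (hA : MeasurableSet A) :
    NullMeasurableSet (T ⁻¹' A) leb := by
  have h1 : MeasurableSet (⋃ i, Ioo (c i) (d i) ∩ T ⁻¹' A) :=
    MeasurableSet.iUnion fun i => hT.measurableSet_branch_inter_preimage i hA
  rw [← iUnion_inter] at h1
  refine h1.nullMeasurableSet.congr ?_
  have hU : (⋃ i, Ioo (c i) (d i)) =ᵐ[leb] univ := by
    rw [ae_eq_univ]; exact hT.branch_full
  have := hU.inter (ae_eq_refl (T ⁻¹' A) : T ⁻¹' A =ᵐ[leb] T ⁻¹' A)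
  rwa [univ_inter] at this

/-- The duality relation for the constant 1, on a measurable hull of the null set, has a vanishing
left side. -/
theorem leb_preimage_eq_zero {N : Set ℝ} (hN : leb N = 0) : leb (T ⁻¹' N) = 0 := by
  obtain ⟨P, hP⟩ := hT.exists_isTransferOperator (H := ∅) ordConnected_empty
  set N' := toMeasurable leb N with hN'
  have hm : MeasurableSet N' := measurableSet_toMeasurable _ _
  have h0 : leb N' = 0 := by rw [hN', measure_toMeasurable, hN]
  have h1 := hP BV.one N' hm
  rw [setIntegral_measure_zero _ h0, sdiff_empty,
    integral_congr_ae (ae_restrict_of_ae BV.fn_one)] at h1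
  simp only [integral_const, smul_eq_mul, mul_one, measureReal_restrict_apply_univ] at h1
  have h2 : leb (T ⁻¹' N') = 0 := by
    rwa [eq_comm, measureReal_eq_zero_iff] at h1
  exact measure_mono_null (preimage_mono (subset_toMeasurable _ _)) h2

theorem preimage_ae_eq {A B : Set ℝ} (h : A =ᵐ[leb] B) : T ⁻¹' A =ᵐ[leb] T ⁻¹' B := by
  rw [ae_eq_set] at *
  rw [← preimage_sdiff, ← preimage_sdiff]
  exact ⟨hT.leb_preimage_eq_zero h.1, hT.leb_preimage_eq_zero h.2⟩

theorem nullMeasurableSet_preimage {A : Set ℝ} (hA : NullMeasurableSet A leb) :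
    NullMeasurableSet (T ⁻¹' A) leb := by
  obtain ⟨B, hB, hAB⟩ := hA
  exact (hT.nullMeasurableSet_preimage_of_measurableSet hB).congr (hT.preimage_ae_eq hAB.symm)

theorem nullMeasurableSet_iterate_preimage {A : Set ℝ} (hA : NullMeasurableSet A leb) (n : ℕ) :
    NullMeasurableSet (T^[n] ⁻¹' A) leb := by
  induction n with
  | zero => exact hA
  | succ n ih =>
    rw [Function.iterate_succ, preimage_comp]
    exact hT.nullMeasurableSet_preimage ih

theorem nullMeasurableSet_survivors {H : Set ℝ} (hH : H.OrdConnected) (n : ℕ) :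
    NullMeasurableSet (survivors T H n) leb := by
  induction n with
  | zero =>
    have : survivors T H 0 = univ := by ext x; simp [survivors]
    rw [this]
    exact MeasurableSet.univ.nullMeasurableSet
  | succ n ih =>
    rw [survivors_succ]
    exact (hT.nullMeasurableSet_preimage ih).diff hH.measurableSet.nullMeasurableSet

theorem setIntegral_apply {H : Set ℝ} {P : BV →L[ℝ] BV}
    (hP : IsTransferOperator T H P) (f : BV) {A : Set ℝ} (hA : NullMeasurableSet A leb) :
    ∫ x in A, (P f).fn x ∂leb = ∫ x in T ⁻¹' A \ H, f.fn x ∂leb := by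
  obtain ⟨B, hB, hAB⟩ := hA
  rw [setIntegral_congr_set hAB, hP f B hB]
  exact setIntegral_congr_set ((hT.preimage_ae_eq hAB.symm).diff (ae_eq_refl H))

theorem setIntegral_pow_apply {H : Set ℝ} (hH : H.OrdConnected) {P : BV →L[ℝ] BV}
    (hP : IsTransferOperator T H P) (n : ℕ) (f : BV) {A : Set ℝ} (hA : NullMeasurableSet A leb) :
    ∫ x in A, ((P ^ n) f).fn x ∂leb = ∫ x in T^[n] ⁻¹' A ∩ survivors T H n, f.fn x ∂leb := by
  induction n generalizing f with
  | zero =>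
    have : survivors T H 0 = univ := by ext x; simp [survivors]
    simp [this]
  | succ n ih =>
    rw [pow_succ]
    change ∫ x in A, ((P ^ n) (P f)).fn x ∂leb = _
    rw [ih, hT.setIntegral_apply hP f
      ((hT.nullMeasurableSet_iterate_preimage hA n).inter (hT.nullMeasurableSet_survivors hH n)),
      survivors_succ, Function.iterate_succ, preimage_comp, preimage_inter, inter_sdiff_assoc]

theorem norm_toL1_apply_le {H : Set ℝ} {P : BV →L[ℝ] BV}
    (hP : IsTransferOperator T H P) (f : BV) : ‖BV.toL1 (P f)‖ ≤ ‖BV.toL1 f‖ := by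
  refine (norm_toL1_le_setIntegral (S := Hᶜ)
    (fun A hA => hT.nullMeasurableSet_preimage_of_measurableSet hA)
    fun A hA => hP f A hA).trans ?_
  rw [BV.norm_toL1]
  exact setIntegral_le_integral f.integrable.abs (Eventually.of_forall fun _ => abs_nonneg _)

theorem norm_toL1_pow_apply_le {H : Set ℝ} {P : BV →L[ℝ] BV}
    (hP : IsTransferOperator T H P) (n : ℕ) (f : BV) : ‖BV.toL1 ((P ^ n) f)‖ ≤ ‖BV.toL1 f‖ := by
  induction n with
  | zero => simp
  | succ n ih =>
    rw [pow_succ']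
    exact (hT.norm_toL1_apply_le hP _).trans ih

/-- The operators of the closed and of the open system are close in the mixed norm. -/
theorem norm_toL1_sub_apply_le {H : Set ℝ} (hH : H.OrdConnected) {P₀ P : BV →L[ℝ] BV}
    (hP₀ : IsTransferOperator T ∅ P₀) (hP : IsTransferOperator T H P) (f : BV) :
    ‖BV.toL1 (P₀ f - P f)‖ ≤ leb.real H * ‖f‖ := by
  refine (norm_toL1_le_setIntegral (S := H) (f := f)
    (fun A hA => hT.nullMeasurableSet_preimage_of_measurableSet hA)
    fun A hA => ?_).trans ?_
  · have h1 := (BV.setInt A).map_sub (P₀ f) (P f)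
    simp only [BV.setInt_apply] at h1
    rw [h1, hP₀ f A hA, hP f A hA, sdiff_empty,
      ← integral_inter_add_sdiff₀ hH.measurableSet.nullMeasurableSet f.integrable.integrableOn,
      add_sub_cancel_right]
  · calc ∫ x in H, |f.fn x| ∂leb ≤ ∫ _ in H, ‖f‖ ∂leb :=
          integral_mono_ae f.integrable.abs.integrableOn (integrable_const _)
            (ae_restrict_of_ae f.abs_fn_le)
      _ = leb.real H * ‖f‖ := by
          rw [integral_const, smul_eq_mul, measureReal_restrict_apply_univ]

omit hT in
theorem int_sub_apply {H : Set ℝ} {P : BV →L[ℝ] BV}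
    (hP : IsTransferOperator T H P) (hH : H.OrdConnected) (f : BV) :
    BV.int (P f) = BV.int f - BV.setInt H f := by
  have h1 := hP f univ MeasurableSet.univ
  rw [preimage_univ, setIntegral_univ] at h1
  rw [BV.int_apply, BV.int_apply, h1, BV.setInt_apply, ← compl_eq_univ_sdiff,
    ← integral_add_compl hH.measurableSet f.integrable]
  ring

theorem exists_norm_pow_apply_le {δ : ℝ} (hδ : 0 < δ) :
    ∃ (n₀ : ℕ), ∀ n ≥ n₀, ∃ K : ℝ, 0 ≤ K ∧ ∀ H : Set ℝ, H.OrdConnected → ∀ P : BV →L[ℝ] BV,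
      IsTransferOperator T H P → ∀ f : BV, ‖(P ^ n) f‖ ≤ δ * ‖f‖ + K * ‖BV.toL1 f‖ := by
  obtain ⟨θ, hθ0, hθ1, hθ⟩ := hT.exists_rate
  have h1 : Tendsto (fun n : ℕ => (6 * n + 9) * θ ^ n) atTop (𝓝 0) := by
    have h2 := (tendsto_self_mul_const_pow_of_lt_one hθ0.le hθ1).const_mul 6
    have h3 := (tendsto_pow_atTop_nhds_zero_of_lt_one hθ0.le hθ1).const_mul 9
    have h4 := h2.add h3
    simp only [mul_zero, add_zero] at h4
    exact h4.congr fun n => by ring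
  obtain ⟨n₀, hn₀⟩ := eventually_atTop.1 (h1.eventually (gt_mem_nhds hδ))
  refine ⟨n₀, fun n hn => ?_⟩
  obtain ⟨K, hK, hLY⟩ := hT.exists_lasotaYorke hθ0 hθ n
  refine ⟨K, hK, fun H hH P hP f => (hLY H hH P hP f).trans ?_⟩
  gcongr
  exact (hn₀ n hn).le

/-- The Lasota–Yorke inequality is iterated at a time where its leading coefficient is 1/2; L¹
contraction bounds the other term by K‖f‖ at every stage. The summand 2K in `C` is the fixed point
of x ↦ x/2 + K. -/
theorem exists_pow_bound : ∃ C : ℝ, 1 ≤ C ∧ ∀ H : Set ℝ, H.OrdConnected → ∀ P : BV →L[ℝ] BV,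
    IsTransferOperator T H P → ∀ (n : ℕ) (f : BV), ‖(P ^ n) f‖ ≤ C * ‖f‖ := by
  obtain ⟨θ, hθ0, hθ1, hθ⟩ := hT.exists_rate
  obtain ⟨K₁, hK₁, hLY₁⟩ := hT.exists_lasotaYorke hθ0 hθ 1
  obtain ⟨n₀, hn₀⟩ := hT.exists_norm_pow_apply_le (δ := 1 / 2) (by norm_num)
  obtain ⟨K, hK, hLY⟩ := hn₀ (n₀ + 1) (Nat.le_succ _)
  set C₁ : ℝ := 15 + K₁ with hC₁
  have hC₁1 : 1 ≤ C₁ := by linarith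
  set C : ℝ := C₁ ^ (n₀ + 1) + 2 * K with hC
  have hpow1 : 1 ≤ C₁ ^ (n₀ + 1) := one_le_pow₀ hC₁1
  refine ⟨C, by linarith, fun H hH P hP n => ?_⟩
  have hone : ∀ f, ‖P f‖ ≤ C₁ * ‖f‖ := fun f => by
    have h1 := hLY₁ H hH P hP f
    rw [pow_one] at h1
    have h2 := mul_le_mul_of_nonneg_left (BV.norm_toL1_le f) hK₁
    have h3 : (6 * ((1 : ℕ) : ℝ) + 9) * θ ^ 1 * ‖f‖ ≤ 15 * ‖f‖ := by
      refine mul_le_mul_of_nonneg_right ?_ (norm_nonneg f)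
      rw [pow_one]; push_cast; nlinarith
    rw [hC₁]; linarith
  have hsmall : ∀ (m : ℕ) (f : BV), ‖(P ^ m) f‖ ≤ C₁ ^ m * ‖f‖ := by
    intro m
    induction m with
    | zero => intro f; simp
    | succ m ih =>
      intro f
      rw [pow_succ]
      change ‖(P ^ m) (P f)‖ ≤ _
      refine (ih _).trans ?_
      rw [pow_succ, mul_assoc]
      exact mul_le_mul_of_nonneg_left (hone f) (by positivity)
  induction n using Nat.strong_induction_on with
  | _ n ih =>
    intro f
    rcases lt_or_ge n (n₀ + 1) with hn | hn
    · refine (hsmall n f).trans (mul_le_mul_of_nonneg_right ?_ (norm_nonneg f))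
      have := pow_le_pow_right₀ hC₁1 hn.le
      linarith
    · obtain ⟨k, rfl⟩ := Nat.exists_eq_add_of_le hn
      rw [pow_add]
      change ‖(P ^ (n₀ + 1)) ((P ^ k) f)‖ ≤ _
      have h1 := hLY H hH P hP ((P ^ k) f)
      have h2 := ih k (by lia) f
      have h3 := mul_le_mul_of_nonneg_left
        ((hT.norm_toL1_pow_apply_le hP k f).trans (BV.norm_toL1_le f)) hK
      have h4 : (2 * K) * ‖f‖ ≤ C * ‖f‖ :=
        mul_le_mul_of_nonneg_right (by linarith) (norm_nonneg f)
      linarith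

end IsPiecewiseExpanding

/-! ### Exactness of the closed system -/

namespace BV

theorem tendsto_setInt {ι : Type*} {l : Filter ι} {u : ι → BV} {f : BV}
    (h : Tendsto (fun n => toL1 (u n)) l (𝓝 (toL1 f))) (A : Set ℝ) :
    Tendsto (fun n => setInt A (u n)) l (𝓝 (setInt A f)) := by
  rw [tendsto_iff_norm_sub_tendsto_zero] at h ⊢
  refine squeeze_zero (fun _ => norm_nonneg _) (fun n => ?_) h
  rw [← map_sub, ← map_sub]
  exact abs_setInt_le _ _

/-- A norm bounded sequence has a subsequence that converges in `L¹` to an element of `BV`. -/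
theorem exists_subseq_tendsto_toL1 {u : ℕ → BV} {C : ℝ} (hC : ∀ n, ‖u n‖ ≤ C) :
    ∃ (f : BV) (k : ℕ → ℕ), ‖f‖ ≤ C ∧ StrictMono k ∧
      Tendsto (fun n => toL1 (u (k n))) atTop (𝓝 (toL1 f)) := by
  have hK := isCompactOperator_toL1.isCompact_closure_image_closedBall C
  obtain ⟨g, -, k, hk, hg⟩ := hK.tendsto_subseq (x := fun n => toL1 (u n)) fun n =>
    subset_closure ⟨u n, by simpa using hC n, rfl⟩
  obtain ⟨f, hf, hfC⟩ := exists_of_tendsto_toL1 (u := fun n => u (k n)) (fun n => hC _) hg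
  exact ⟨f, k, hfC, hk, by rw [hf]; exact hg⟩

theorem ae_nonneg_of_setInt {f : BV} (h : ∀ A, MeasurableSet A → 0 ≤ setInt A f) :
    0 ≤ᵐ[leb] f.fn :=
  ae_nonneg_of_forall_setIntegral_nonneg f.integrable fun A hA _ => h A hA

theorem setInt_nonneg {f : BV} (h : 0 ≤ᵐ[leb] f.fn) (A : Set ℝ) : 0 ≤ setInt A f :=
  integral_nonneg_of_ae (ae_restrict_of_ae h)

end BV

theorem densityMeasure_congr {f g : ℝ → ℝ} (h : f =ᵐ[leb] g) :
    densityMeasure f = densityMeasure g :=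
  withDensity_congr_ae (by filter_upwards [h] with x hx; rw [hx])

theorem densityMeasure_apply {f : BV} (hf : 0 ≤ᵐ[leb] f.fn) {A : Set ℝ}
    (hA : NullMeasurableSet A leb) :
    densityMeasure f.fn A = ENNReal.ofReal (BV.setInt A f) := by
  rw [densityMeasure, withDensity_apply₀ _ hA, BV.setInt_apply,
    ofReal_integral_eq_lintegral_ofReal f.integrable.integrableOn (ae_restrict_of_ae hf)]

theorem densityMeasure_real {f : BV} (hf : 0 ≤ᵐ[leb] f.fn) {A : Set ℝ}
    (hA : NullMeasurableSet A leb) : (densityMeasure f.fn).real A = BV.setInt A f := by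
  rw [measureReal_def, densityMeasure_apply hf hA, ENNReal.toReal_ofReal (BV.setInt_nonneg hf A)]

theorem densityMeasure_absolutelyContinuous (f : ℝ → ℝ) : densityMeasure f ≪ leb :=
  withDensity_absolutelyContinuous _ _

theorem survivors_empty (T : ℝ → ℝ) (n : ℕ) : survivors T ∅ n = univ := by
  ext x; simp [survivors]

namespace IsPiecewiseExpanding

variable {T : ℝ → ℝ} {c d : ℕ → ℝ} (hT : IsPiecewiseExpanding T c d)
include hT

section closed

variable {P : BV →L[ℝ] BV} (hP : IsTransferOperator T ∅ P)
include hP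

theorem setInt_pow_apply (n : ℕ) (f : BV) {A : Set ℝ} (hA : NullMeasurableSet A leb) :
    BV.setInt A ((P ^ n) f) = BV.setInt (T^[n] ⁻¹' A) f := by
  rw [BV.setInt_apply, BV.setInt_apply, hT.setIntegral_pow_apply ordConnected_empty hP n f hA,
    survivors_empty, inter_univ]

theorem int_pow_apply (n : ℕ) (f : BV) : BV.int ((P ^ n) f) = BV.int f :=
  hT.setInt_pow_apply hP n f MeasurableSet.univ.nullMeasurableSet

theorem ae_nonneg_pow_apply (n : ℕ) {f : BV} (hf : 0 ≤ᵐ[leb] f.fn) :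
    0 ≤ᵐ[leb] ((P ^ n) f).fn :=
  BV.ae_nonneg_of_setInt fun A hA => by
    rw [hT.setInt_pow_apply hP n f hA.nullMeasurableSet]
    exact BV.setInt_nonneg hf _

/-- Positivity of the iterates, applied to ‖f‖·1 ± f. It reduces control of the mass off the support
of the invariant density to the orbit of the constant 1. -/
theorem abs_pow_apply_le (n : ℕ) (f : BV) :
    ∀ᵐ x ∂leb, |((P ^ n) f).fn x| ≤ ‖f‖ * ((P ^ n) BV.one).fn x := by
  have h1 : 0 ≤ᵐ[leb] (‖f‖ • BV.one + f).fn := by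
    filter_upwards [BV.fn_add (‖f‖ • BV.one) f, BV.fn_smul ‖f‖ BV.one, BV.fn_one, f.abs_fn_le]
      with x h1 h2 h3 h4
    rw [h1, Pi.add_apply, h2, Pi.smul_apply, h3, smul_eq_mul, mul_one]
    exact neg_le_iff_add_nonneg'.1 (abs_le.1 h4).1
  have h2 : 0 ≤ᵐ[leb] (‖f‖ • BV.one - f).fn := by
    filter_upwards [BV.fn_sub (‖f‖ • BV.one) f, BV.fn_smul ‖f‖ BV.one, BV.fn_one, f.abs_fn_le]
      with x h1 h2 h3 h4
    rw [h1, Pi.sub_apply, h2, Pi.smul_apply, h3, smul_eq_mul, mul_one]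
    exact sub_nonneg.2 (abs_le.1 h4).2
  have h3 := hT.ae_nonneg_pow_apply hP n h1
  have h4 := hT.ae_nonneg_pow_apply hP n h2
  rw [map_add, map_smul] at h3
  rw [map_sub, map_smul] at h4
  filter_upwards [h3, h4, BV.fn_add (‖f‖ • (P ^ n) BV.one) ((P ^ n) f),
    BV.fn_sub (‖f‖ • (P ^ n) BV.one) ((P ^ n) f), BV.fn_smul ‖f‖ ((P ^ n) BV.one)]
    with x h3 h4 h5 h6 h7
  rw [h5, Pi.add_apply, h7, Pi.smul_apply, smul_eq_mul, Pi.zero_apply] at h3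
  rw [h6, Pi.sub_apply, h7, Pi.smul_apply, smul_eq_mul, Pi.zero_apply] at h4
  rw [abs_le]
  constructor <;> linarith

/-- Averages of the iterates of the constant density accumulate at an invariant density. -/
theorem exists_invariant : ∃ φ : BV, P φ = φ ∧ 0 ≤ᵐ[leb] φ.fn ∧ BV.int φ = 1 ∧
    ∃ k : ℕ → ℕ, StrictMono k ∧ Tendsto (fun n => BV.toL1 (((k n : ℝ) + 1)⁻¹ •
      ∑ j ∈ Finset.range (k n + 1), (P ^ j) BV.one)) atTop (𝓝 (BV.toL1 φ)) := by
  obtain ⟨C, hC1, hC⟩ := hT.exists_pow_bound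
  set u : ℕ → BV := fun n => ((n : ℝ) + 1)⁻¹ • ∑ j ∈ Finset.range (n + 1), (P ^ j) BV.one with hu
  have hpos : ∀ n : ℕ, (0 : ℝ) < (n : ℝ) + 1 := fun n => by positivity
  have huC : ∀ n, ‖u n‖ ≤ C * ‖BV.one‖ := fun n => by
    rw [hu, norm_smul, norm_inv, Real.norm_of_nonneg (hpos n).le, inv_mul_le_iff₀ (hpos n)]
    refine (norm_sum_le_of_le _ fun j _ => hC ∅ ordConnected_empty P hP j BV.one).trans ?_
    simp
  obtain ⟨φ, k, -, hk, hlim⟩ := BV.exists_subseq_tendsto_toL1 huC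
  have hone : 0 ≤ᵐ[leb] BV.one.fn := by
    filter_upwards [BV.fn_one] with x hx
    rw [hx]; exact zero_le_one
  refine ⟨φ, ?_, ?_, ?_, k, hk, hlim⟩
  · refine BV.toL1_injective ?_
    have h1 : Tendsto (fun n => BV.toL1 (P (u (k n)))) atTop (𝓝 (BV.toL1 (P φ))) := by
      rw [tendsto_iff_norm_sub_tendsto_zero] at hlim ⊢
      refine squeeze_zero (fun _ => norm_nonneg _) (fun n => ?_) hlim
      rw [← map_sub, ← map_sub, ← map_sub]
      exact hT.norm_toL1_apply_le hP _
    have h2 : Tendsto (fun n => BV.toL1 (P (u (k n))) - BV.toL1 (u (k n))) atTop (𝓝 0) := by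
      have h3 : Tendsto (fun n : ℕ => (1 / ((n : ℝ) + 1)) * (C * ‖BV.one‖ + ‖BV.one‖)) atTop
          (𝓝 0) := by
        have := tendsto_one_div_add_atTop_nhds_zero_nat (𝕜 := ℝ)
        simpa using this.mul_const (C * ‖BV.one‖ + ‖BV.one‖)
      refine squeeze_zero_norm (fun n => ?_) (h3.comp hk.tendsto_atTop)
      rw [← map_sub]
      refine (BV.norm_toL1_le _).trans ?_
      have h4 : P (u (k n)) - u (k n) =
          ((k n : ℝ) + 1)⁻¹ • ((P ^ (k n + 1)) BV.one - BV.one) := by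
        simp only [hu]
        rw [map_smul, ← smul_sub, map_sum]
        congr 1
        have h5 : ∀ j, P ((P ^ j) BV.one) = (P ^ (j + 1)) BV.one := fun j => by
          rw [pow_succ']; rfl
        simp only [h5]
        rw [← Finset.sum_sub_distrib, Finset.sum_range_sub (fun j => (P ^ j) BV.one)]
        simp
      rw [h4, norm_smul, norm_inv, Real.norm_of_nonneg (hpos _).le, Function.comp_apply, one_div]
      refine mul_le_mul_of_nonneg_left ?_ (inv_nonneg.2 (hpos _).le)
      exact (norm_sub_le _ _).trans
        (add_le_add_left (hC ∅ ordConnected_empty P hP _ BV.one) _)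
    have h3 := h1.sub hlim
    exact sub_eq_zero.1 (tendsto_nhds_unique h3 h2)
  · refine BV.ae_nonneg_of_setInt fun A hA => ?_
    refine ge_of_tendsto' (BV.tendsto_setInt hlim A) fun n => ?_
    simp only [hu, map_smul, map_sum, smul_eq_mul]
    exact mul_nonneg (inv_nonneg.2 (hpos _).le) (Finset.sum_nonneg fun j _ =>
      BV.setInt_nonneg (hT.ae_nonneg_pow_apply hP j hone) A)
  · refine tendsto_nhds_unique (BV.tendsto_setInt hlim univ) ?_
    refine tendsto_const_nhds.congr fun n => ?_
    simp only [hu, map_smul, map_sum, smul_eq_mul]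
    have h1 : ∀ j, BV.setInt univ ((P ^ j) BV.one) = 1 := fun j => by
      have := hT.int_pow_apply hP j BV.one
      rw [BV.int] at this
      rw [this]
      rw [BV.setInt_apply, Measure.restrict_univ, integral_congr_ae BV.fn_one]
      simp
    simp only [h1]
    simp only [Finset.sum_const, Finset.card_range, nsmul_eq_mul, mul_one]
    push_cast
    rw [inv_mul_cancel₀ (hpos _).ne']

theorem isAcip_densityMeasure {φ : BV} (hφ : P φ = φ) (h0 : 0 ≤ᵐ[leb] φ.fn)
    (h1 : BV.int φ = 1) : IsAcip T (densityMeasure φ.fn) where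
  prob := by
    rw [densityMeasure_apply h0 MeasurableSet.univ.nullMeasurableSet]
    change ENNReal.ofReal (BV.int φ) = 1
    rw [h1, ENNReal.ofReal_one]
  ac := densityMeasure_absolutelyContinuous _
  invariant B hB := by
    rw [densityMeasure_apply h0 (hT.nullMeasurableSet_preimage_of_measurableSet hB),
      densityMeasure_apply h0 hB.nullMeasurableSet]
    have := hT.setInt_pow_apply hP 1 φ hB.nullMeasurableSet
    rw [pow_one, hφ, Function.iterate_one] at this
    rw [this]

end closed

end IsPiecewiseExpanding

/-- If indicators of measurable sets become independent of `E n`, so do integrable functions. -/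
theorem tendsto_setIntegral_of_mixing {μ : Measure ℝ} [IsProbabilityMeasure μ] {E : ℕ → Set ℝ}
    {m : ℝ} (hm : |m| ≤ 1)
    (hmix : ∀ A, MeasurableSet A → Tendsto (fun n => μ.real (A ∩ E n)) atTop (𝓝 (μ.real A * m)))
    {h : ℝ → ℝ} (hh : Integrable h μ) :
    Tendsto (fun n => ∫ x in E n, h x ∂μ) atTop (𝓝 ((∫ x, h x ∂μ) * m)) := by
  refine Integrable.induction
    (P := fun h => Tendsto (fun n => ∫ x in E n, h x ∂μ) atTop (𝓝 ((∫ x, h x ∂μ) * m)))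
    ?_ ?_ ?_ ?_ hh
  · intro r A hA _
    have h1 := (hmix A hA).const_mul r
    have e1 : ∀ n, ∫ x in E n, A.indicator (fun _ => r) x ∂μ = r * μ.real (A ∩ E n) := fun n => by
      rw [integral_indicator hA, integral_const, smul_eq_mul, mul_comm,
        measureReal_restrict_apply_univ, measureReal_restrict_apply hA]
    rw [integral_indicator hA, integral_const, smul_eq_mul, measureReal_restrict_apply_univ]
    simp only [e1]
    convert h1 using 2
    ring
  · intro f g _ hf hg h1 h2
    have := h1.add h2
    simp only [Pi.add_apply]
    rw [integral_add hf hg, add_mul]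
    refine this.congr fun n => ?_
    rw [integral_add hf.integrableOn hg.integrableOn]
  · rw [← isSeqClosed_iff_isClosed]
    intro u f hu huf
    rw [mem_ofPred_eq, Metric.tendsto_atTop]
    intro ε hε
    have key : ∀ (v : Lp ℝ 1 μ) (A : Set ℝ), |∫ x in A, v x ∂μ| ≤ ‖v‖ := fun v A => by
      rw [L1.norm_eq_integral_norm]
      refine (abs_integral_le_integral_abs).trans ?_
      exact setIntegral_le_integral (L1.integrable_coeFn v).abs
        (Eventually.of_forall fun _ => abs_nonneg _)
    have key2 : ∀ (v w : Lp ℝ 1 μ) (A : Set ℝ),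
        |(∫ x in A, v x ∂μ) - ∫ x in A, w x ∂μ| ≤ ‖v - w‖ := fun v w A => by
      rw [← integral_sub (L1.integrable_coeFn v).integrableOn (L1.integrable_coeFn w).integrableOn]
      rw [show ∫ x in A, (v x - w x) ∂μ = ∫ x in A, (v - w : Lp ℝ 1 μ) x ∂μ from
        integral_congr_ae (ae_restrict_of_ae (Lp.coeFn_sub v w).symm)]
      exact key _ _
    obtain ⟨i, hi⟩ := (Metric.tendsto_atTop.1 huf (ε / 3) (by positivity))
    have hi := hi i le_rfl
    rw [dist_eq_norm] at hi
    obtain ⟨N, hN⟩ := Metric.tendsto_atTop.1 (hu i) (ε / 3) (by positivity)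
    refine ⟨N, fun n hn => ?_⟩
    have h1 := hN n hn
    have h2 := key2 (u i) f (E n)
    have h3 := key2 (u i) f univ
    simp only [Measure.restrict_univ] at h3
    rw [Real.dist_eq] at h1 ⊢
    have h4 : |((∫ x, (u i) x ∂μ) - ∫ x, f x ∂μ) * m| ≤ ‖u i - f‖ := by
      rw [abs_mul]
      exact (mul_le_of_le_one_right (abs_nonneg _) hm).trans h3
    rw [abs_lt] at h1 ⊢
    rw [abs_le] at h2 h4
    constructor <;> linarith
  · intro f g hfg _ h1
    rw [← integral_congr_ae hfg]
    exact h1.congr fun n => integral_congr_ae (ae_restrict_of_ae hfg)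

/-- Integration against the measure with density `φ`, over sets carrying `φ`. -/
theorem setIntegral_densityMeasure {φ : BV} (u : BV) {B : Set ℝ}
    (hB : NullMeasurableSet B leb) :
    ∫ x in B, {x | 0 < φ.fn x}.indicator (fun x => u.fn x / φ.fn x) x ∂densityMeasure φ.fn =
      ∫ x in B ∩ {x | 0 < φ.fn x}, u.fn x ∂leb := by
  have hS : MeasurableSet {x | 0 < φ.fn x} := measurableSet_lt measurable_const φ.measurable_fn
  obtain ⟨B', hB', hBB'⟩ := hB
  rw [setIntegral_congr_set (densityMeasure_absolutelyContinuous _ hBB'),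
    setIntegral_congr_set (hBB'.inter (ae_eq_refl {x | 0 < φ.fn x})), densityMeasure,
    setIntegral_withDensity_eq_setIntegral_toReal_smul φ.measurable_fn.ennreal_ofReal
      (Eventually.of_forall fun _ => ENNReal.ofReal_lt_top) _ hB', ← setIntegral_indicator hS]
  refine integral_congr_ae (Eventually.of_forall fun x => ?_)
  by_cases hx : 0 < φ.fn x
  · simp only [indicator, mem_ofPred_eq, hx, if_true, smul_eq_mul]
    rw [ENNReal.toReal_ofReal hx.le, mul_div_cancel₀ _ hx.ne']
  · simp [indicator, hx]

theorem integrable_densityMeasure {φ : BV} (u : BV) :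
    Integrable ({x | 0 < φ.fn x}.indicator (fun x => u.fn x / φ.fn x)) (densityMeasure φ.fn) := by
  have hS : MeasurableSet {x | 0 < φ.fn x} := measurableSet_lt measurable_const φ.measurable_fn
  rw [densityMeasure, integrable_withDensity_iff_integrable_smul' φ.measurable_fn.ennreal_ofReal
    (Eventually.of_forall fun _ => ENNReal.ofReal_lt_top)]
  refine (u.integrable.indicator hS).congr (Eventually.of_forall fun x => ?_)
  by_cases hx : 0 < φ.fn x
  · simp only [indicator, mem_ofPred_eq, hx, if_true, smul_eq_mul]
    rw [ENNReal.toReal_ofReal hx.le, mul_div_cancel₀ _ hx.ne']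
  · simp [indicator, hx]

/-! ### Uniform L¹ decay from mixing and compactness -/

namespace IsPiecewiseExpanding

variable {T : ℝ → ℝ} {c d : ℕ → ℝ} (hT : IsPiecewiseExpanding T c d)
include hT

section closed

variable {P : BV →L[ℝ] BV} (hP : IsTransferOperator T ∅ P)
include hP

/-- The accumulation point of the averages is an invariant density, so uniqueness identifies it with
φ₀; in particular φ₀ agrees almost everywhere with an element of `BV`. -/
theorem exists_density {φ₀ : ℝ → ℝ} (hφ_meas : AEMeasurable φ₀ leb)
    (hφ_nonneg : ∀ x ∈ Icc (0 : ℝ) 1, 0 ≤ φ₀ x) (hmix : IsMixing T (densityMeasure φ₀)) :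
    ∃ φ : BV, φ.fn =ᵐ[leb] φ₀ ∧ P φ = φ ∧ 0 ≤ᵐ[leb] φ.fn ∧ BV.int φ = 1 ∧
    ∃ k : ℕ → ℕ, StrictMono k ∧ Tendsto (fun n => BV.toL1 (((k n : ℝ) + 1)⁻¹ •
      ∑ j ∈ Finset.range (k n + 1), (P ^ j) BV.one)) atTop (𝓝 (BV.toL1 φ)) := by
  obtain ⟨φ, h1, h2, h3, h4⟩ := hT.exists_invariant hP
  refine ⟨φ, ?_, h1, h2, h3, h4⟩
  have h5 := hmix.unique _ (hT.isAcip_densityMeasure hP h1 h2 h3)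
  rw [densityMeasure, densityMeasure, withDensity_eq_iff_of_sigmaFinite
    φ.measurable_fn.ennreal_ofReal.aemeasurable hφ_meas.ennreal_ofReal] at h5
  have h6 : ∀ᵐ x ∂leb, x ∈ Icc (0 : ℝ) 1 := ae_restrict_mem measurableSet_Icc
  filter_upwards [h5, h2, h6] with x h5 h2 h6
  exact (ENNReal.ofReal_eq_ofReal_iff h2 (hφ_nonneg x h6)).1 h5

/-- The mass that the iterates of Lebesgue measure put off the support of the invariant density
tends to zero. -/
theorem tendsto_setInt_compl_support {φ : BV} (hφ : P φ = φ) (h0 : 0 ≤ᵐ[leb] φ.fn) {k : ℕ → ℕ}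
    (hlim : Tendsto (fun n => BV.toL1 (((k n : ℝ) + 1)⁻¹ •
      ∑ j ∈ Finset.range (k n + 1), (P ^ j) BV.one)) atTop (𝓝 (BV.toL1 φ))) :
    Tendsto (fun n => BV.setInt {x | 0 < φ.fn x}ᶜ ((P ^ n) BV.one)) atTop (𝓝 0) := by
  set S : Set ℝ := {x | 0 < φ.fn x} with hS
  have hSm : MeasurableSet S := measurableSet_lt measurable_const φ.measurable_fn
  have hone : 0 ≤ᵐ[leb] BV.one.fn := by
    filter_upwards [BV.fn_one] with x hx
    rw [hx]; exact zero_le_one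
  have hSc : BV.setInt Sᶜ φ = 0 := by
    rw [BV.setInt_apply]
    refine setIntegral_eq_zero_of_ae_eq_zero ?_
    filter_upwards [h0] with x hx hxS
    exact le_antisymm (not_lt.1 hxS) hx
  -- The preimage of the complement of the support has invariant mass zero, hence lies almost
  -- everywhere in that complement. The mass there therefore decreases along the orbit and is
  -- dominated by its averages, which tend to the integral of φ over `Sᶜ`, that is, to zero.
  have hsub : T ⁻¹' Sᶜ ≤ᵐ[leb] Sᶜ := by
    have h1 := hT.setInt_pow_apply hP 1 φ hSm.compl.nullMeasurableSet
    rw [pow_one, hφ, hSc, Function.iterate_one, BV.setInt_apply, eq_comm,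
      setIntegral_eq_zero_iff_of_nonneg_ae (ae_restrict_of_ae h0) φ.integrable.integrableOn] at h1
    have h2 := (ae_restrict_iff'₀
      (hT.nullMeasurableSet_preimage_of_measurableSet hSm.compl)).1 h1
    filter_upwards [h2] with x hx hxT hxS
    have h3 := hx hxT
    have h4 : 0 < φ.fn x := hxS
    rw [h3] at h4
    exact lt_irrefl _ h4
  have hanti : Antitone fun n => BV.setInt Sᶜ ((P ^ n) BV.one) := by
    refine antitone_nat_of_succ_le fun n => ?_
    have h1 := hT.setInt_pow_apply hP 1 ((P ^ n) BV.one) hSm.compl.nullMeasurableSet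
    rw [pow_one] at h1
    rw [pow_succ']
    change BV.setInt Sᶜ (P ((P ^ n) BV.one)) ≤ _
    rw [h1, Function.iterate_one, BV.setInt_apply, BV.setInt_apply]
    exact setIntegral_mono_set (BV.integrable _).integrableOn
      (ae_restrict_of_ae (hT.ae_nonneg_pow_apply hP n hone)) hsub
  have hpos : ∀ n, 0 ≤ BV.setInt Sᶜ ((P ^ n) BV.one) := fun n =>
    BV.setInt_nonneg (hT.ae_nonneg_pow_apply hP n hone) _
  have h1 := BV.tendsto_setInt hlim Sᶜ
  rw [hSc] at h1
  rw [Metric.tendsto_atTop]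
  intro ε hε
  obtain ⟨i, hi⟩ := (h1.eventually (gt_mem_nhds hε)).exists
  refine ⟨k i, fun n hn => ?_⟩
  rw [Real.dist_eq, sub_zero, abs_of_nonneg (hpos n)]
  refine lt_of_le_of_lt ?_ hi
  rw [map_smul, map_sum, smul_eq_mul, ← div_eq_inv_mul, le_div_iff₀ (by positivity)]
  calc BV.setInt Sᶜ ((P ^ n) BV.one) * ((k i : ℝ) + 1)
      = ∑ j ∈ Finset.range (k i + 1), BV.setInt Sᶜ ((P ^ n) BV.one) := by
        rw [Finset.sum_const, Finset.card_range, nsmul_eq_mul, mul_comm]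
        push_cast
        rfl
    _ ≤ _ := Finset.sum_le_sum fun j hj => hanti (by
        have := Finset.mem_range.1 hj
        lia)

/-- Mixing concerns only densities carried by the support of φ. After `k` steps almost all of the
mass of `f` lies there; that part, divided by φ, is integrable for the invariant measure and mixing
applies to it. The remainder stays below ε / 3. -/
theorem tendsto_setInt_pow {φ : BV} (h0 : 0 ≤ᵐ[leb] φ.fn)
    (hmix : IsMixing T (densityMeasure φ.fn))
    (hsupp : Tendsto (fun n => BV.setInt {x | 0 < φ.fn x}ᶜ ((P ^ n) BV.one)) atTop (𝓝 0))
    (f : BV) {A : Set ℝ} (hA : MeasurableSet A) :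
    Tendsto (fun n => BV.setInt A ((P ^ n) f)) atTop (𝓝 (BV.int f * BV.setInt A φ)) := by
  set S : Set ℝ := {x | 0 < φ.fn x} with hS
  have hSm : MeasurableSet S := measurableSet_lt measurable_const φ.measurable_fn
  set μ := densityMeasure φ.fn with hμ
  have : IsProbabilityMeasure μ := ⟨hmix.acip.prob⟩
  have hreal : ∀ B, NullMeasurableSet B leb → μ.real B = BV.setInt B φ := fun B hB =>
    densityMeasure_real h0 hB
  have hpre : ∀ n, NullMeasurableSet (T^[n] ⁻¹' A) leb := fun n =>
    hT.nullMeasurableSet_iterate_preimage hA.nullMeasurableSet n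
  have hlim : ∀ u : BV, Tendsto (fun n => ∫ x in T^[n] ⁻¹' A ∩ S, u.fn x ∂leb) atTop
      (𝓝 ((∫ x in S, u.fn x ∂leb) * μ.real A)) := fun u => by
    have h2 := tendsto_setIntegral_of_mixing (μ := μ) (E := fun n => T^[n] ⁻¹' A)
      (m := μ.real A) (by rw [abs_of_nonneg measureReal_nonneg]; exact measureReal_le_one)
      (fun B hB => by
        have := (ENNReal.tendsto_toReal (ENNReal.mul_ne_top (measure_ne_top μ B)
          (measure_ne_top μ A))).comp (hmix.mixing B A hB hA)
        rw [ENNReal.toReal_mul] at this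
        exact this) (integrable_densityMeasure (φ := φ) u)
    have h3 := setIntegral_densityMeasure (φ := φ) u (B := univ) MeasurableSet.univ.nullMeasurableSet
    rw [Measure.restrict_univ, univ_inter] at h3
    rw [h3] at h2
    exact h2.congr fun n => setIntegral_densityMeasure u (hpre n)
  rw [← hreal A hA.nullMeasurableSet, Metric.tendsto_atTop]
  intro ε hε
  have hsupp' := (hsupp.const_mul ‖f‖).eventually
    (gt_mem_nhds (show ‖f‖ * 0 < ε / 3 by simpa using by positivity))
  obtain ⟨k, hk⟩ := hsupp'.exists
  set u := (P ^ k) f with hu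
  have hnull : ∫ x in Sᶜ, |u.fn x| ∂leb < ε / 3 := by
    refine lt_of_le_of_lt ?_ hk
    rw [BV.setInt_apply, ← integral_const_mul]
    exact integral_mono_ae u.integrable.abs.integrableOn
      ((BV.integrable _).const_mul _).integrableOn
      (ae_restrict_of_ae (hT.abs_pow_apply_le hP k f))
  have hnull' : ∀ B : Set ℝ, |∫ x in B ∩ Sᶜ, u.fn x ∂leb| < ε / 3 := fun B => by
    refine lt_of_le_of_lt ?_ hnull
    refine abs_integral_le_integral_abs.trans ?_
    exact setIntegral_mono_set u.integrable.abs.integrableOn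
      (Eventually.of_forall fun _ => abs_nonneg _) (inter_subset_right.eventuallyLE)
  obtain ⟨N, hN⟩ := Metric.tendsto_atTop.1 (hlim u) (ε / 3) (by positivity)
  refine ⟨N + k, fun n hn => ?_⟩
  obtain ⟨j, rfl⟩ : ∃ j, n = j + k := ⟨n - k, by lia⟩
  have h2 := hN j (by lia)
  have h3 : BV.setInt A ((P ^ (j + k)) f) = (∫ x in T^[j] ⁻¹' A ∩ S, u.fn x ∂leb) +
      ∫ x in T^[j] ⁻¹' A ∩ Sᶜ, u.fn x ∂leb := by
    rw [pow_add]
    change BV.setInt A ((P ^ j) u) = _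
    rw [hT.setInt_pow_apply hP j u hA.nullMeasurableSet, BV.setInt_apply,
      ← integral_inter_add_sdiff₀ hSm.nullMeasurableSet u.integrable.integrableOn]
    rfl
  have h4 : BV.int f = (∫ x in S, u.fn x ∂leb) + ∫ x in univ ∩ Sᶜ, u.fn x ∂leb := by
    rw [← hT.int_pow_apply hP k f, BV.int_apply, ← integral_add_compl hSm u.integrable, univ_inter]
  have h5 := hnull' (T^[j] ⁻¹' A)
  have h6 : |(∫ x in univ ∩ Sᶜ, u.fn x ∂leb) * μ.real A| < ε / 3 := by
    rw [abs_mul]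
    refine lt_of_le_of_lt (mul_le_of_le_one_right (abs_nonneg _) ?_) (hnull' univ)
    rw [abs_of_nonneg measureReal_nonneg]
    exact measureReal_le_one
  rw [Real.dist_eq, h3, h4]
  rw [Real.dist_eq] at h2
  rw [abs_lt] at *
  constructor <;> linarith

/-- The orbit is bounded in `BV`, hence relatively compact in L¹, and a limit point is determined by
its integrals over sets. Convergence of these integrals thus becomes L¹ convergence. -/
theorem tendsto_toL1_pow {φ : BV} (f : BV)
    (h : ∀ A, MeasurableSet A →
      Tendsto (fun n => BV.setInt A ((P ^ n) f)) atTop (𝓝 (BV.int f * BV.setInt A φ))) :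
    Tendsto (fun n => BV.toL1 ((P ^ n) f)) atTop (𝓝 (BV.int f • BV.toL1 φ)) := by
  obtain ⟨C, hC1, hC⟩ := hT.exists_pow_bound
  refine tendsto_of_subseq_tendsto fun ns hns => ?_
  obtain ⟨g, k, -, hk, hg⟩ := BV.exists_subseq_tendsto_toL1 (u := fun i => (P ^ (ns i)) f)
    (C := C * ‖f‖) fun i => hC ∅ ordConnected_empty P hP _ f
  refine ⟨k, ?_⟩
  have : g = BV.int f • φ := BV.ext_setIntegral fun A hA => by
    have h1 := BV.tendsto_setInt hg A
    have h2 := (h A hA).comp (hns.comp hk.tendsto_atTop)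
    have h3 := tendsto_nhds_unique h1 h2
    rw [← smul_eq_mul, ← map_smul] at h3
    exact h3
  rw [← map_smul, ← this]
  exact hg

/-- A normalised sequence of counterexamples would accumulate in L¹ at a function of integral zero.
The orbit of that function decays, and L¹ contraction transfers the decay to the sequence. -/
theorem exists_uniform_decay
    (h : ∀ f, BV.int f = 0 → Tendsto (fun n => BV.toL1 ((P ^ n) f)) atTop (𝓝 0))
    {δ : ℝ} (hδ : 0 < δ) :
    ∃ N, ∀ n ≥ N, ∀ f, BV.int f = 0 → ‖BV.toL1 ((P ^ n) f)‖ ≤ δ * ‖f‖ := by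
  by_contra! hcon
  choose n hn f hf0 hf using hcon
  have hfne : ∀ i, ‖f i‖ ≠ 0 := fun i h0 => by
    have h1 := hf i
    rw [norm_eq_zero] at h0
    rw [h0] at h1
    simp at h1
  set g : ℕ → BV := fun i => ‖f i‖⁻¹ • f i with hg
  have hg1 : ∀ i, ‖g i‖ ≤ 1 := fun i => by
    rw [hg, norm_smul, norm_inv, norm_norm, inv_mul_cancel₀ (hfne i)]
  have hgδ : ∀ i, δ < ‖BV.toL1 ((P ^ n i) (g i))‖ := fun i => by
    rw [hg, map_smul, map_smul, norm_smul, norm_inv, norm_norm,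
      lt_inv_mul_iff₀ (lt_of_le_of_ne (norm_nonneg _) (hfne i).symm), mul_comm]
    exact hf i
  obtain ⟨u, k, -, hk, hu⟩ := BV.exists_subseq_tendsto_toL1 hg1
  have hu0 : BV.int u = 0 := by
    refine tendsto_nhds_unique (BV.tendsto_setInt hu univ) (tendsto_const_nhds.congr fun i => ?_)
    rw [hg, map_smul]
    have : BV.setInt univ (f (k i)) = 0 := hf0 (k i)
    rw [this, smul_zero]
  have hn' : Tendsto n atTop atTop := tendsto_atTop_mono hn tendsto_id
  have h1 := ((h u hu0).comp (hn'.comp hk.tendsto_atTop)).norm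
  rw [tendsto_iff_norm_sub_tendsto_zero] at hu
  have h2 := hu.add h1
  rw [norm_zero, add_zero] at h2
  obtain ⟨i, hi⟩ := (h2.eventually (gt_mem_nhds hδ)).exists
  refine lt_irrefl _ ((hgδ (k i)).trans (lt_of_le_of_lt ?_ hi))
  calc ‖BV.toL1 ((P ^ n (k i)) (g (k i)))‖
      = ‖BV.toL1 ((P ^ n (k i)) (g (k i) - u)) + BV.toL1 ((P ^ n (k i)) u)‖ := by
        rw [← map_add, ← map_add, sub_add_cancel]
    _ ≤ _ := by
        refine (norm_add_le _ _).trans (add_le_add ?_ le_rfl)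
        rw [← map_sub]
        exact hT.norm_toL1_pow_apply_le hP _ _

end closed

/-- The transfer operator of a mixing map contracts functions of integral zero, uniformly. -/
theorem exists_exact {φ₀ : ℝ → ℝ} (hφ_meas : AEMeasurable φ₀ leb)
    (hφ_nonneg : ∀ x ∈ Icc (0 : ℝ) 1, 0 ≤ φ₀ x) (hmix : IsMixing T (densityMeasure φ₀)) :
    ∃ (P : BV →L[ℝ] BV) (φ : BV), IsTransferOperator T ∅ P ∧ φ.fn =ᵐ[leb] φ₀ ∧ P φ = φ ∧
      0 ≤ᵐ[leb] φ.fn ∧ BV.int φ = 1 ∧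
      ∀ δ > 0, ∃ N, ∀ n ≥ N, ∀ f, BV.int f = 0 → ‖BV.toL1 ((P ^ n) f)‖ ≤ δ * ‖f‖ := by
  obtain ⟨P, hP⟩ := hT.exists_isTransferOperator (H := ∅) ordConnected_empty
  obtain ⟨φ, h1, h2, h3, h4, k, -, hlim⟩ := hT.exists_density hP hφ_meas hφ_nonneg hmix
  refine ⟨P, φ, hP, h1, h2, h3, h4, fun δ hδ => hT.exists_uniform_decay hP (fun f hf => ?_) hδ⟩
  rw [← densityMeasure_congr h1] at hmix
  have := hT.tendsto_toL1_pow hP (φ := φ) f fun A hA => hT.tendsto_setInt_pow hP h3 hmix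
    (hT.tendsto_setInt_compl_support hP h2 h3 hlim) f hA
  rwa [hf, zero_smul] at this

end IsPiecewiseExpanding

/-! ### Leading eigenvalues of operators that nearly preserve a functional -/

section spectral

variable {X : Type*} [NormedAddCommGroup X] [NormedSpace ℝ X]

/-- `L` is power bounded, its `N`-th power contracts the kernel of `m`, and `m` is nearly
invariant. -/
structure IsNearlyMarkov (m : X →L[ℝ] ℝ) (L : X →L[ℝ] X) (N : ℕ) (C ε : ℝ) : Prop where
  one_le : 1 ≤ C
  pos : 0 < N
  nonneg : 0 ≤ ε
  abs_le : ∀ f, |m f| ≤ ‖f‖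
  norm_pow_le : ∀ n f, ‖(L ^ n) f‖ ≤ C * ‖f‖
  contract : ∀ f, m f = 0 → ‖(L ^ N) f‖ ≤ 1 / 8 * ‖f‖
  defect : ∀ f, |m (L f) - m f| ≤ ε * ‖f‖

namespace IsNearlyMarkov

variable {m : X →L[ℝ] ℝ} {L : X →L[ℝ] X} {N : ℕ} {C ε R : ℝ}

theorem defect_pow (h : IsNearlyMarkov m L N C ε) (n : ℕ) (f : X) :
    |m ((L ^ n) f) - m f| ≤ n * ε * C * ‖f‖ := by
  induction n with
  | zero => simp
  | succ n ih =>
    have h1 := h.defect ((L ^ n) f)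
    have h2 := mul_le_mul_of_nonneg_left (h.norm_pow_le n f) h.nonneg
    have h4 : (L ^ (n + 1)) f = L ((L ^ n) f) := by rw [pow_succ']; rfl
    rw [h4]
    have h3 := abs_sub_le (m (L ((L ^ n) f))) (m ((L ^ n) f)) (m f)
    rw [Nat.cast_succ]
    nlinarith

theorem le_of_small (h : IsNearlyMarkov m L N C ε) (hR : 0 ≤ R)
    (hsmall : N * ε * C * R ≤ 1 / 8) : ε * R ≤ 1 / 8 := by
  refine le_trans ?_ hsmall
  have h1 : (1 : ℝ) ≤ N := by exact_mod_cast h.pos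
  have h2 := h.one_le
  have h3 : 1 ≤ N * C := by nlinarith
  have h4 : 0 ≤ ε * R := mul_nonneg h.nonneg hR
  nlinarith

variable [CompleteSpace X]

/-- The map x ↦ Lᴺx / m(Lᴺx) contracts the complete set where m = 1 and ‖x‖ ≤ R. Differences lie in
the kernel of m, where Lᴺ contracts by 1/8, and near invariance of m keeps the denominator above
7/8. The size of R absorbs the image of the base point `e`. -/
theorem exists_eigenvector_pow (h : IsNearlyMarkov m L N C ε) {e : X} (he : m e = 1)
    (hR : 4 * (C + 1) * ‖e‖ ≤ R) (hsmall : N * ε * C * R ≤ 1 / 8) :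
    ∃ φ, m φ = 1 ∧ ‖φ‖ ≤ R ∧ (L ^ N) φ = m ((L ^ N) φ) • φ ∧ 7 / 8 ≤ m ((L ^ N) φ) := by
  have hC := h.one_le
  have he1 : 1 ≤ ‖e‖ := by
    have := h.abs_le e
    rwa [he, abs_one] at this
  have hR0 : 0 ≤ R := le_trans (by positivity) hR
  set B := L ^ N with hB
  set s : Set X := {x | m x = 1 ∧ ‖x‖ ≤ R} with hs
  have hsc : IsComplete s := by
    refine IsClosed.isComplete ?_
    exact (isClosed_eq m.continuous continuous_const).inter
      (isClosed_le continuous_norm continuous_const)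
  have hdef : ∀ x : X, |m (B x) - m x| * R ≤ 1 / 8 * ‖x‖ := fun x => by
    have h1 := mul_le_mul_of_nonneg_right (h.defect_pow N x) hR0
    have h2 := mul_le_mul_of_nonneg_right hsmall (norm_nonneg x)
    nlinarith
  have hmB : ∀ x ∈ s, 7 / 8 ≤ m (B x) := fun x hx => by
    have h1 := h.defect_pow N x
    have h2 : N * ε * C * ‖x‖ ≤ 1 / 8 := le_trans (mul_le_mul_of_nonneg_left hx.2 (by
      have := h.nonneg
      positivity)) hsmall
    rw [hx.1] at h1
    have h3 := (_root_.abs_le.1 h1).1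
    linarith
  set F : X → X := fun x => (m (B x))⁻¹ • B x with hF
  have hFs : MapsTo F s s := by
    intro x hx
    have h1 := hmB x hx
    refine ⟨?_, ?_⟩
    · rw [hF, map_smul, smul_eq_mul, inv_mul_cancel₀ (by linarith)]
    · rw [hF, norm_smul, norm_inv, Real.norm_of_nonneg (by linarith), inv_mul_le_iff₀ (by linarith)]
      have h2 : ‖B (x - e)‖ ≤ 1 / 8 * ‖x - e‖ := h.contract _ (by rw [map_sub, hx.1, he, sub_self])
      have h3 : ‖B e‖ ≤ C * ‖e‖ := h.norm_pow_le N e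
      have h4 : ‖B x‖ ≤ ‖B (x - e)‖ + ‖B e‖ := by
        rw [map_sub]
        exact norm_le_norm_sub_add _ _
      have h5 := norm_sub_le x e
      have h6 := hx.2
      nlinarith
  have hlip : ∀ x ∈ s, ∀ y ∈ s, ‖F x - F y‖ ≤ 1 / 2 * ‖x - y‖ := by
    intro x hx y hy
    have h1 := hmB x hx
    have h2 := hmB y hy
    have hxy : m (x - y) = 0 := by rw [map_sub, hx.1, hy.1, sub_self]
    have h3 : ‖B (x - y)‖ ≤ 1 / 8 * ‖x - y‖ := h.contract _ hxy
    have h4 := hdef (x - y)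
    rw [hxy, sub_zero] at h4
    have h5 : m (B x) • (F x - F y) = B (x - y) - m (B (x - y)) • F y := by
      rw [hF, smul_sub, smul_inv_smul₀ (by linarith), map_sub, map_sub, sub_smul,
        smul_inv_smul₀ (by linarith : m (B y) ≠ 0)]
      abel
    have h6 : m (B x) * ‖F x - F y‖ ≤ 1 / 4 * ‖x - y‖ := by
      rw [← Real.norm_of_nonneg (by linarith : 0 ≤ m (B x)), ← norm_smul, h5]
      refine (norm_sub_le _ _).trans ?_
      rw [norm_smul, Real.norm_eq_abs]
      have h7 := mul_le_mul_of_nonneg_left (hFs hy).2 (abs_nonneg (m (B (x - y))))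
      linarith
    nlinarith [norm_nonneg (F x - F y)]
  have hcon : ContractingWith (1 / 2) (hFs.restrict F s s) := by
    refine ⟨by rw [← NNReal.coe_lt_coe]; norm_num, LipschitzWith.of_dist_le_mul fun x y => ?_⟩
    have := hlip x x.2 y y.2
    rw [Subtype.dist_eq, Subtype.dist_eq, dist_eq_norm, dist_eq_norm]
    simpa using this
  have hes : e ∈ s := ⟨he, by nlinarith⟩
  obtain ⟨φ, hφs, hφ, -⟩ := ContractingWith.exists_fixedPoint' hsc hFs hcon hes (edist_ne_top _ _)
  refine ⟨φ, hφs.1, hφs.2, ?_, hmB φ hφs⟩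
  have h1 := hmB φ hφs
  have h2 : F φ = φ := hφ
  have h3 : m (B φ) • F φ = B φ := smul_inv_smul₀ (by linarith) _
  rw [h2] at h3
  exact h3.symm

/-- As L commutes with Lᴺ, the vector `L φ - m (L φ) • φ` satisfies the eigenvector equation of Lᴺ
with a factor at least 7/8. It lies in the kernel of m, and the contraction there forces it to
vanish. -/
theorem exists_eigenvector (h : IsNearlyMarkov m L N C ε) {e : X} (he : m e = 1)
    (hR : 4 * (C + 1) * ‖e‖ ≤ R) (hsmall : N * ε * C * R ≤ 1 / 8) :
    ∃ (φ : X) (l : ℝ), m φ = 1 ∧ ‖φ‖ ≤ R ∧ L φ = l • φ ∧ |l - 1| ≤ ε * R ∧ 7 / 8 ≤ l ^ N := by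
  obtain ⟨φ, h1, h2, h3, h4⟩ := h.exists_eigenvector_pow he hR hsmall
  set Λ := m ((L ^ N) φ) with hΛ
  set y := L φ - m (L φ) • φ with hy
  have hcomm : (L ^ N) (L φ) = L ((L ^ N) φ) := by
    change (L ^ N * L) φ = (L * L ^ N) φ
    rw [(Commute.pow_self L N).eq]
  have hBy : (L ^ N) y = Λ • y := by
    rw [hy, map_sub, map_smul, hcomm, h3, map_smul, smul_sub, smul_comm]
  have hmy : m y = 0 := by rw [hy, map_sub, map_smul, h1, smul_eq_mul, mul_one, sub_self]
  have hy0 : y = 0 := by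
    have h5 := h.contract y hmy
    rw [hBy, norm_smul, Real.norm_of_nonneg (by linarith)] at h5
    rw [← norm_eq_zero]
    nlinarith [norm_nonneg y]
  have hL : L φ = m (L φ) • φ := sub_eq_zero.1 hy0
  have hpow : ∀ n, (L ^ n) φ = m (L φ) ^ n • φ := by
    intro n
    induction n with
    | zero => simp
    | succ n ih =>
      rw [pow_succ]
      change (L ^ n) (L φ) = _
      rw [hL, map_smul, ih, smul_smul, pow_succ, map_smul, h1, smul_eq_mul, mul_one, mul_comm]
  refine ⟨φ, m (L φ), h1, h2, hL, ?_, ?_⟩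
  · have h5 := h.defect φ
    rw [h1] at h5
    exact h5.trans (mul_le_mul_of_nonneg_left h2 h.nonneg)
  · have h5 : Λ = m (L φ) ^ N := by
      rw [hΛ, hpow, map_smul, h1, smul_eq_mul, mul_one]
    rwa [← h5]

omit [CompleteSpace X] in
theorem seven_eighths_le_pow {l : ℝ} (h0 : 0 < l) (hl : 7 / 8 ≤ l ^ N) {r : ℕ} (hr : r ≤ N) :
    7 / 8 ≤ l ^ r := by
  rcases le_total 1 l with h1 | h1
  · have := one_le_pow₀ (n := r) h1
    linarith
  · exact hl.trans (pow_le_pow_of_le_one h0.le h1 hr)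

omit [CompleteSpace X] in
-- The witness is 2^(-1/N); the factor 2 pays for the rounding in `k / N`.
theorem exists_root_half {N : ℕ} (hN : 0 < N) :
    ∃ ρ : ℝ, 0 < ρ ∧ ρ < 1 ∧ ∀ k : ℕ, (1 / 2 : ℝ) ^ (k / N) ≤ 2 * ρ ^ k := by
  refine ⟨(1 / 2 : ℝ) ^ (1 / (N : ℝ)), by positivity,
    Real.rpow_lt_one (by norm_num) (by norm_num) (by positivity), fun k => ?_⟩
  rw [← Real.rpow_natCast ((1 / 2 : ℝ) ^ (1 / (N : ℝ))) k, ← Real.rpow_mul (by norm_num),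
    ← Real.rpow_natCast]
  have h1 : (2 : ℝ) = (1 / 2 : ℝ) ^ (-1 : ℝ) := by
    rw [Real.rpow_neg_one]; norm_num
  have hN' : (0 : ℝ) < N := by exact_mod_cast hN
  nth_rw 2 [h1]
  rw [← Real.rpow_add (by norm_num)]
  refine Real.rpow_le_rpow_of_exponent_ge (by norm_num) (by norm_num) ?_
  have h2 : (k : ℝ) ≤ N * ((k / N : ℕ) : ℝ) + N := by
    have h3 := Nat.div_add_mod k N
    have h4 := Nat.mod_lt k hN
    exact_mod_cast (by lia : k ≤ N * (k / N) + N)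
  rw [one_div_mul_eq_div, neg_add_le_iff_le_add, div_le_iff₀ hN']
  linarith

omit [CompleteSpace X] in
-- After projection along φ to the kernel of m, a block of N steps gains 1/2: contraction and defect
-- give 1/4, and l⁻ᴺ ≤ 8/7. The remaining `k % N` steps cost the factor 2C(1 + R).
theorem norm_projection_pow_le (h : IsNearlyMarkov m L N C ε) (hsmall : N * ε * C * R ≤ 1 / 8)
    {φ : X} {l : ℝ} (hφ : m φ = 1) (hφR : ‖φ‖ ≤ R) (hL : L φ = l • φ) (hl0 : 0 < l)
    (hl : 7 / 8 ≤ l ^ N) (k : ℕ) (f : X) :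
    ‖((l⁻¹ • L) ^ k) f - m (((l⁻¹ • L) ^ k) f) • φ‖ ≤
      (1 / 2) ^ (k / N) * (2 * C * (1 + R)) * ‖f‖ := by
  set A := l⁻¹ • L with hA
  have hC := h.one_le
  have hR0 : 0 ≤ R := (norm_nonneg φ).trans hφR
  have hAφ : A φ = φ := by
    rw [hA, smul_apply, hL, inv_smul_smul₀ hl0.ne']
  have hAkφ : ∀ k, (A ^ k) φ = φ := fun k => by
    induction k with
    | zero => simp
    | succ k ih =>
      rw [pow_succ]
      change (A ^ k) (A φ) = φ
      rw [hAφ, ih]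
  have hAk : ∀ (k : ℕ) (g : X), (A ^ k) g = (l ^ k)⁻¹ • (L ^ k) g := fun k g => by
    rw [hA, smul_pow, smul_apply, inv_pow]
  set p : X → X := fun g => g - m g • φ with hp
  have hmp : ∀ g, m (p g) = 0 := fun g => by
    rw [hp, map_sub, map_smul, hφ, smul_eq_mul, mul_one, sub_self]
  have hpn : ∀ g, ‖p g‖ ≤ (1 + R) * ‖g‖ := fun g => by
    refine (norm_sub_le _ _).trans ?_
    rw [norm_smul, Real.norm_eq_abs]
    have := mul_le_mul (h.abs_le g) hφR (norm_nonneg _) (norm_nonneg _)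
    linarith
  have hpA : ∀ (k : ℕ) (g : X), p ((A ^ k) g) = p ((A ^ k) (p g)) := fun k g => by
    simp only [hp, map_sub, map_smul, hAkφ, hφ, smul_eq_mul, mul_one,
      sub_smul]
    abel
  have hstep : ∀ g, m g = 0 → ‖p ((A ^ N) g)‖ ≤ 1 / 2 * ‖g‖ := fun g hg => by
    have h1 := h.contract g hg
    have h2 := h.defect_pow N g
    rw [hg, sub_zero] at h2
    have h3 : (l ^ N)⁻¹ ≤ 8 / 7 := by
      rw [inv_le_comm₀ (by linarith) (by norm_num)]
      linarith
    have h4 : ‖p ((L ^ N) g)‖ ≤ 1 / 4 * ‖g‖ := by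
      refine (norm_sub_le _ _).trans ?_
      rw [norm_smul, Real.norm_eq_abs]
      have h5 := mul_le_mul h2 hφR (norm_nonneg _) ((abs_nonneg _).trans h2)
      have h6 := mul_le_mul_of_nonneg_right hsmall (norm_nonneg g)
      nlinarith
    have h5 : p ((A ^ N) g) = (l ^ N)⁻¹ • p ((L ^ N) g) := by
      simp only [hp, hAk, map_smul, smul_sub, smul_assoc]
    rw [h5, norm_smul, Real.norm_of_nonneg (inv_nonneg.2 (by linarith))]
    have h6 := mul_le_mul h3 h4 (norm_nonneg _) (by norm_num)
    linarith [norm_nonneg g]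
  have hiter : ∀ (q : ℕ) (g : X), m g = 0 → ‖p ((A ^ (N * q)) g)‖ ≤ (1 / 2) ^ q * ‖g‖ := by
    intro q g hg
    induction q with
    | zero => simp [hp, hg]
    | succ q ih =>
      have h1 : (A ^ (N * (q + 1))) g = (A ^ N) ((A ^ (N * q)) g) := by
        rw [mul_add, mul_one, add_comm, pow_add]; rfl
      rw [h1, hpA]
      refine (hstep _ (hmp _)).trans ?_
      rw [pow_succ]
      linarith
  have hk : (A ^ k) f = (A ^ (N * (k / N))) ((A ^ (k % N)) f) := by
    conv_lhs => rw [← Nat.div_add_mod k N, pow_add]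
    rfl
  change ‖p ((A ^ k) f)‖ ≤ _
  rw [hk, hpA]
  refine (hiter _ _ (hmp _)).trans ?_
  rw [mul_assoc]
  refine mul_le_mul_of_nonneg_left ((hpn _).trans ?_) (by positivity)
  have h1 := seven_eighths_le_pow hl0 hl (Nat.mod_lt k h.pos).le
  have h2 := h.norm_pow_le (k % N) f
  have h3 : (l ^ (k % N))⁻¹ ≤ 2 := by
    rw [inv_le_comm₀ (by linarith) (by norm_num)]
    linarith
  have h4 : ‖(A ^ (k % N)) f‖ ≤ 2 * (C * ‖f‖) := by
    rw [hAk, norm_smul, Real.norm_of_nonneg (inv_nonneg.2 (by linarith))]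
    exact mul_le_mul h3 h2 (norm_nonneg _) (by norm_num)
  have h5 := mul_le_mul_of_nonneg_left h4 (by linarith : 0 ≤ 1 + R)
  linarith

omit [CompleteSpace X] in
/-- The left eigenfunctional, as the limit of `l⁻ⁿ m Lⁿ`. -/
theorem exists_eigenfunctional (h : IsNearlyMarkov m L N C ε) {K ρ : ℝ}
    {φ : X} {l : ℝ} (hφ : m φ = 1) (hL : L φ = l • φ) (hl : 7 / 8 ≤ l) (hK : 0 ≤ K) (hρ0 : 0 < ρ)
    (hρ1 : ρ < 1)
    (hdec : ∀ (k : ℕ) (f : X), ‖((l⁻¹ • L) ^ k) f - m (((l⁻¹ • L) ^ k) f) • φ‖ ≤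
      K * ρ ^ k * ‖f‖) :
    ∃ ν : X →L[ℝ] ℝ, ∀ n f, |ν f - m (((l⁻¹ • L) ^ n) f)| ≤ ε * (2 * K / (1 - ρ)) * ρ ^ n * ‖f‖ := by
  set A := l⁻¹ • L with hA
  have hε := h.nonneg
  have hAφ : A φ = φ := by
    rw [hA, smul_apply, hL, inv_smul_smul₀ (by linarith)]
  set u : ℕ → X →L[ℝ] ℝ := fun k => m.comp (A ^ (k + 1)) - m.comp (A ^ k) with hu
  have hle : ∀ k f, ‖u k f‖ ≤ 2 * ε * K * ρ ^ k * ‖f‖ := fun k f => by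
    set g := (A ^ k) f with hg
    set q := g - m g • φ with hq
    have hmq : m q = 0 := by rw [hq, map_sub, map_smul, hφ, smul_eq_mul, mul_one, sub_self]
    -- Since `A` fixes φ, the increment sees only the component `q` in the kernel of m, where m ∘ L
    -- is of size ε. This is the source of the factor ε in the error.
    have h1 : u k f = m (A q) := by
      have h2 : (A ^ (k + 1)) f = A g := by rw [pow_succ']; rfl
      change m ((A ^ (k + 1)) f) - m ((A ^ k) f) = _
      rw [h2, hq, map_sub, map_smul, hAφ, map_sub, map_smul, hφ, smul_eq_mul, mul_one]
    have h2 := h.defect q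
    rw [hmq, sub_zero] at h2
    have h3 : l⁻¹ ≤ 2 := by
      rw [inv_le_comm₀ (by linarith) (by norm_num)]
      linarith
    rw [h1, hA, smul_apply, map_smul, norm_smul, Real.norm_eq_abs,
      Real.norm_eq_abs, abs_of_pos (inv_pos.2 (by linarith))]
    have h4 := mul_le_mul h3 (h2.trans (mul_le_mul_of_nonneg_left (hdec k f) hε)) (abs_nonneg _)
      (by norm_num)
    linarith
  have hgeo := summable_geometric_of_lt_one hρ0.le hρ1
  have hnorm : ∀ k, ‖u k‖ ≤ 2 * ε * K * ρ ^ k := fun k =>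
    ContinuousLinearMap.opNorm_le_bound _ (by positivity) (hle k)
  have hsum : Summable u := (hgeo.mul_left (2 * ε * K)).of_norm_bounded hnorm
  refine ⟨m + ∑' k, u k, fun n f => ?_⟩
  have hsumf : Summable fun k => u k f := hsum.mapL (ContinuousLinearMap.apply ℝ ℝ f)
  have h1 : (∑' k, u k) f = ∑' k, u k f :=
    (ContinuousLinearMap.apply ℝ ℝ f).map_tsum hsum
  have h2 : m ((A ^ n) f) = m f + ∑ k ∈ Finset.range n, u k f := by
    have h3 := Finset.sum_range_sub (fun k => m ((A ^ k) f)) n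
    have h4 : ∀ k, u k f = m ((A ^ (k + 1)) f) - m ((A ^ k) f) := fun k => rfl
    simp only [h4]
    rw [h3]
    simp
  have h3 : (m + ∑' k, u k) f - m ((A ^ n) f) = ∑' k, u (k + n) f := by
    rw [add_apply, h1, ← hsumf.sum_add_tsum_nat_add n, h2]
    ring
  rw [h3, ← Real.norm_eq_abs]
  refine tsum_of_norm_bounded (g := fun k => 2 * ε * K * ρ ^ n * ‖f‖ * ρ ^ k) ?_ fun k => ?_
  · have h4 := (hasSum_geometric_of_lt_one hρ0.le hρ1).mul_left (2 * ε * K * ρ ^ n * ‖f‖)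
    have h5 : ε * (2 * K / (1 - ρ)) * ρ ^ n * ‖f‖ = 2 * ε * K * ρ ^ n * ‖f‖ * (1 - ρ)⁻¹ := by
      rw [div_eq_mul_inv]; ring
    rw [h5]
    exact h4
  · refine (hle _ _).trans (le_of_eq ?_)
    rw [pow_add]; ring

/-- The spectral decomposition at the leading eigenvalue. -/
theorem exists_decomposition (N : ℕ) (hN : 0 < N) (C R : ℝ) : ∃ K ρ : ℝ, 0 ≤ K ∧ 0 < ρ ∧ ρ < 1 ∧
    ∀ (m : X →L[ℝ] ℝ) (L : X →L[ℝ] X) (ε : ℝ) (e : X), IsNearlyMarkov m L N C ε → m e = 1 →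
      4 * (C + 1) * ‖e‖ ≤ R → N * ε * C * R ≤ 1 / 8 →
      ∃ (Q : X →L[ℝ] X) (φ : X) (ν : X →L[ℝ] ℝ) (l : ℝ), |l - 1| ≤ ε * R ∧ 7 / 8 ≤ l ∧
        l⁻¹ • L = ν.smulRight φ + Q ∧ L φ = l • φ ∧ ν.comp L = l • ν ∧ Q φ = 0 ∧
        ν.comp Q = 0 ∧ ν φ = 1 ∧ (Summable fun n : ℕ => ‖Q ^ n‖) ∧
        ∀ n f, |ν f - (l ^ n)⁻¹ * m ((L ^ n) f)| ≤ ε * K * ρ ^ n * ‖f‖ := by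
  obtain ⟨ρ, hρ0, hρ1, hρ⟩ := exists_root_half hN
  set K₁ : ℝ := 2 * (2 * |C| * (1 + |R|)) with hK₁
  have hK₁0 : 0 ≤ K₁ := by positivity
  refine ⟨2 * K₁ / (1 - ρ), ρ, div_nonneg (by positivity) (by linarith), hρ0, hρ1,
    fun m L ε e h he hR hsmall => ?_⟩
  obtain ⟨φ, l, h1, h2, h3, h4, h5⟩ := h.exists_eigenvector he hR hsmall
  have hR0 : 0 ≤ R := (norm_nonneg φ).trans h2
  have hl : 7 / 8 ≤ l := by
    have := (_root_.abs_le.1 (h4.trans (h.le_of_small hR0 hsmall))).1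
    linarith
  have hdec : ∀ (k : ℕ) (f : X), ‖((l⁻¹ • L) ^ k) f - m (((l⁻¹ • L) ^ k) f) • φ‖ ≤
      K₁ * ρ ^ k * ‖f‖ := fun k f => by
    refine (h.norm_projection_pow_le hsmall h1 h2 h3 (by linarith) h5 k f).trans ?_
    refine mul_le_mul_of_nonneg_right ?_ (norm_nonneg f)
    have h6 := h.one_le
    have h7 := mul_le_mul_of_nonneg_right (hρ k) (by positivity : 0 ≤ 2 * C * (1 + R))
    rw [hK₁, abs_of_nonneg hR0, abs_of_nonneg (by linarith)]
    linarith
  obtain ⟨ν, hν⟩ := h.exists_eigenfunctional h1 h3 hl hK₁0 hρ0 hρ1 hdec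
  set A := l⁻¹ • L with hA
  have hAφ : A φ = φ := by
    rw [hA, smul_apply, h3, inv_smul_smul₀ (by linarith)]
  have hAkφ : ∀ k, (A ^ k) φ = φ := fun k => by
    induction k with
    | zero => simp
    | succ k ih =>
      rw [pow_succ]
      change (A ^ k) (A φ) = φ
      rw [hAφ, ih]
  have hlim : ∀ f, Tendsto (fun n => m ((A ^ n) f)) atTop (𝓝 (ν f)) := fun f => by
    rw [tendsto_iff_norm_sub_tendsto_zero]
    have h6 : Tendsto (fun n => ε * (2 * K₁ / (1 - ρ)) * ρ ^ n * ‖f‖) atTop (𝓝 0) := by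
      have := ((tendsto_pow_atTop_nhds_zero_of_lt_one hρ0.le hρ1).const_mul
        (ε * (2 * K₁ / (1 - ρ)))).mul_const ‖f‖
      simpa using this
    refine squeeze_zero (fun _ => norm_nonneg _) (fun n => ?_) h6
    rw [norm_sub_rev]
    exact hν n f
  have hνA : ∀ f, ν (A f) = ν f := fun f =>
    tendsto_nhds_unique (hlim (A f)) (((tendsto_add_atTop_iff_nat 1).2 (hlim f)).congr fun n => by
      rw [pow_succ]; rfl)
  have hνφ : ν φ = 1 := tendsto_nhds_unique (hlim φ) (tendsto_const_nhds.congr fun n => by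
    rw [hAkφ, h1])
  have hQ : ∀ f, (A - ν.smulRight φ) f = A f - ν f • φ := fun f => rfl
  have hνQ : ∀ f, ν ((A - ν.smulRight φ) f) = 0 := fun f => by
    rw [hQ, map_sub, map_smul, hνA, hνφ, smul_eq_mul, mul_one, sub_self]
  -- Subtracting the rank one part changes every power by the same rank one term, but only from
  -- exponent 1 on.
  have hQk : ∀ (k : ℕ) (f : X), ((A - ν.smulRight φ) ^ (k + 1)) f = (A ^ (k + 1)) f - ν f • φ := by
    intro k f
    induction k with
    | zero => simp
    | succ k ih =>
      have h6 : ∀ B : X →L[ℝ] X, (B ^ (k + 1 + 1)) f = B ((B ^ (k + 1)) f) := fun B => by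
        rw [pow_succ']; rfl
      have h7 : ν ((A ^ (k + 1)) f - ν f • φ) = 0 := by
        rw [← ih, pow_succ']
        exact hνQ _
      rw [h6, h6, ih, hQ, h7, zero_smul, sub_zero, map_sub, map_smul, hAφ]
  refine ⟨A - ν.smulRight φ, φ, ν, l, h4, hl, by abel, h3, ?_, ?_, ?_, hνφ, ?_, fun n f => ?_⟩
  · ext f
    have h6 := hνA f
    rw [hA, smul_apply, map_smul, smul_eq_mul,
      inv_mul_eq_iff_eq_mul₀ (by linarith)] at h6
    exact h6
  · rw [hQ, hAφ, hνφ, one_smul, sub_self]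
  · ext f
    exact hνQ f
  · rw [← summable_nat_add_iff 1]
    have hgeo := summable_geometric_of_lt_one hρ0.le hρ1
    refine (((summable_nat_add_iff 1).2 hgeo).mul_left
      (K₁ + ε * (2 * K₁ / (1 - ρ)) * R)).of_nonneg_of_le (fun _ => norm_nonneg _) fun k => ?_
    have hεK : 0 ≤ ε * (2 * K₁ / (1 - ρ)) :=
      mul_nonneg h.nonneg (div_nonneg (by positivity) (by linarith))
    refine ContinuousLinearMap.opNorm_le_bound _ (by positivity) fun f => ?_
    have h6 : ((A - ν.smulRight φ) ^ (k + 1)) f = ((A ^ (k + 1)) f - m ((A ^ (k + 1)) f) • φ) -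
        (ν f - m ((A ^ (k + 1)) f)) • φ := by
      rw [hQk, sub_smul]; abel
    rw [h6]
    refine (norm_sub_le _ _).trans ?_
    have h7 := hdec (k + 1) f
    have h8 := mul_le_mul (hν (k + 1) f) h2 (norm_nonneg _) ((abs_nonneg _).trans (hν (k + 1) f))
    rw [norm_smul, Real.norm_eq_abs]
    linarith
  · have h6 := hν n f
    rwa [hA, smul_pow, smul_apply, map_smul, smul_eq_mul, inv_pow] at h6

end IsNearlyMarkov

/-- The leading eigenvalue is determined by the operator. -/
theorem leading_eigenvalue_unique {P Q Q' : X →L[ℝ] X} {φ φ' : X} {ν ν' : X →L[ℝ] ℝ} {l l' : ℝ}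
    (hl : l ≠ 0) (hl' : l' ≠ 0) (h : l⁻¹ • P = ν.smulRight φ + Q)
    (h' : l'⁻¹ • P = ν'.smulRight φ' + Q') (hφ : P φ = l • φ) (hφ' : P φ' = l' • φ')
    (hν : ν.comp P = l • ν) (hν' : ν'.comp P = l' • ν') (hνφ : ν φ = 1) (hνφ' : ν' φ' = 1)
    (hQ : Summable fun n : ℕ => ‖Q ^ n‖) (hQ' : Summable fun n : ℕ => ‖Q' ^ n‖) : l = l' := by
  by_contra hne
  -- If l ≠ l', the functional ν kills φ', so φ' is an eigenvector of `Q` for l'/l and summability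
  -- gives |l'/l| < 1. By symmetry |l/l'| < 1 as well.
  have key : ∀ {Q : X →L[ℝ] X} {φ φ' : X} {ν : X →L[ℝ] ℝ} {l l' : ℝ}, l ≠ 0 → l ≠ l' →
      l⁻¹ • P = ν.smulRight φ + Q → P φ' = l' • φ' → ν.comp P = l • ν → φ' ≠ 0 →
      (Summable fun n : ℕ => ‖Q ^ n‖) → |l⁻¹ * l'| < 1 := by
    intro Q φ φ' ν l l' hl hne h hφ' hν hφ0 hQ
    have h1 : ν φ' = 0 := by
      have h2 := DFunLike.congr_fun hν φ'
      rw [ContinuousLinearMap.comp_apply, hφ', map_smul, smul_apply, smul_eq_mul,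
        smul_eq_mul] at h2
      have h3 : (l - l') * ν φ' = 0 := by linarith
      exact (mul_eq_zero.1 h3).resolve_left (sub_ne_zero.2 hne)
    have h2 : Q φ' = (l⁻¹ * l') • φ' := by
      have h3 := DFunLike.congr_fun h φ'
      rw [smul_apply, hφ', add_apply, ContinuousLinearMap.smulRight_apply, h1, zero_smul,
        zero_add, smul_smul] at h3
      exact h3.symm
    have h3 : ∀ n, (Q ^ n) φ' = (l⁻¹ * l') ^ n • φ' := fun n => by
      induction n with
      | zero => simp
      | succ n ih =>
        rw [pow_succ]
        change (Q ^ n) (Q φ') = _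
        rw [h2, map_smul, ih, smul_smul, pow_succ, mul_comm]
    have h4 : Tendsto (fun n => |l⁻¹ * l'| ^ n) atTop (𝓝 0) := by
      refine squeeze_zero (fun _ => by positivity) (fun n => ?_) hQ.tendsto_atTop_zero
      have h5 := (Q ^ n).le_opNorm φ'
      rw [h3, norm_smul, norm_pow, Real.norm_eq_abs] at h5
      exact le_of_mul_le_mul_right h5 (norm_pos_iff.2 hφ0)
    by_contra! h5
    have h6 := ge_of_tendsto' h4 fun n => one_le_pow₀ (n := n) h5
    linarith
  have hφ0 : φ ≠ 0 := by rintro rfl; simp at hνφ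
  have hφ0' : φ' ≠ 0 := by rintro rfl; simp at hνφ'
  have h1 := key hl hne h hφ' hν hφ0' hQ
  have h2 := key hl' (Ne.symm hne) h' hφ hν' hφ0 hQ'
  have h3 : |l⁻¹ * l'| * |l'⁻¹ * l| = 1 := by
    rw [← abs_mul, show l⁻¹ * l' * (l'⁻¹ * l) = 1 by field_simp, abs_one]
  nlinarith [abs_nonneg (l⁻¹ * l'), abs_nonneg (l'⁻¹ * l)]

end spectral

/-! ### The leading eigenvalue of systems with a small hole -/

theorem IsLeadingEigenvalue.unique {T : ℝ → ℝ} {H : Set ℝ} {l l' : ℝ}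
    (h : IsLeadingEigenvalue T H l) (h' : IsLeadingEigenvalue T H l') : l = l' := by
  obtain ⟨P, Q, φ, ν, h1, h2, h3, h4, h5, -, -, h8, h9⟩ := h
  obtain ⟨P', Q', φ', ν', h1', h2', h3', h4', h5', -, -, h8', h9'⟩ := h'
  obtain rfl := h1.unique h1'
  exact leading_eigenvalue_unique h2 h2' h3 h3' h4 h4' h5 h5' h8 h8' h9 h9'

theorem abs_setInt_le_measure_mul {H : Set ℝ} (f : BV) : |BV.setInt H f| ≤ leb.real H * ‖f‖ := by
  rw [BV.setInt_apply]
  refine abs_integral_le_integral_abs.trans ?_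
  calc ∫ x in H, |f.fn x| ∂leb ≤ ∫ _ in H, ‖f‖ ∂leb :=
        integral_mono_ae f.integrable.abs.integrableOn (integrable_const _)
          (ae_restrict_of_ae f.abs_fn_le)
    _ = leb.real H * ‖f‖ := by
        rw [integral_const, smul_eq_mul, measureReal_restrict_apply_univ]

namespace IsPiecewiseExpanding

variable {T : ℝ → ℝ} {c d : ℕ → ℝ} (hT : IsPiecewiseExpanding T c d)
include hT

/-- Telescoping: `P` does not expand the earlier difference in L¹, and each new step costs m(H)
times the bounded norm of `(L ^ n) f`. -/
theorem norm_toL1_pow_sub_pow_le {C : ℝ} {H : Set ℝ} (hH : H.OrdConnected) {P L : BV →L[ℝ] BV}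
    (hP : IsTransferOperator T ∅ P) (hL : IsTransferOperator T H L)
    (hC : ∀ (n : ℕ) (f : BV), ‖(L ^ n) f‖ ≤ C * ‖f‖) (n : ℕ) (f : BV) :
    ‖BV.toL1 ((P ^ n) f - (L ^ n) f)‖ ≤ n * leb.real H * C * ‖f‖ := by
  induction n with
  | zero => simp
  | succ n ih =>
    have h1 : (P ^ (n + 1)) f - (L ^ (n + 1)) f =
        P ((P ^ n) f - (L ^ n) f) + (P ((L ^ n) f) - L ((L ^ n) f)) := by
      rw [pow_succ', pow_succ', map_sub]
      simp
    rw [h1, map_add]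
    refine (norm_add_le _ _).trans ?_
    have h2 := hT.norm_toL1_apply_le hP ((P ^ n) f - (L ^ n) f)
    have h3 := hT.norm_toL1_sub_apply_le hH hP hL ((L ^ n) f)
    have h4 := mul_le_mul_of_nonneg_left (hC n f) (measureReal_nonneg (μ := leb) (s := H))
    rw [Nat.cast_succ]
    linarith

/-- For integral zero, decay under `P` and closeness of the powers make the L¹ norm small after `M'`
steps; `n` further steps turn this into smallness in `BV` by Lasota–Yorke. Each of the two
Lasota–Yorke terms contributes 1/16. -/
theorem exists_isNearlyMarkov {P : BV →L[ℝ] BV} (hP : IsTransferOperator T ∅ P)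
    (hdec : ∀ δ > 0, ∃ N, ∀ n ≥ N, ∀ f, BV.int f = 0 → ‖BV.toL1 ((P ^ n) f)‖ ≤ δ * ‖f‖) :
    ∃ (N : ℕ) (C ε₀ : ℝ), 0 < N ∧ 0 < ε₀ ∧ ∀ H : Set ℝ, H.OrdConnected → leb.real H ≤ ε₀ →
      ∀ L, IsTransferOperator T H L → IsNearlyMarkov BV.int L N C (leb.real H) := by
  obtain ⟨C, hC1, hC⟩ := hT.exists_pow_bound
  obtain ⟨n, hn⟩ := hT.exists_norm_pow_apply_le (δ := 1 / (16 * C)) (by positivity)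
  obtain ⟨K, hK0, hK⟩ := hn n le_rfl
  obtain ⟨M, hM⟩ := hdec (1 / (32 * (K + 1))) (by positivity)
  set M' := M + 1 with hM'
  have hM'0 : (0 : ℝ) < M' := by rw [hM']; positivity
  refine ⟨n + M', C, 1 / (32 * (K + 1) * M' * C), by lia, by positivity,
    fun H hH hε L hL => ⟨hC1, by lia, measureReal_nonneg, fun f => ?_, hC H hH L hL, fun f hf => ?_,
      fun f => ?_⟩⟩
  · exact (BV.abs_setInt_le _ f).trans (BV.norm_toL1_le f)
  · rw [pow_add]
    change ‖(L ^ n) ((L ^ M') f)‖ ≤ _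
    have h1 := hK H hH L hL ((L ^ M') f)
    have h2 := mul_le_mul_of_nonneg_left (hC H hH L hL M' f)
      (by positivity : 0 ≤ 1 / (16 * C))
    have h3 : 1 / (16 * C) * (C * ‖f‖) = 1 / 16 * ‖f‖ := by field_simp
    have h4 : ‖BV.toL1 ((L ^ M') f)‖ ≤
        1 / (32 * (K + 1)) * ‖f‖ + M' * leb.real H * C * ‖f‖ := by
      refine le_trans ?_ (add_le_add (hM M' (Nat.le_succ _) f hf)
        (hT.norm_toL1_pow_sub_pow_le hH hP hL (hC H hH L hL) M' f))
      rw [map_sub]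
      exact norm_le_norm_add_norm_sub _ _
    have h5 : M' * leb.real H * C ≤ 1 / (32 * (K + 1)) := by
      rw [le_div_iff₀ (by positivity)] at hε ⊢
      linarith
    have h6 := mul_le_mul_of_nonneg_right h5 (norm_nonneg f)
    have h7 : K * ‖BV.toL1 ((L ^ M') f)‖ ≤ K * (1 / (32 * (K + 1)) * ‖f‖ * 2) :=
      mul_le_mul_of_nonneg_left (by linarith) hK0
    have h8 : K * (1 / (32 * (K + 1)) * ‖f‖ * 2) ≤ 1 / 16 * ‖f‖ := by
      have h9 : K / (K + 1) ≤ 1 := by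
        rw [div_le_one (by positivity)]
        linarith
      have h10 : K * (1 / (32 * (K + 1)) * ‖f‖ * 2) = 1 / 16 * ‖f‖ * (K / (K + 1)) := by
        field_simp
        ring
      rw [h10]
      exact mul_le_of_le_one_right (by positivity) h9
    linarith
  · rw [int_sub_apply hL hH, sub_sub_cancel_left, abs_neg]
    exact abs_setInt_le_measure_mul f

/-- Existence and uniqueness of the leading eigenvalue for small holes, and the approximation of the
eigenfunctional by `l⁻ⁿ ∫ Lⁿ`, uniformly in the hole. -/
theorem exists_leading {P : BV →L[ℝ] BV} (hP : IsTransferOperator T ∅ P)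
    (hdec : ∀ δ > 0, ∃ N, ∀ n ≥ N, ∀ f, BV.int f = 0 → ‖BV.toL1 ((P ^ n) f)‖ ≤ δ * ‖f‖)
    {φ : BV} (hφ : BV.int φ = 1) :
    ∃ K ρ R ε₀ : ℝ, 0 ≤ K ∧ 0 < ρ ∧ ρ < 1 ∧ 0 ≤ R ∧ 0 < ε₀ ∧
      ∀ H : Set ℝ, H.OrdConnected → leb.real H ≤ ε₀ →
      ∃ (L : BV →L[ℝ] BV) (ν : BV →L[ℝ] ℝ) (l : ℝ), IsTransferOperator T H L ∧
        IsLeadingEigenvalue T H l ∧ |l - 1| ≤ leb.real H * R ∧ 7 / 8 ≤ l ∧ ν.comp L = l • ν ∧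
        ∀ n f, |ν f - (l ^ n)⁻¹ * BV.int ((L ^ n) f)| ≤ leb.real H * K * ρ ^ n * ‖f‖ := by
  obtain ⟨N, C, ε₀, hN, hε₀, h⟩ := hT.exists_isNearlyMarkov hP hdec
  set R : ℝ := 4 * (|C| + 1) * ‖φ‖ with hR
  obtain ⟨K, ρ, hK, hρ0, hρ1, hdecomp⟩ := IsNearlyMarkov.exists_decomposition (X := BV) N hN C R
  have hR0 : 0 ≤ R := by positivity
  refine ⟨K, ρ, R, min ε₀ (1 / (8 * N * (|C| + 1) * (R + 1))), hK, hρ0, hρ1, hR0,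
    lt_min hε₀ (by positivity), fun H hH hHε => ?_⟩
  obtain ⟨L, hL⟩ := hT.exists_isTransferOperator hH
  have hM := h H hH (hHε.trans (min_le_left _ _)) L hL
  have hC : |C| = C := abs_of_nonneg (by linarith [hM.one_le])
  have hsmall : N * leb.real H * C * R ≤ 1 / 8 := by
    have h1 := hHε.trans (min_le_right _ _)
    rw [le_div_iff₀ (by positivity), hC] at h1
    have h2 : N * leb.real H * C * R ≤ N * leb.real H * (C + 1) * (R + 1) := by
      have := hM.one_le
      gcongr <;> linarith
    linarith
  obtain ⟨Q, ψ, ν, l, h1, h2, h3, h4, h5, h6, h7, h8, h9, h10⟩ :=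
    hdecomp BV.int L (leb.real H) φ hM hφ (by rw [hR, hC]) hsmall
  exact ⟨L, ν, l, hL, ⟨L, Q, ψ, ν, hL, by linarith, h3, h4, h5, h6, h7, h8, h9⟩, h1, h2, h5, h10⟩

/-- The set of points of the hole that do not return within `n` steps carries the mass that the
open system loses at time `n`. -/
theorem int_pow_sub {P L : BV →L[ℝ] BV} (hP : IsTransferOperator T ∅ P) {H : Set ℝ}
    (hH : H.OrdConnected) (hL : IsTransferOperator T H L) {φ : BV} (hφ : P φ = φ) (n : ℕ) :
    BV.int ((L ^ n) (φ - L φ)) = BV.setInt (H ∩ T ⁻¹' survivors T H n) φ := by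
  have h1 : ∀ k, BV.int ((L ^ k) φ) = BV.setInt (survivors T H k) φ := fun k => by
    rw [BV.int, BV.setInt_apply,
      hT.setIntegral_pow_apply hH hL k φ MeasurableSet.univ.nullMeasurableSet, preimage_univ,
      univ_inter, BV.setInt_apply]
  have h2 : (L ^ n) (L φ) = (L ^ (n + 1)) φ := by rw [pow_succ]; rfl
  have hm := hT.nullMeasurableSet_survivors hH n
  -- By invariance the survivors at time n have the same mass as their preimage, and the survivors
  -- at time n + 1 are the part of that preimage outside the hole.
  have h3 : BV.setInt (survivors T H n) φ = BV.setInt (T ⁻¹' survivors T H n) φ := by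
    have := hT.setInt_pow_apply hP 1 φ hm
    rwa [pow_one, hφ, Function.iterate_one] at this
  rw [map_sub, map_sub, h2, h1, h1, h3, survivors_succ, BV.setInt_apply, BV.setInt_apply,
    BV.setInt_apply, ← integral_inter_add_sdiff₀ hH.measurableSet.nullMeasurableSet
      (φ.integrable.integrableOn (s := T ⁻¹' survivors T H n)), add_sub_cancel_right, inter_comm]

omit hT in
-- Only what sits in the hole is lost: Pφ − Lφ = P(φ 1_H). The norm of φ 1_H enters, rather than
-- that of φ.
theorem norm_sub_apply_le {C : ℝ} {P L : BV →L[ℝ] BV} (hP : IsTransferOperator T ∅ P)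
    (hC : ∀ f, ‖P f‖ ≤ C * ‖f‖) {H : Set ℝ} (hH : H.OrdConnected)
    (hL : IsTransferOperator T H L) {φ g : BV} (hg : g.fn =ᵐ[leb] H.indicator φ.fn) :
    ‖P φ - L φ‖ ≤ C * ‖g‖ := by
  have h1 : P φ - L φ = P g := BV.ext_setIntegral fun A hA => by
    have h2 := (BV.setInt A).map_sub (P φ) (L φ)
    simp only [BV.setInt_apply] at h2
    rw [h2, hP φ A hA, hL φ A hA, hP g A hA, sdiff_empty,
      integral_congr_ae (ae_restrict_of_ae hg), integral_indicator hH.measurableSet,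
      Measure.restrict_restrict hH.measurableSet, inter_comm H,
      ← integral_inter_add_sdiff₀ hH.measurableSet.nullMeasurableSet
        (φ.integrable.integrableOn (s := T ⁻¹' A)), add_sub_cancel_right]
  rw [h1]
  exact hC g

end IsPiecewiseExpanding

/-! ### The escape rate in terms of the mass of first returns -/

theorem essVar_indicator_le {H : Set ℝ} (hH : H.OrdConnected) (f : BV) :
    essVar (H.indicator f.fn) ≤ ENNReal.ofReal (3 * (‖f‖ + 1)) := by
  obtain ⟨v, -, h1, h2, h3⟩ := f.exists_version (lt_add_one ‖f‖)
  have h4 : H.indicator v =ᵐ[leb] H.indicator f.fn := by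
    filter_upwards [h1] with x hx
    by_cases hxH : x ∈ H
    · rw [indicator_of_mem hxH, indicator_of_mem hxH, hx]
    · rw [indicator_of_notMem hxH, indicator_of_notMem hxH]
  refine (essVar_le h4 fun x hx => ?_).trans ?_
  · by_cases hxH : x ∈ H
    · rw [indicator_of_mem hxH, h2 x hx]
    · rw [indicator_of_notMem hxH]
  refine (eVariationOn_indicator_le hH (A := ENNReal.ofReal (‖f‖ + 1)) fun x _ =>
    (enorm_le_eVariationOn h2 x).trans h3).trans ?_
  have h5 : eVariationOn v H ≤ ENNReal.ofReal (‖f‖ + 1) :=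
    (eVariationOn.mono v (subset_univ _)).trans h3
  refine (add_le_add_left h5 _).trans (le_of_eq ?_)
  rw [ENNReal.ofReal_mul (by norm_num), ENNReal.ofReal_ofNat]
  ring

namespace IsPiecewiseExpanding

variable {T : ℝ → ℝ} {c d : ℕ → ℝ} (hT : IsPiecewiseExpanding T c d)
include hT

/-- This is (1 − l) ν(φ) = ν(φ − Lφ) with the eigenfunctional replaced by l⁻ⁿ∫Lⁿ. The number `ν` is
the value of that functional at φ, near 1 by the case n = 0. The bound `B` enters through ‖φ − Lφ‖;
for shrinking holes it will be of order μ₀(H)/ε. -/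
theorem exists_escape_bound {φ₀ : ℝ → ℝ} (hφ_meas : AEMeasurable φ₀ leb)
    (hφ_nonneg : ∀ x ∈ Icc (0 : ℝ) 1, 0 ≤ φ₀ x) (hmix : IsMixing T (densityMeasure φ₀)) :
    ∃ K ρ R ε₀ : ℝ, 0 ≤ K ∧ 0 < ρ ∧ ρ < 1 ∧ 0 < ε₀ ∧
      ∀ H : Set ℝ, H.OrdConnected → leb.real H ≤ ε₀ → ∃ l ν : ℝ, IsLeadingEigenvalue T H l ∧
        |l - 1| ≤ leb.real H * R ∧ |ν - 1| ≤ leb.real H * K ∧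
        ∀ (n : ℕ) (B : ℝ), 0 ≤ B → essVar (H.indicator φ₀) ≤ ENNReal.ofReal B →
          |(1 - l) * ν - (l ^ n)⁻¹ * (densityMeasure φ₀).real (H ∩ T ⁻¹' survivors T H n)| ≤
            leb.real H * K * ρ ^ n * B := by
  obtain ⟨P, φ, hP, hφ, hPφ, hpos, hint, hdec⟩ := hT.exists_exact hφ_meas hφ_nonneg hmix
  obtain ⟨K, ρ, R, ε₀, hK, hρ0, hρ1, hR, hε₀, hlead⟩ := hT.exists_leading hP hdec hint
  obtain ⟨C, hC1, hC⟩ := hT.exists_pow_bound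
  have hKC : 0 ≤ K * (C + ‖φ‖) := by positivity
  refine ⟨K * (C + ‖φ‖), ρ, R, ε₀, hKC, hρ0, hρ1, hε₀, fun H hH hHε => ?_⟩
  obtain ⟨L, ν, l, hL, h1, h2, h3, h4, h5⟩ := hlead H hH hHε
  have hε : 0 ≤ leb.real H := measureReal_nonneg
  refine ⟨l, ν φ, h1, h2, ?_, fun n B hB hvar => ?_⟩
  · have h6 := h5 0 φ
    simp only [pow_zero, inv_one, one_mul, one_apply_eq_self, mul_one] at h6
    rw [hint] at h6
    refine h6.trans ?_
    rw [mul_assoc]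
    refine mul_le_mul_of_nonneg_left (mul_le_mul_of_nonneg_left ?_ hK) hε
    linarith
  · have h6 : ν (φ - L φ) = (1 - l) * ν φ := by
      have h7 := DFunLike.congr_fun h4 φ
      rw [ContinuousLinearMap.comp_apply, smul_apply, smul_eq_mul] at h7
      rw [map_sub, h7]; ring
    have h7 := h5 n (φ - L φ)
    have h8 : NullMeasurableSet (H ∩ T ⁻¹' survivors T H n) leb :=
      hH.measurableSet.nullMeasurableSet.inter
        (hT.nullMeasurableSet_preimage (hT.nullMeasurableSet_survivors hH n))
    rw [h6, hT.int_pow_sub hP hH hL hPφ, ← densityMeasure_real hpos h8,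
      densityMeasure_congr hφ] at h7
    set g : BV := BV.mk (H.indicator φ₀)
      (hφ_meas.aestronglyMeasurable.indicator hH.measurableSet)
      (hvar.trans_lt ENNReal.ofReal_lt_top) with hg
    have h9 : g.fn =ᵐ[leb] H.indicator φ₀ := BV.fn_mk _ _ _
    have h10 : g.fn =ᵐ[leb] H.indicator φ.fn := by
      filter_upwards [h9, hφ] with x hx hx'
      rw [hx]
      by_cases hxH : x ∈ H
      · rw [indicator_of_mem hxH, indicator_of_mem hxH, hx']
      · rw [indicator_of_notMem hxH, indicator_of_notMem hxH]
    have h11 : ‖g‖ ≤ B := BV.norm_le_of_essVar_le hB (by rw [essVar_congr h9]; exact hvar)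
    have h12 := norm_sub_apply_le hP (fun f => by
      simpa using hC ∅ ordConnected_empty P hP 1 f) hH hL h10
    rw [hPφ] at h12
    have h13 : ‖φ - L φ‖ ≤ (C + ‖φ‖) * B := h12.trans
      (mul_le_mul (by linarith [norm_nonneg φ]) h11 (norm_nonneg _) (by positivity))
    refine h7.trans ?_
    calc leb.real H * K * ρ ^ n * ‖φ - L φ‖ ≤ leb.real H * K * ρ ^ n * ((C + ‖φ‖) * B) :=
          mul_le_mul_of_nonneg_left h13 (by positivity)
      _ = _ := by ring

end IsPiecewiseExpanding

/-- Sets of small diameter around a continuity point of the density. -/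
theorem abs_densityMeasure_sub_le {φ₀ : ℝ → ℝ} {φ : BV} (hφ : φ.fn =ᵐ[leb] φ₀)
    (h0 : 0 ≤ᵐ[leb] φ.fn) {E : Set ℝ} (hE : NullMeasurableSet E leb) {w δ : ℝ}
    (h : ∀ x ∈ E, x ∈ Icc (0 : ℝ) 1 → |φ₀ x - w| ≤ δ) :
    |(densityMeasure φ₀).real E - w * leb.real E| ≤ δ * leb.real E := by
  have h1 : w * leb.real E = ∫ _ in E, w ∂leb := by
    rw [integral_const, smul_eq_mul, measureReal_restrict_apply_univ, mul_comm]
  rw [← densityMeasure_congr hφ, densityMeasure_real h0 hE, BV.setInt_apply, h1,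
    ← integral_sub φ.integrable.integrableOn (integrable_const _)]
  have h2 : ∀ᵐ x ∂leb.restrict E, ‖φ.fn x - w‖ ≤ δ := by
    have h3 : ∀ᵐ x ∂leb, x ∈ Icc (0 : ℝ) 1 := ae_restrict_mem measurableSet_Icc
    filter_upwards [ae_restrict_of_ae hφ, ae_restrict_of_ae h3, ae_restrict_mem₀ hE]
      with x hx1 hx2 hx3
    rw [hx1]
    exact h x hx3 hx2
  have h3 := norm_integral_le_of_norm_le_const h2
  rwa [measureReal_restrict_apply_univ] at h3

/-! ### From error bounds to limits -/

section limits

variable {ρ K : ℝ} {lam Δ : ℝ → ℝ} {ν : ℝ → ℝ} {q : ℕ → ℝ → ℝ} {F : Filter ℝ}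

/-- The order of the limits matters: `n` is fixed so large that K ρⁿ is small, and ε tends to zero
afterwards. The error is proportional to Δ, so dividing by Δ loses nothing. -/
theorem tendsto_div_of_bound (hρ0 : 0 < ρ) (hρ1 : ρ < 1) (hlam : Tendsto lam F (𝓝 1))
    (hν : Tendsto ν F (𝓝 1)) (hΔ : ∀ᶠ ε in F, 0 < Δ ε)
    (hb : ∀ n, ∀ᶠ ε in F, |(1 - lam ε) * ν ε - (lam ε ^ n)⁻¹ * q n ε| ≤ K * ρ ^ n * Δ ε)
    {θ : ℝ} {n₁ : ℕ} (hq : ∀ n ≥ n₁, Tendsto (fun ε => q n ε / Δ ε) F (𝓝 θ)) :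
    Tendsto (fun ε => (1 - lam ε) / Δ ε) F (𝓝 θ) := by
  have h1 : Tendsto (fun ε => (1 - lam ε) * ν ε / Δ ε) F (𝓝 θ) := by
    rw [Metric.tendsto_nhds]
    intro δ hδ
    have h2 : Tendsto (fun n => K * ρ ^ n) atTop (𝓝 0) := by
      simpa using (tendsto_pow_atTop_nhds_zero_of_lt_one hρ0.le hρ1).const_mul K
    obtain ⟨n, hn, hn1⟩ := ((h2.eventually (gt_mem_nhds (half_pos hδ))).and
      (eventually_ge_atTop n₁)).exists
    have h3 : Tendsto (fun ε => (lam ε ^ n)⁻¹ * (q n ε / Δ ε)) F (𝓝 θ) := by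
      have := ((hlam.pow n).inv₀ (by simp)).mul (hq n hn1)
      simpa using this
    filter_upwards [hb n, hΔ, Metric.tendsto_nhds.1 h3 _ (half_pos hδ)] with ε h4 h5 h6
    rw [Real.dist_eq] at *
    have h7 : |(1 - lam ε) * ν ε / Δ ε - (lam ε ^ n)⁻¹ * (q n ε / Δ ε)| ≤ K * ρ ^ n := by
      rw [← mul_div_assoc, ← sub_div, abs_div, abs_of_pos h5, div_le_iff₀ h5]
      exact h4
    have h8 := abs_sub_le ((1 - lam ε) * ν ε / Δ ε) ((lam ε ^ n)⁻¹ * (q n ε / Δ ε)) θ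
    linarith
  have h2 := h1.div hν one_ne_zero
  rw [div_one] at h2
  refine h2.congr' ?_
  filter_upwards [hν.eventually_ne one_ne_zero] with ε hε
  rw [Pi.div_apply]
  field_simp

theorem eventually_abs_le_of_bound (hν : Tendsto ν F (𝓝 1))
    (hΔ : ∀ᶠ ε in F, 0 < Δ ε)
    (hb : ∀ᶠ ε in F, |(1 - lam ε) * ν ε - Δ ε| ≤ K * Δ ε) :
    ∀ᶠ ε in F, |1 - lam ε| ≤ 2 * (K + 1) * Δ ε := by
  filter_upwards [hb, hΔ, hν.eventually (lt_mem_nhds (by norm_num : (1 / 2 : ℝ) < 1))]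
    with ε h1 h2 h3
  have h4 : |(1 - lam ε) * ν ε| ≤ (K + 1) * Δ ε := by
    have h5 := abs_sub_abs_le_abs_sub ((1 - lam ε) * ν ε) (Δ ε)
    rw [abs_of_pos h2] at h5
    linarith
  rw [abs_mul, abs_of_pos (by linarith : 0 < ν ε)] at h4
  nlinarith [abs_nonneg (1 - lam ε)]

end limits

/-! ### Returns to a small hole around a fixed point -/

theorem volume_affine_preimage {D : ℝ} (hD : D ≠ 0) (z u v : ℝ) :
    volume {x | z + D * (x - z) ∈ Icc u v} = ENNReal.ofReal ((v - u) / |D|) := by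
  have h1 : {x | z + D * (x - z) ∈ Icc u v} =
      (fun x => D * x) ⁻¹' ((fun y => (z - D * z) + y) ⁻¹' Icc u v) := by
    ext x
    simp only [mem_ofPred_eq, mem_preimage]
    rw [show z + D * (x - z) = z - D * z + D * x by ring]
  rw [h1, Real.volume_preimage_mul_left hD, measure_preimage_add, Real.volume_Icc,
    ← ENNReal.ofReal_mul (abs_nonneg _), abs_inv, inv_mul_eq_div]

/-- An interval around `z` that is not too asymmetric is almost contained in its image under an
affine map that fixes `z` and does not contract. -/
theorem mem_Icc_of_affine_mem {z D a b ε η s t : ℝ} (hD : 1 ≤ |D|) (ha : a ≤ z) (hb : z ≤ b)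
    (hε : 0 ≤ ε) (hη : 0 ≤ η) (hs : 0 ≤ s + η)
    (hneg : D < 0 → z - a ≤ |D| * (b - z) + η * ε ∧ b - z ≤ |D| * (z - a) + η * ε)
    (h : z + D * t ∈ Icc (a - s * ε) (b + s * ε)) :
    z + t ∈ Icc (a - (s + η) * ε) (b + (s + η) * ε) := by
  obtain ⟨h1, h2⟩ := h
  have h3 := mul_nonneg hs hε
  have h4 := mul_nonneg hη hε
  -- A negative `D` exchanges the two sides of `z`, so each side must be compared with |D| times the
  -- other; for `D ≥ 0` each side is compared with itself.
  rcases lt_or_ge D 0 with hD0 | hD0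
  · obtain ⟨h5, h6⟩ := hneg hD0
    rw [abs_of_neg hD0] at *
    constructor
    · by_contra! h7
      have h8 : (-D) * (z - a + (s + η) * ε) ≤ (-D) * (-t) :=
        mul_le_mul_of_nonneg_left (by linarith) (by linarith)
      have h8' : (-D) * (z - a + (s + η) * ε) < (-D) * (-t) :=
        mul_lt_mul_of_pos_left (by linarith) (by linarith)
      have h9 := mul_le_mul_of_nonneg_right hD h3
      nlinarith
    · by_contra! h7
      have h8 : (-D) * (b - z + (s + η) * ε) < (-D) * t :=
        mul_lt_mul_of_pos_left (by linarith) (by linarith)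
      have h9 := mul_le_mul_of_nonneg_right hD h3
      nlinarith
  · rw [abs_of_nonneg hD0] at hD
    rcases le_total 0 t with ht | ht
    · have h5 := mul_le_mul_of_nonneg_right hD ht
      constructor <;> nlinarith
    · have h5 := mul_le_mul_of_nonneg_right hD (neg_nonneg.2 ht)
      constructor <;> nlinarith

/-- A return after several steps already forces the one-step affine image to lie near the hole: the
hole is almost contained in its own affine image, so each step can be undone at the price of (δ M +
η) ε. Later returns thus add nothing to first order. -/
theorem affine_mem_of_iterate_mem {G : ℝ → ℝ} {z D δ M η a b ε : ℝ} (hD : 1 ≤ |D|) (ha : a ≤ z)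
    (hb : z ≤ b) (hε : 0 ≤ ε) (hη : 0 ≤ η) (hδ : 0 ≤ δ) (hM : 0 ≤ M)
    (hneg : D < 0 → z - a ≤ |D| * (b - z) + η * ε ∧ b - z ≤ |D| * (z - a) + η * ε)
    (hG : ∀ y ∈ Icc (0 : ℝ) 1, |y - z| ≤ M * ε → |G y - (z + D * (y - z))| ≤ δ * |y - z|)
    (j : ℕ) (x : ℝ) (hx : ∀ i ≤ j, G^[i] x ∈ Icc (0 : ℝ) 1 ∧ |G^[i] x - z| ≤ M * ε)
    (hj : G^[j + 1] x ∈ Icc a b) :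
    z + D * (x - z) ∈ Icc (a - (j + 1) * (δ * M + η) * ε) (b + (j + 1) * (δ * M + η) * ε) := by
  have herr : ∀ x, x ∈ Icc (0 : ℝ) 1 → |x - z| ≤ M * ε →
      |G x - (z + D * (x - z))| ≤ δ * M * ε := fun x h1 h2 => by
    refine (hG x h1 h2).trans ?_
    rw [mul_assoc]
    exact mul_le_mul_of_nonneg_left h2 hδ
  have hηε := mul_nonneg hη hε
  induction j generalizing x with
  | zero =>
    have h1 := hx 0 le_rfl
    have h2 := abs_le.1 (herr x h1.1 h1.2)
    have h3 : G x ∈ Icc a b := hj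
    obtain ⟨h4, h5⟩ := h3
    constructor <;> push_cast <;> linarith
  | succ j ih =>
    have h1 := ih (G x) (fun i hi => hx (i + 1) (by lia)) hj
    have h2 := mem_Icc_of_affine_mem hD ha hb hε hη (by positivity) hneg h1
    have h0 := hx 0 (Nat.zero_le _)
    have h3 := abs_le.1 (herr x h0.1 h0.2)
    rw [add_sub_cancel] at h2
    obtain ⟨h4, h5⟩ := h2
    constructor <;> push_cast <;> linarith

/-- Near `z` one step enlarges the distance from `z` by at most |D| + 1, so the orbit stays where
the linearisation is valid. -/
theorem abs_iterate_sub_le {G : ℝ → ℝ} {z D r : ℝ} (hmaps : MapsTo G (Icc 0 1) (Icc 0 1))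
    (hG : ∀ y ∈ Icc (0 : ℝ) 1, |y - z| < r → |G y - (z + D * (y - z))| ≤ 1 * |y - z|)
    {n : ℕ} {x ε : ℝ} (hx : x ∈ Icc (0 : ℝ) 1) (hxε : |x - z| ≤ ε)
    (hr : (|D| + 1) ^ n * ε < r) (i : ℕ) (hi : i ≤ n) :
    G^[i] x ∈ Icc (0 : ℝ) 1 ∧ |G^[i] x - z| ≤ (|D| + 1) ^ n * ε := by
  have hε : 0 ≤ ε := (abs_nonneg _).trans hxε
  have h1 : 1 ≤ |D| + 1 := by linarith [abs_nonneg D]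
  have key : ∀ i ≤ n, G^[i] x ∈ Icc (0 : ℝ) 1 ∧ |G^[i] x - z| ≤ (|D| + 1) ^ i * ε := by
    intro i
    induction i with
    | zero => intro _; exact ⟨hx, by simpa using hxε⟩
    | succ i ih =>
      intro hi
      obtain ⟨h2, h3⟩ := ih (by lia)
      rw [Function.iterate_succ_apply']
      refine ⟨hmaps h2, ?_⟩
      have h4 : (|D| + 1) ^ i * ε ≤ (|D| + 1) ^ n * ε :=
        mul_le_mul_of_nonneg_right (pow_le_pow_right₀ h1 (by lia)) hε
      have h5 := hG _ h2 (lt_of_le_of_lt (h3.trans h4) hr)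
      have h6 : |G (G^[i] x) - z| ≤ (|D| + 1) * |G^[i] x - z| := by
        have h7 : G (G^[i] x) - z =
            (G (G^[i] x) - (z + D * (G^[i] x - z))) + D * (G^[i] x - z) := by ring
        rw [h7]
        refine (abs_add_le _ _).trans ?_
        rw [abs_mul]
        linarith
      rw [pow_succ]
      have h7 := mul_le_mul_of_nonneg_left h3 (by linarith : 0 ≤ |D| + 1)
      linarith
  obtain ⟨h2, h3⟩ := key i hi
  exact ⟨h2, h3.trans (mul_le_mul_of_nonneg_right (pow_le_pow_right₀ h1 hi) hε)⟩

theorem exists_radius {G : ℝ → ℝ} {z D : ℝ} (hz : G z = z)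
    (hG : HasDerivWithinAt G D (Icc 0 1) z) {δ : ℝ} (hδ : 0 < δ) :
    ∃ r > 0, ∀ y ∈ Icc (0 : ℝ) 1, |y - z| < r → |G y - (z + D * (y - z))| ≤ δ * |y - z| := by
  have h1 := (hasDerivWithinAt_iff_isLittleO.1 hG).def hδ
  obtain ⟨r, hr, h2⟩ := Metric.mem_nhdsWithin_iff.1 h1
  refine ⟨r, hr, fun y hy hyr => ?_⟩
  have h3 := h2 ⟨hyr, hy⟩
  simp only [mem_ofPred_eq, Real.norm_eq_abs, smul_eq_mul, hz] at h3
  rwa [show G y - (z + D * (y - z)) = G y - z - (y - z) * D by ring]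

/-- Data of a family of holes `[a ε, b ε]` that shrink to `z`. -/
def IsShrinking (z : ℝ) (a b : ℝ → ℝ) : Prop :=
  ∀ᶠ ε in 𝓝[>] (0 : ℝ), 0 < ε ∧ 0 ≤ a ε ∧ a ε ≤ z ∧ z ≤ b ε ∧ b ε ≤ 1 ∧ b ε - a ε = ε

/-! ### Holes shrinking to a point -/

namespace IsShrinking

variable {z : ℝ} {a b : ℝ → ℝ} (hI : IsShrinking z a b)
include hI

theorem eventually_subset {V : Set ℝ} (hV : V ∈ 𝓝[Icc 0 1] z) :
    ∀ᶠ ε in 𝓝[>] (0 : ℝ), Icc (a ε) (b ε) ⊆ V := by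
  obtain ⟨r, hr, h⟩ := Metric.mem_nhdsWithin_iff.1 hV
  filter_upwards [hI, Ioo_mem_nhdsGT hr] with ε h1 h2 x hx
  obtain ⟨h0, h3, h4, h5, h6, h7⟩ := h1
  refine h ⟨?_, h3.trans hx.1, hx.2.trans h6⟩
  rw [Metric.mem_ball, Real.dist_eq, abs_lt]
  have := h2.2
  constructor <;> linarith [hx.1, hx.2]

/-- Either hypothesis keeps the values of `T^[k]` near `z` away from some neighbourhood of `z`:
continuity places them near `T^[k] z ≠ z`, and otherwise `z` is not a cluster value. -/
theorem eventually_no_return {T : ℝ → ℝ} {k : ℕ} (hk : T^[k] z ≠ z)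
    (hreturn : ContinuousWithinAt T^[k] (Icc 0 1) z ∨ ¬ MapClusterPt z (𝓝[Icc 0 1] z) T^[k]) :
    ∀ᶠ ε in 𝓝[>] (0 : ℝ), ∀ x ∈ Icc (a ε) (b ε), T^[k] x ∉ Icc (a ε) (b ε) := by
  have h : ∃ V ∈ 𝓝 z, ∀ᶠ x in 𝓝[Icc 0 1] z, T^[k] x ∉ V := by
    rcases hreturn with h | h
    · obtain ⟨U, V, hU, hV, hzU, hzV, hUV⟩ := t2_separation hk
      refine ⟨V, hV.mem_nhds hzV, ?_⟩
      filter_upwards [h (hU.mem_nhds hzU)] with x hx hxV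
      exact disjoint_left.1 hUV hx hxV
    · rw [mapClusterPt_iff_frequently] at h
      push Not at h
      obtain ⟨V, hV, h⟩ := h
      exact ⟨V, hV, h⟩
  obtain ⟨V, hV, h⟩ := h
  filter_upwards [hI.eventually_subset (mem_nhdsWithin_of_mem_nhds hV),
    hI.eventually_subset h] with ε h1 h2 x hx hxT
  exact h2 hx (h1 hxT)

theorem eventually_leb_real : ∀ᶠ ε in 𝓝[>] (0 : ℝ), leb.real (Icc (a ε) (b ε)) = ε := by
  filter_upwards [hI] with ε ⟨h0, h1, h2, h3, h4, h5⟩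
  rw [measureReal_def, leb, Measure.restrict_apply measurableSet_Icc,
    inter_eq_left.2 (Icc_subset_Icc h1 h4), Real.volume_Icc, h5, ENNReal.toReal_ofReal h0.le]

theorem eventually_no_escape {T : ℝ → ℝ} (hper : ∀ k : ℕ, 1 ≤ k → T^[k] z ≠ z)
    (hreturn : ∀ k : ℕ, 1 ≤ k → ContinuousWithinAt T^[k] (Icc 0 1) z ∨
      ¬ MapClusterPt z (𝓝[Icc 0 1] z) T^[k]) (n : ℕ) :
    ∀ᶠ ε in 𝓝[>] (0 : ℝ),
      Icc (a ε) (b ε) ∩ T ⁻¹' survivors T (Icc (a ε) (b ε)) n = Icc (a ε) (b ε) := by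
  have h1 : ∀ᶠ ε in 𝓝[>] (0 : ℝ), ∀ j ∈ Finset.range n, ∀ x ∈ Icc (a ε) (b ε),
      T^[j + 1] x ∉ Icc (a ε) (b ε) :=
    (Finset.eventually_all _).2 fun j _ =>
      hI.eventually_no_return (hper _ (by lia)) (hreturn _ (by lia))
  filter_upwards [h1] with ε h2
  exact inter_eq_left.2 fun x hx j hj => h2 j (Finset.mem_range.2 hj) x hx

/-- Returns at times not divisible by p are excluded, returns at multiples of p come from points of
`Up`, and points of `Lo` do return at time p. Both sets are preimages of slightly altered holes
under x ↦ z + D(x − z), so their lengths are ε/|D| up to a small multiple of ε. -/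
theorem eventually_abs_leb_sub_le {T : ℝ → ℝ} (hmaps : MapsTo T (Icc 0 1) (Icc 0 1))
    (hreturn : ∀ k : ℕ, 1 ≤ k → ContinuousWithinAt T^[k] (Icc 0 1) z ∨
      ¬ MapClusterPt z (𝓝[Icc 0 1] z) T^[k])
    {p : ℕ} {D : ℝ} (hp : 0 < p) (hper : Function.minimalPeriod T z = p)
    (hder : HasDerivWithinAt T^[p] D (Icc 0 1) z) (hD : 1 ≤ |D|)
    (hneg : D < 0 → ∀ η > 0, ∀ᶠ ε in 𝓝[>] (0 : ℝ),
      z - a ε ≤ |D| * (b ε - z) + η * ε ∧ b ε - z ≤ |D| * (z - a ε) + η * ε)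
    {n : ℕ} (hn : p ≤ n) {κ : ℝ} (hκ : 0 < κ) :
    ∀ᶠ ε in 𝓝[>] (0 : ℝ),
      |leb.real (Icc (a ε) (b ε) ∩ T ⁻¹' survivors T (Icc (a ε) (b ε)) n) - (1 - 1 / |D|) * ε| ≤
        κ * ε := by
  have hz : T^[p] z = z := by
    rw [← hper]; exact Function.iterate_minimalPeriod
  set M : ℝ := (|D| + 1) ^ n with hM
  have hM0 : 0 < M := by positivity
  -- the error allowed at each step
  obtain ⟨δ, hδ0, hδ1, hδκ⟩ : ∃ δ : ℝ, 0 < δ ∧ δ ≤ 1 ∧ 2 * (n + 1) * (δ * M + δ) ≤ κ := by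
    refine ⟨min 1 (κ / (2 * (n + 1) * (M + 1))), lt_min one_pos (by positivity), min_le_left _ _, ?_⟩
    have h1 := min_le_right (1 : ℝ) (κ / (2 * (n + 1) * (M + 1)))
    rw [le_div_iff₀ (by positivity)] at h1
    linarith
  obtain ⟨r, hr, hG⟩ := exists_radius hz hder hδ0
  have hmapsp : MapsTo T^[p] (Icc 0 1) (Icc 0 1) := hmaps.iterate p
  have hno : ∀ᶠ ε in 𝓝[>] (0 : ℝ), ∀ j ∈ Finset.range n, ¬ p ∣ j + 1 → ∀ x ∈ Icc (a ε) (b ε),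
      T^[j + 1] x ∉ Icc (a ε) (b ε) := by
    refine (Finset.eventually_all _).2 fun j _ => ?_
    by_cases hdvd : p ∣ j + 1
    · exact Eventually.of_forall fun ε h => absurd hdvd h
    · filter_upwards [hI.eventually_no_return (fun h => hdvd (by
        rw [← hper]
        exact Function.IsPeriodicPt.minimalPeriod_dvd h)) (hreturn (j + 1) (by lia))] with ε h _
      exact h
  have hneg' : ∀ᶠ ε in 𝓝[>] (0 : ℝ), D < 0 →
      z - a ε ≤ |D| * (b ε - z) + δ * ε ∧ b ε - z ≤ |D| * (z - a ε) + δ * ε := by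
    by_cases h : D < 0
    · filter_upwards [hneg h δ hδ0] with ε hε _
      exact hε
    · exact Eventually.of_forall fun ε h' => absurd h' h
  have hsmall : ∀ᶠ ε in 𝓝[>] (0 : ℝ), M * ε < r := by
    filter_upwards [Ioo_mem_nhdsGT (div_pos hr hM0)] with ε hε
    have := (lt_div_iff₀ hM0).1 hε.2
    linarith
  filter_upwards [hI, hno, hneg', hsmall, hI.eventually_leb_real] with ε ⟨h0, h1, h2, h3, h4, h5⟩
    hno hneg hsmall hleb
  set H := Icc (a ε) (b ε) with hH
  have hHsub : H ⊆ Icc 0 1 := Icc_subset_Icc h1 h4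
  have hHz : ∀ x ∈ H, |x - z| ≤ ε := fun x hx => by
    rw [abs_le]
    constructor <;> linarith [hx.1, hx.2]
  have hD0 : D ≠ 0 := by
    rintro rfl
    rw [abs_zero] at hD
    linarith
  have hM1 : 1 ≤ M := one_le_pow₀ (by linarith [abs_nonneg D])
  set s : ℝ := n * (δ * M + δ) with hs
  have hs0 : 0 ≤ s := by positivity
  set Up : Set ℝ := {x | z + D * (x - z) ∈ Icc (a ε - s * ε) (b ε + s * ε)} with hUp
  -- The margin -δ absorbs the linearisation error at time p, and it cancels exactly against the
  -- asymmetry allowance δ, which places `Lo` inside `H`.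
  set Lo : Set ℝ := {x | z + D * (x - z) ∈ Icc (a ε - (-δ) * ε) (b ε + (-δ) * ε)} with hLo
  have hmeas : ∀ u v : ℝ, MeasurableSet {x | z + D * (x - z) ∈ Icc u v} := fun u v =>
    (by fun_prop : Measurable fun x : ℝ => z + D * (x - z)) measurableSet_Icc
  -- points that return lie in `Up`
  have hret : H \ Up ⊆ H ∩ T ⁻¹' survivors T H n := by
    rintro x ⟨hx, hxUp⟩
    refine ⟨hx, fun j hj hret => ?_⟩
    have hret : T^[j + 1] x ∈ H := hret
    by_cases hdvd : p ∣ j + 1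
    · obtain ⟨i, hi⟩ := hdvd
      obtain ⟨i, rfl⟩ : ∃ i', i = i' + 1 := ⟨i - 1, by
        rcases i with _ | i
        · simp at hi
        · simp⟩
      have hin : i + 1 ≤ n := by nlinarith
      have h6 : (T^[p])^[i + 1] x ∈ H := by rwa [← Function.iterate_mul, ← hi]
      have h7 := affine_mem_of_iterate_mem hD h2 h3 h0.le hδ0.le hδ0.le hM0.le hneg
        (fun y hy hyM => hG y hy (lt_of_le_of_lt hyM hsmall)) i x
        (fun i' hi' => abs_iterate_sub_le hmapsp (fun y hy hyr => (hG y hy hyr).trans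
          (mul_le_mul_of_nonneg_right hδ1 (abs_nonneg _))) (hHsub hx) (hHz x hx) hsmall i' (by lia))
        h6
      have h8 : ((i : ℝ) + 1) * (δ * M + δ) * ε ≤ s * ε := by
        have : (i : ℝ) + 1 ≤ n := by exact_mod_cast hin
        rw [hs]
        gcongr
      exact hxUp ⟨by linarith [h7.1], by linarith [h7.2]⟩
    · exact hno j (Finset.mem_range.2 hj) hdvd x hx hret
  -- points of `Lo` return
  have hLoH : Lo ⊆ H := fun x hx => by
    have h6 := mem_Icc_of_affine_mem hD h2 h3 h0.le hδ0.le (by linarith) hneg hx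
    rw [add_sub_cancel, neg_add_cancel, zero_mul, sub_zero, add_zero] at h6
    exact h6
  have hret' : H ∩ T ⁻¹' survivors T H n ⊆ H \ Lo := by
    rintro x ⟨hx, hxs⟩
    refine ⟨hx, fun hxLo => ?_⟩
    have h6 := hxs (p - 1) (by lia)
    have h7 : T^[p - 1] (T x) = T^[p] x := by
      rw [← Function.iterate_succ_apply, Nat.succ_eq_add_one, Nat.sub_add_cancel hp]
    rw [h7] at h6
    refine h6 ?_
    have h8 : |x - z| < r := lt_of_le_of_lt (hHz x hx) (by nlinarith)
    have h9 := abs_le.1 ((hG x (hHsub hx) h8).trans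
      (mul_le_mul_of_nonneg_left (hHz x hx) hδ0.le))
    obtain ⟨h10, h11⟩ := hxLo
    constructor <;> linarith
  have hvolUp : leb.real Up ≤ (1 + 2 * s) * ε / |D| := by
    have h6 : leb Up ≤ ENNReal.ofReal ((1 + 2 * s) * ε / |D|) := by
      refine (Measure.restrict_apply_le _ _).trans (le_of_eq ?_)
      rw [hUp, volume_affine_preimage hD0]
      congr 2
      linarith
    exact ENNReal.toReal_le_of_le_ofReal (by positivity) h6
  have hvolLo : (1 - 2 * δ) * ε / |D| ≤ leb.real Lo := by
    have h6 : leb Lo = ENNReal.ofReal ((1 - 2 * δ) * ε / |D|) := by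
      rw [leb, Measure.restrict_apply (hmeas _ _), inter_eq_left.2 (hLoH.trans hHsub), hLo,
        volume_affine_preimage hD0]
      congr 2
      linarith
    rw [measureReal_def, h6, ENNReal.toReal_ofReal']
    exact le_max_left _ _
  have hle1 : leb.real (H ∩ T ⁻¹' survivors T H n) ≤ leb.real H - leb.real Lo := by
    rw [← measureReal_sdiff hLoH (hmeas _ _)]
    exact measureReal_mono hret'
  have hle2 : leb.real H - leb.real Up ≤ leb.real (H ∩ T ⁻¹' survivors T H n) := by
    refine le_trans ?_ (measureReal_mono hret)
    have := measureReal_mono (μ := leb) (s₁ := H) (s₂ := H \ Up ∪ Up) (by simp)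
    linarith [measureReal_union_le (μ := leb) (H \ Up) Up]
  rw [hleb] at hle1 hle2
  have hDpos : 0 < |D| := by linarith
  have e1 : ε * (1 / |D|) ≤ ε * 1 := by
    refine mul_le_mul_of_nonneg_left ?_ h0.le
    rw [div_le_one hDpos]; exact hD
  have e2 : (1 + 2 * s) * ε / |D| ≤ ε * (1 / |D|) + 2 * s * ε := by
    have : (1 + 2 * s) * ε / |D| = ε * (1 / |D|) + 2 * s * (ε * (1 / |D|)) := by ring
    rw [this]
    nlinarith
  have e3 : ε * (1 / |D|) - 2 * δ * ε ≤ (1 - 2 * δ) * ε / |D| := by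
    have : (1 - 2 * δ) * ε / |D| = ε * (1 / |D|) - 2 * δ * (ε * (1 / |D|)) := by ring
    rw [this]
    nlinarith
  have e4 : 2 * s ≤ κ := by
    rw [hs]
    have : 0 ≤ δ * M + δ := by positivity
    linarith
  have e5 : 2 * δ ≤ κ := by
    have h6 : δ ≤ δ * M + δ := by nlinarith
    have h7 : 2 * (δ * M + δ) ≤ 2 * (n + 1) * (δ * M + δ) := by
      have : (0 : ℝ) ≤ n := Nat.cast_nonneg n
      have : 0 ≤ δ * M + δ := by positivity
      nlinarith
    linarith
  have e6 := mul_le_mul_of_nonneg_right e4 h0.le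
  have e7 := mul_le_mul_of_nonneg_right e5 h0.le
  rw [abs_le]
  constructor <;> linarith

end IsShrinking

theorem abs_densityMeasure_sub_le' {φ₀ : ℝ → ℝ} {φ : BV} (hφ : φ.fn =ᵐ[leb] φ₀)
    (h0 : 0 ≤ᵐ[leb] φ.fn) {z : ℝ} (hφ_cont : ContinuousWithinAt φ₀ (Icc 0 1) z) {δ : ℝ}
    (hδ : 0 < δ) :
    ∃ V ∈ 𝓝[Icc 0 1] z, ∀ E ⊆ V, NullMeasurableSet E leb →
      |(densityMeasure φ₀).real E - φ₀ z * leb.real E| ≤ δ * leb.real E :=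
  ⟨{x | |φ₀ x - φ₀ z| < δ}, hφ_cont (Metric.ball_mem_nhds _ hδ), fun _ hEV hE =>
    abs_densityMeasure_sub_le hφ h0 hE fun _ hx _ => (hEV hx).le⟩

namespace IsShrinking

variable {z : ℝ} {a b : ℝ → ℝ} (hI : IsShrinking z a b)
include hI

theorem tendsto_densityMeasure_div {φ₀ : ℝ → ℝ} {φ : BV} (hφ : φ.fn =ᵐ[leb] φ₀)
    (h0 : 0 ≤ᵐ[leb] φ.fn) (hφ_cont : ContinuousWithinAt φ₀ (Icc 0 1) z)
    {E : ℝ → Set ℝ} (hE : ∀ᶠ ε in 𝓝[>] (0 : ℝ), NullMeasurableSet (E ε) leb)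
    (hsub : ∀ᶠ ε in 𝓝[>] (0 : ℝ), E ε ⊆ Icc (a ε) (b ε)) {w : ℝ}
    (hw : Tendsto (fun ε => leb.real (E ε) / ε) (𝓝[>] 0) (𝓝 w)) :
    Tendsto (fun ε => (densityMeasure φ₀).real (E ε) / ε) (𝓝[>] 0) (𝓝 (φ₀ z * w)) := by
  have h1 : Tendsto (fun ε => (densityMeasure φ₀).real (E ε) / ε - φ₀ z * (leb.real (E ε) / ε))
      (𝓝[>] 0) (𝓝 0) := by
    rw [Metric.tendsto_nhds]
    intro δ hδ
    obtain ⟨V, hV, h⟩ := abs_densityMeasure_sub_le' hφ h0 hφ_cont (half_pos hδ)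
    filter_upwards [hE, hsub, hI.eventually_subset hV, hI.eventually_leb_real, hI]
      with ε h2 h3 h4 h5 h6
    have h7 := h _ (h3.trans h4) h2
    have h8 : leb.real (E ε) ≤ ε := (measureReal_mono h3).trans h5.le
    rw [Real.dist_eq, sub_zero, ← mul_div_assoc, ← sub_div, abs_div, abs_of_pos h6.1,
      div_lt_iff₀ h6.1]
    have h9 := mul_le_mul_of_nonneg_left h8 (half_pos hδ).le
    have h10 := mul_pos hδ h6.1
    linarith
  have h2 := h1.add (hw.const_mul (φ₀ z))
  rw [zero_add] at h2
  exact h2.congr fun ε => by ring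

end IsShrinking

theorem leb_Icc_inter_pos {z u v : ℝ} (hz : z ∈ Icc (0 : ℝ) 1) (huv : u < v) (hv : v ≤ 1 / 2) :
    0 < leb.real {x | x ∈ Icc (0 : ℝ) 1 ∧ u < |x - z| ∧ |x - z| ≤ v} ∨ u < 0 := by
  rcases lt_or_ge u 0 with hu | hu
  · exact Or.inr hu
  refine Or.inl ?_
  have key : ∀ s t : ℝ, s < t → Ioo s t ⊆ {x | x ∈ Icc (0 : ℝ) 1 ∧ u < |x - z| ∧ |x - z| ≤ v} →
      0 < leb.real {x | x ∈ Icc (0 : ℝ) 1 ∧ u < |x - z| ∧ |x - z| ≤ v} := by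
    intro s t hst hsub
    refine lt_of_lt_of_le ?_ (measureReal_mono hsub)
    rw [measureReal_def, leb, Measure.restrict_apply measurableSet_Ioo,
      inter_eq_left.2 fun x hx => (hsub hx).1, Real.volume_Ioo,
      ENNReal.toReal_ofReal (by linarith)]
    linarith
  rcases le_total z (1 / 2) with h | h
  · refine key (z + u) (z + v) (by linarith) fun x hx => ?_
    have h1 : 0 ≤ x - z := by linarith [hx.1]
    rw [mem_ofPred_eq, abs_of_nonneg h1]
    exact ⟨⟨by linarith [hx.1, hz.1], by linarith [hx.2]⟩, by linarith [hx.1], by linarith [hx.2]⟩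
  · refine key (z - v) (z - u) (by linarith) fun x hx => ?_
    have h1 : x - z ≤ 0 := by linarith [hx.2]
    rw [mem_ofPred_eq, abs_of_nonpos h1]
    exact ⟨⟨by linarith [hx.1], by linarith [hx.2, hz.2]⟩, by linarith [hx.2], by linarith [hx.1]⟩

/-! ### Periodic points at which the density is positive -/

namespace IsPiecewiseExpanding

variable {T : ℝ → ℝ} {c d : ℕ → ℝ} (hT : IsPiecewiseExpanding T c d)
include hT

/-- A periodic point at which the invariant density is continuous and positive does not attract. -/
theorem one_le_abs_deriv {P : BV →L[ℝ] BV} (hP : IsTransferOperator T ∅ P) {φ₀ : ℝ → ℝ} {φ : BV}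
    (hφ : φ.fn =ᵐ[leb] φ₀) (h0 : 0 ≤ᵐ[leb] φ.fn) (hPφ : P φ = φ) {z : ℝ}
    (hz : z ∈ Icc (0 : ℝ) 1) (hφ_cont : ContinuousWithinAt φ₀ (Icc 0 1) z) (hpos : 0 < φ₀ z)
    {p : ℕ} {D : ℝ} (hper : T^[p] z = z) (hder : HasDerivWithinAt T^[p] D (Icc 0 1) z) :
    1 ≤ |D| := by
  by_contra! hD
  obtain ⟨V, hV, hVE⟩ := abs_densityMeasure_sub_le' hφ h0 hφ_cont (half_pos hpos)
  obtain ⟨r', hr', hrV⟩ := Metric.mem_nhdsWithin_iff.1 hV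
  set t : ℝ := (1 + |D|) / 2 with ht
  have ht1 : t < 1 := by rw [ht]; linarith
  have ht0 : 0 < t := by rw [ht]; linarith [abs_nonneg D]
  obtain ⟨r, hr, hG⟩ := exists_radius hper hder (show 0 < (1 - |D|) / 2 by linarith)
  obtain ⟨s, hs0, hs⟩ := exists_between (lt_min (lt_min hr hr') (by norm_num : (0 : ℝ) < 1 / 2))
  have hsr : s < r := hs.trans_le ((min_le_left _ _).trans (min_le_left _ _))
  have hsr' : s < r' := hs.trans_le ((min_le_left _ _).trans (min_le_right _ _))
  have hs2 : s < 1 / 2 := hs.trans_le (min_le_right _ _)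
  set J : ℝ → Set ℝ := fun s => {x | x ∈ Icc (0 : ℝ) 1 ∧ |x - z| ≤ s} with hJ
  have hdist : Measurable fun x : ℝ => |x - z| := by fun_prop
  have hJm : ∀ s, MeasurableSet (J s) := fun s =>
    measurableSet_Icc.inter (measurableSet_le hdist measurable_const)
  set E : Set ℝ := {x | x ∈ Icc (0 : ℝ) 1 ∧ t * s < |x - z| ∧ |x - z| ≤ s} with hE
  have hEm : MeasurableSet E :=
    measurableSet_Icc.inter ((measurableSet_lt measurable_const hdist).inter
      (measurableSet_le hdist measurable_const))
  have hts : t * s < s := by nlinarith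
  have hmapsp : MapsTo T^[p] (Icc 0 1) (Icc 0 1) := hT.mapsTo.iterate p
  -- If |D| < 1, the neighbourhood `J s` is mapped into `J (t * s)`. Invariance then leaves no mass
  -- in the annulus between them, contrary to positivity of the density near `z`.
  have hsub : J s ⊆ T^[p] ⁻¹' J (t * s) := by
    rintro x ⟨hx, hxs⟩
    refine ⟨hmapsp hx, ?_⟩
    have h1 := hG x hx (lt_of_le_of_lt hxs hsr)
    have h2 : T^[p] x - z = (T^[p] x - (z + D * (x - z))) + D * (x - z) := by ring
    rw [h2]
    refine (abs_add_le _ _).trans ?_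
    rw [abs_mul]
    have h3 := mul_le_mul_of_nonneg_left hxs ht0.le
    have h4 : t * |x - z| = (1 - |D|) / 2 * |x - z| + |D| * |x - z| := by rw [ht]; ring
    linarith
  have h1 : BV.setInt (J s) φ ≤ BV.setInt (J (t * s)) φ := by
    have h2 := hT.setInt_pow_apply hP p φ (hJm (t * s)).nullMeasurableSet
    have h3 : (P ^ p) φ = φ := by
      have h4 : ∀ n, (P ^ n) φ = φ := fun n => by
        induction n with
        | zero => simp
        | succ n ih =>
          rw [pow_succ]
          change (P ^ n) (P φ) = φ
          rw [hPφ, ih]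
      exact h4 p
    rw [h3] at h2
    rw [h2, BV.setInt_apply, BV.setInt_apply]
    exact setIntegral_mono_set φ.integrable.integrableOn (ae_restrict_of_ae h0) hsub.eventuallyLE
  have h2 : BV.setInt (J s) φ = BV.setInt (J (t * s)) φ + BV.setInt E φ := by
    have h3 : J s = J (t * s) ∪ E := by
      ext x
      simp only [hJ, hE, mem_union, mem_ofPred_eq]
      constructor
      · rintro ⟨hx, hxs⟩
        rcases le_or_gt |x - z| (t * s) with h | h
        · exact Or.inl ⟨hx, h⟩
        · exact Or.inr ⟨hx, h, hxs⟩
      · rintro (⟨hx, h⟩ | ⟨hx, -, h⟩)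
        · exact ⟨hx, by linarith⟩
        · exact ⟨hx, h⟩
    have h4 : Disjoint (J (t * s)) E := disjoint_left.2 fun x hx hx' => by
      have h5 := hx.2
      have h6 := hx'.2.1
      linarith
    simp only [BV.setInt_apply]
    rw [h3, setIntegral_union h4 hEm φ.integrable.integrableOn φ.integrable.integrableOn]
  have h3 := hVE E (fun x hx => hrV ⟨by
    rw [Metric.mem_ball, Real.dist_eq]
    exact lt_of_le_of_lt hx.2.2 hsr', hx.1⟩) hEm.nullMeasurableSet
  rw [← densityMeasure_congr hφ, densityMeasure_real h0 hEm.nullMeasurableSet] at h3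
  have h4 : 0 < leb.real E := (leb_Icc_inter_pos hz hts hs2.le).resolve_right (by
    have := mul_pos ht0 hs0
    linarith)
  have h5 := (abs_le.1 h3).1
  have h6 := mul_pos hpos h4
  linarith

end IsPiecewiseExpanding

end HoleEscape

/-! ### Existence, uniqueness and asymptotics of the leading eigenvalue -/

theorem mainTheorem2
    -- a mixing piecewise expanding map with invariant density `φ₀`
    (T : ℝ → ℝ) (c d : ℕ → ℝ) (hT : IsPiecewiseExpanding T c d)
    (φ₀ : ℝ → ℝ) (hφ_meas : AEMeasurable φ₀ leb) (hφ_nonneg : ∀ x ∈ Icc (0 : ℝ) 1, 0 ≤ φ₀ x)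
    (hmix : IsMixing T (densityMeasure φ₀))
    -- the point `z`
    (z : ℝ) (hz : z ∈ Icc (0 : ℝ) 1) (hφ_cont : ContinuousWithinAt φ₀ (Icc 0 1) z)
    (hreturn : ∀ k : ℕ, 1 ≤ k → ContinuousWithinAt T^[k] (Icc 0 1) z ∨
      ¬ MapClusterPt z (𝓝[Icc 0 1] z) T^[k])
    -- the holes `[a ε, b ε]`, of length `ε`, containing `z`
    (ε₁ : ℝ) (hε₁ : 0 < ε₁) (a b : ℝ → ℝ)
    (hI : ∀ ε ∈ Ioc 0 ε₁, 0 ≤ a ε ∧ a ε ≤ z ∧ z ≤ b ε ∧ b ε ≤ 1 ∧ b ε - a ε = ε)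
    -- if the density vanishes at `z`, it does so in a controlled way
    (hsmall : φ₀ z = 0 → ∃ C : ℝ, ∀ᶠ ε in 𝓝[>] (0 : ℝ),
      0 < densityMeasure φ₀ (Icc (a ε) (b ε)) ∧
      essVar ((Icc (a ε) (b ε)).indicator φ₀) ≤
        ENNReal.ofReal (C / ε) * densityMeasure φ₀ (Icc (a ε) (b ε))) :
    -- for small `ε` the leading eigenvalue exists and is unique
    (∀ᶠ ε in 𝓝[>] (0 : ℝ), ∃! l : ℝ, IsLeadingEigenvalue T (Icc (a ε) (b ε)) l) ∧
    ∀ lam : ℝ → ℝ, (∀ᶠ ε in 𝓝[>] (0 : ℝ), IsLeadingEigenvalue T (Icc (a ε) (b ε)) (lam ε)) →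
      -- `z` is not periodic
      ((∀ k : ℕ, 1 ≤ k → T^[k] z ≠ z) →
        Tendsto (fun ε => (1 - lam ε) / (densityMeasure φ₀).real (Icc (a ε) (b ε)))
          (𝓝[>] 0) (𝓝 1) ∧
        Tendsto (fun ε => (1 - lam ε) / ε) (𝓝[>] 0) (𝓝 (φ₀ z))) ∧
      -- `z` is periodic with (minimal) period `p`, and `D` is the derivative of `T ^ p` at `z`
      (∀ (p : ℕ) (D : ℝ), 0 < p → Function.minimalPeriod T z = p →
        HasDerivWithinAt T^[p] D (Icc 0 1) z →
        (D < 0 → ∀ η > 0, ∀ᶠ ε in 𝓝[>] (0 : ℝ),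
          z - a ε ≤ |D| * (b ε - z) + η * ε ∧ b ε - z ≤ |D| * (z - a ε) + η * ε) →
        (0 < φ₀ z →
          Tendsto (fun ε => (1 - lam ε) / (densityMeasure φ₀).real (Icc (a ε) (b ε)))
            (𝓝[>] 0) (𝓝 (1 - 1 / |D|))) ∧
        Tendsto (fun ε => (1 - lam ε) / ε) (𝓝[>] 0) (𝓝 (φ₀ z * (1 - 1 / |D|)))) := by
  have hI' : IsShrinking z a b := by
    filter_upwards [Ioc_mem_nhdsGT hε₁] with ε hε
    exact ⟨hε.1, hI ε hε⟩
  have hε0 : ∀ᶠ ε in 𝓝[>] (0 : ℝ), 0 < ε := self_mem_nhdsWithin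
  obtain ⟨P, φ, hP, hφ, hPφ, hpos, hint, -⟩ := hT.exists_exact hφ_meas hφ_nonneg hmix
  obtain ⟨K, ρ, R, ε₀, hK, hρ0, hρ1, hε₀, hesc⟩ :=
    hT.exists_escape_bound hφ_meas hφ_nonneg hmix
  set H : ℝ → Set ℝ := fun ε => Icc (a ε) (b ε) with hH
  set Δ : ℝ → ℝ := fun ε => (densityMeasure φ₀).real (H ε) with hΔ
  set q : ℕ → ℝ → ℝ := fun n ε =>
    (densityMeasure φ₀).real (H ε ∩ T ⁻¹' survivors T (H ε) n) with hq
  have hesc' : ∀ᶠ ε in 𝓝[>] (0 : ℝ), ∃ ν l : ℝ, IsLeadingEigenvalue T (H ε) l ∧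
      |l - 1| ≤ ε * R ∧ |ν - 1| ≤ ε * K ∧ ∀ (n : ℕ) (B : ℝ), 0 ≤ B →
        essVar ((H ε).indicator φ₀) ≤ ENNReal.ofReal B →
          |(1 - l) * ν - (l ^ n)⁻¹ * q n ε| ≤ ε * K * ρ ^ n * B := by
    filter_upwards [hI'.eventually_leb_real, Ioc_mem_nhdsGT hε₀] with ε h1 h2
    obtain ⟨l, ν, h3⟩ := hesc (H ε) ordConnected_Icc (h1.le.trans h2.2)
    rw [h1] at h3
    exact ⟨ν, l, h3⟩
  refine ⟨?_, fun lam hlam => ?_⟩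
  · filter_upwards [hesc'] with ε ⟨ν, l, h1, _⟩
    exact ⟨l, h1, fun l' h2 => h2.unique h1⟩
  have hesc'' : ∀ᶠ ε in 𝓝[>] (0 : ℝ), ∃ ν : ℝ, |lam ε - 1| ≤ ε * R ∧ |ν - 1| ≤ ε * K ∧
      ∀ (n : ℕ) (B : ℝ), 0 ≤ B → essVar ((H ε).indicator φ₀) ≤ ENNReal.ofReal B →
        |(1 - lam ε) * ν - (lam ε ^ n)⁻¹ * q n ε| ≤ ε * K * ρ ^ n * B := by
    filter_upwards [hesc', hlam] with ε ⟨ν, l, h1, h2⟩ h3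
    obtain rfl := h3.unique h1
    exact ⟨ν, h2⟩
  obtain ⟨ν, hν⟩ := hesc''.choice
  have hto1 : ∀ (f : ℝ → ℝ) (M : ℝ), (∀ᶠ ε in 𝓝[>] (0 : ℝ), |f ε - 1| ≤ ε * M) →
      Tendsto f (𝓝[>] 0) (𝓝 1) := fun f M h => by
    rw [tendsto_iff_norm_sub_tendsto_zero]
    refine squeeze_zero' (Eventually.of_forall fun _ => norm_nonneg _) h ?_
    have h1 : Tendsto (fun ε : ℝ => ε * M) (𝓝 0) (𝓝 (0 * M)) := tendsto_id.mul_const M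
    rw [zero_mul] at h1
    exact h1.mono_left nhdsWithin_le_nhds
  have hlam1 := hto1 lam R (hν.mono fun ε h => h.1)
  have hν1 := hto1 ν K (hν.mono fun ε h => h.2.1)
  -- the mass of the hole
  have hΔε : Tendsto (fun ε => Δ ε / ε) (𝓝[>] 0) (𝓝 (φ₀ z)) := by
    have h1 : Tendsto (fun ε => leb.real (H ε) / ε) (𝓝[>] 0) (𝓝 1) := by
      refine tendsto_const_nhds.congr' ?_
      filter_upwards [hI'.eventually_leb_real, hε0] with ε h1 h2
      rw [hH, h1, div_self h2.ne']
    simpa using hI'.tendsto_densityMeasure_div hφ hpos hφ_cont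
      (Eventually.of_forall fun ε => measurableSet_Icc.nullMeasurableSet)
      (Eventually.of_forall fun ε => Subset.rfl) h1
  -- the variation of the density restricted to the hole
  have hvar : ∃ C : ℝ, ∀ᶠ ε in 𝓝[>] (0 : ℝ), 0 < Δ ε ∧
      essVar ((H ε).indicator φ₀) ≤ ENNReal.ofReal (C / ε * Δ ε) := by
    have hz0 : 0 ≤ φ₀ z := hφ_nonneg z hz
    rcases hz0.eq_or_lt with h0 | h0
    · obtain ⟨C, hC⟩ := hsmall h0.symm
      have : IsFiniteMeasure (densityMeasure φ₀) := ⟨by simp [hmix.acip.prob]⟩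
      refine ⟨|C|, ?_⟩
      filter_upwards [hC, hε0] with ε ⟨h1, h2⟩ h3
      refine ⟨ENNReal.toReal_pos h1.ne' (measure_ne_top _ _), h2.trans ?_⟩
      have h4 : ENNReal.ofReal (Δ ε) = densityMeasure φ₀ (Icc (a ε) (b ε)) :=
        ENNReal.ofReal_toReal (measure_ne_top _ _)
      rw [ENNReal.ofReal_mul (by positivity), h4]
      gcongr
      exact le_abs_self C
    -- The variation over the hole is bounded while Δ ε exceeds ε φ₀(z)/2; the constant is the
    -- quotient of these two bounds.
    · refine ⟨3 * (‖φ‖ + 1) * (2 / φ₀ z), ?_⟩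
      filter_upwards [hΔε.eventually (lt_mem_nhds (half_lt_self h0)), hε0] with ε h1 h2
      have h3 : 0 < Δ ε / ε := (half_pos h0).trans h1
      refine ⟨(div_pos_iff_of_pos_right h2).1 h3, ?_⟩
      have h4 : essVar ((H ε).indicator φ₀) ≤ ENNReal.ofReal (3 * (‖φ‖ + 1)) := by
        refine (essVar_congr ?_).trans_le (essVar_indicator_le (H := H ε) ordConnected_Icc φ)
        filter_upwards [hφ] with x hx
        by_cases hxH : x ∈ H ε
        · rw [indicator_of_mem hxH, indicator_of_mem hxH, hx]
        · rw [indicator_of_notMem hxH, indicator_of_notMem hxH]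
      refine h4.trans (ENNReal.ofReal_le_ofReal ?_)
      have h5 : 3 * (‖φ‖ + 1) * (2 / φ₀ z) / ε * Δ ε =
          3 * (‖φ‖ + 1) * (2 / φ₀ z * (Δ ε / ε)) := by ring
      rw [h5]
      refine le_mul_of_one_le_right (by positivity) ?_
      rw [div_mul_eq_mul_div, le_div_iff₀ h0]
      linarith
  obtain ⟨C, hC⟩ := hvar
  have hΔpos : ∀ᶠ ε in 𝓝[>] (0 : ℝ), 0 < Δ ε := hC.mono fun ε h => h.1
  have hb : ∀ n, ∀ᶠ ε in 𝓝[>] (0 : ℝ),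
      |(1 - lam ε) * ν ε - (lam ε ^ n)⁻¹ * q n ε| ≤ K * |C| * ρ ^ n * Δ ε := fun n => by
    filter_upwards [hν, hC, hε0] with ε ⟨_, _, h1⟩ ⟨h2, h3⟩ h4
    -- The factor ε from the eigenfunctional cancels the 1/ε in the variation of the density over
    -- the hole, leaving an error proportional to Δ.
    have h5 := h1 n (|C| / ε * Δ ε) (by positivity) (h3.trans (ENNReal.ofReal_le_ofReal (by
      gcongr
      exact le_abs_self C)))
    refine h5.trans (le_of_eq ?_)
    field_simp
  have hprod : ∀ {θ : ℝ}, Tendsto (fun ε => (1 - lam ε) / Δ ε) (𝓝[>] 0) (𝓝 θ) →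
      Tendsto (fun ε => (1 - lam ε) / ε) (𝓝[>] 0) (𝓝 (φ₀ z * θ)) := fun {θ} h => by
    refine (hΔε.mul h).congr' ?_
    filter_upwards [hΔpos, hε0] with ε h1 h2
    field_simp
  refine ⟨fun hper => ?_, fun p D hp hper hder hneg => ?_⟩
  · have h1 : Tendsto (fun ε => (1 - lam ε) / Δ ε) (𝓝[>] 0) (𝓝 1) := by
      refine tendsto_div_of_bound hρ0 hρ1 hlam1 hν1 hΔpos hb (n₁ := 0) fun n _ => ?_
      refine tendsto_const_nhds.congr' ?_
      filter_upwards [hI'.eventually_no_escape hper hreturn n, hΔpos] with ε h1 h2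
      have h3 : q n ε = Δ ε := by
        simp only [hq, hΔ, hH]
        rw [h1]
      rw [h3, div_self h2.ne']
    refine ⟨h1, ?_⟩
    have h2 := hprod h1
    rwa [mul_one] at h2
  · have hpz : T^[p] z = z := by
      rw [← hper]; exact Function.iterate_minimalPeriod
    have hmain : 0 < φ₀ z →
        Tendsto (fun ε => (1 - lam ε) / Δ ε) (𝓝[>] 0) (𝓝 (1 - 1 / |D|)) := fun h0 => by
      have hD := hT.one_le_abs_deriv hP hφ hpos hPφ hz hφ_cont h0 hpz hder
      -- The proportion of points that do not return reaches its limiting value only once the first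
      -- possible return time p is included.
      refine tendsto_div_of_bound hρ0 hρ1 hlam1 hν1 hΔpos hb (n₁ := p) fun n hn => ?_
      have h1 : Tendsto (fun ε => leb.real (H ε ∩ T ⁻¹' survivors T (H ε) n) / ε) (𝓝[>] 0)
          (𝓝 (1 - 1 / |D|)) := by
        rw [Metric.tendsto_nhds]
        intro κ hκ
        filter_upwards [hI'.eventually_abs_leb_sub_le hT.mapsTo hreturn hp hper hder hD hneg hn
          (half_pos hκ), hε0] with ε h1 h2
        rw [Real.dist_eq, div_sub' h2.ne', abs_div, abs_of_pos h2, div_lt_iff₀ h2,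
          mul_comm ε]
        have := mul_pos hκ h2
        linarith
      have h2 := hI'.tendsto_densityMeasure_div hφ hpos hφ_cont
        (E := fun ε => H ε ∩ T ⁻¹' survivors T (H ε) n)
        (Eventually.of_forall fun ε => measurableSet_Icc.nullMeasurableSet.inter
          (hT.nullMeasurableSet_preimage (hT.nullMeasurableSet_survivors ordConnected_Icc n)))
        (Eventually.of_forall fun ε => inter_subset_left) h1
      have h3 := h2.div hΔε h0.ne'
      rw [mul_div_cancel_left₀ _ h0.ne'] at h3
      refine h3.congr' ?_
      filter_upwards [hε0] with ε h4
      exact div_div_div_cancel_right₀ h4.ne' _ _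
    refine ⟨hmain, ?_⟩
    rcases (hφ_nonneg z hz).eq_or_lt with h0 | h0
    -- Where φ₀(z) = 0 the lower bound for |D| is not available. The estimate at n = 0 gives 1 − λ =
    -- O(Δ ε), and Δ ε = o(ε).
    · have h1 : ∀ᶠ ε in 𝓝[>] (0 : ℝ), |(1 - lam ε) * ν ε - Δ ε| ≤ K * |C| * Δ ε := by
        filter_upwards [hb 0] with ε h1
        have h2 : q 0 ε = Δ ε := by
          have h3 : H ε ∩ T ⁻¹' survivors T (H ε) 0 = H ε :=
            inter_eq_left.2 fun x _ j hj => absurd hj (Nat.not_lt_zero j)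
          simp only [hq, hΔ]
          rw [h3]
        rwa [pow_zero, pow_zero, inv_one, one_mul, mul_one, h2] at h1
      have h2 := eventually_abs_le_of_bound hν1 hΔpos h1
      rw [← h0, zero_mul]
      rw [← h0] at hΔε
      have h3 := hΔε.const_mul (2 * (K * |C| + 1))
      rw [mul_zero] at h3
      refine squeeze_zero_norm' ?_ h3
      filter_upwards [h2, hε0] with ε h4 h5
      rw [norm_div, Real.norm_eq_abs, Real.norm_of_nonneg h5.le, ← mul_div_assoc]
      gcongr
    · exact hprod (hmain h0)
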